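/- **Setting.** Let $t=(t^{(1)},t^{(2)},t^{(3)})$ with $t^{(i)}=(t^{(i)}_1,t^{(i)}_2,\dots)$, write $\bm m=(m_1,m_2)\in\mathbb Z^2$, $\bm e_1=(1,0)$, $\bm e_2=(0,1)$, $\bm e=\bm e_1+\bm e_2$, $\xi(x,z)=\sum_{k\ge1}x_kz^k$, $[z]=(z,z^2/2,z^3/3,\dots)$, and let $t\pm[z]_i$ denote $t$ with $t^{(i)}$ replaced by $t^{(i)}\pm[z]$. Let $\widetilde\tau_{\bm m}\in\mathbb C[[t]]$ $(\bm m\in\mathbb Z^2)$ be nonzero formal power series that satisfy the bilinear equation of the 3-KP hierarchy: for all $\bm m,\bm m'$, $$\oint_{C_R}\frac{dz}{2\pi i}z^{m_1-m_1'}e^{\xi(t^{(1)}-t'^{(1)},z)}\widetilde\tau_{\bm m}(t-[z^{-1}]_1)\widetilde\tau_{\bm m'}(t'+[z^{-1}]_1)=\oint_{C_r}\frac{dz}{2\pi i}z^{m_2-m_2'}e^{\xi(t^{(2)}-t'^{(2)},z^{-1})}\widetilde\tau_{\bm m+\bm e}(t-[z]_2)\widetilde\tau_{\bm m'-\bm e}(t'+[z]_2)$$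 $$\qquad+\oint_{C_r}\frac{dz}{2\pi i}(-1)^{m_2+m_2'}z^{m_1-m_2-m_1'+m_2'}e^{\xi(t^{(3)}-t'^{(3)},z^{-1})}\widetilde\tau_{\bm m+\bm e_1}(t-[z]_3)\widetilde\tau_{\bm m'-\bm e_1}(t'+[z]_3),$$ where $\oint_{C_R}$ and $\oint_{C_r}$ denote the coefficient of $z^{-1}$ of the formal expansion at $z=\infty$ and at $z=0$ respectively. **Operators.** Let $\mathcal B$ be the ring of functions of $\bm m\in\mathbb Z^2$ with values in the fraction field of $\mathbb C[[t]]$, and let $\Lambda_i$ be the shift $f(\bm m)\mapsto f(\bm m+\bm e_i)$, so that $\Lambda_i f(\bm m)=f(\bm m+\bm e_i)\Lambda_i$ in products of operators. Time derivatives act on the coefficients of operators. Put $$S_1=\sum_{k\ge0}a^{(1)}_k\Lambda_1^{-k},\quad S_2=\sum_{k\ge0}a^{(2)}_k\Lambda_2^{k},\quad S_3(\Lambda_1)=\sum_{k\ge0}a_k^{(3)}\Lambda_1^k,\quad S_3(\Lambda_2^{-1})=\sum_{k\ge0}a_k^{(3)}\Lambda_2^{-k},$$ $$\sum_k a^{(1)}_kz^{-k}=\frac{\widetilde\tau_{\bm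 m}(t-[z^{-1}]_1)}{\widetilde\tau_{\bm m}(t)},\quad \sum_k a^{(2)}_kz^{k}=\frac{\widetilde\tau_{\bm m+\bm e}(t-[z]_2)}{\widetilde\tau_{\bm m}(t)},\quad \sum_k a^{(3)}_kz^{k}=(-1)^{m_2}\frac{\widetilde\tau_{\bm m+\bm e_1}(t-[z]_3)}{\widetilde\tau_{\bm m}(t)}.$$ For $\alpha=1,2$ let $\mathcal E^{0,\pm}_{(\alpha)}=\mathcal B((\Lambda_\alpha^{\mp1}))$ and let $\mathcal E^{\pm}_{(\alpha)}=\mathcal E^{0,\pm}_{(\alpha)}[\Lambda_{3-\alpha},\Lambda_{3-\alpha}^{-1}]$ (Laurent polynomials in the other shift). The Lax operators are $$L_1(\Lambda_1)=S_1\Lambda_1S_1^{-1},\quad L_2(\Lambda_2)=S_2\Lambda_2^{-1}S_2^{-1},\quad L_3(\Lambda_1)=S_3(\Lambda_1)\Lambda_1^{-1}S_3(\Lambda_1)^{-1},\quad L_3(\Lambda_2^{-1})=S_3(\Lambda_2^{-1})\Lambda_2S_3(\Lambda_2^{-1})^{-1},$$ with inverses taken in $\mathcal E^{0,+}_{(1)},\mathcal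 E^{0,-}_{(2)},\mathcal E^{0,-}_{(1)},\mathcal E^{0,+}_{(2)}$ respectively. For $k\ge1$ put $$B^{(1)}_k(\Lambda_1)=(L_1^k)_{\ge0},\quad B^{(3)}_k(\Lambda_1)=(L_3(\Lambda_1)^k)_{<0},\quad B_k^{(2)}(\Lambda_2)=(L_2^k)_{\Delta_2^*,\ge1},\quad B_k^{(3)}(\Lambda_2^{-1})=(L_3(\Lambda_2^{-1})^k)_{\Delta_2,\ge1}.$$ The first two are the parts of the indicated orders in $\Lambda_1$; the last two are the parts of order at least $1$ in the expansions in powers of $\Delta_2^*=\Lambda_2^{-1}-1$ and $\Delta_2=\Lambda_2-1$, in which negative powers of $\Delta+1$ are expanded in negative powers of $\Delta$. Finally let $$H=\Lambda_1\Delta_2+\rho,\qquad \rho=\frac{\widetilde\tau_{\bm m}}{\widetilde\tau_{\bm m+\bm e_1}}\frac{\widetilde\tau_{\bm m+\bm e+\bm e_1}}{\widetilde\tau_{\bm m+\bm e}}.$$ **Theorem.** The inverses above exist and are unique, the four operators $B$ are Laurent polynomials in the shifts, and $\mathcal E^{\pm}_{(\alpha)}=\mathcal E^{0,\pm}_{(\alpha)}\oplus\mathcal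 E^{\pm}_{(\alpha)}H$ for $\alpha=1,2$, which defines projections $\pi_\alpha^\pm:\mathcal E^{\pm}_{(\alpha)}\to\mathcal E^{0,\pm}_{(\alpha)}$. For every $k\ge1$ the following Lax equations hold. * $t^{(1)}_k$-flow: $$\partial_{t_k^{(1)}}L_1(\Lambda_1)=[B_k^{(1)}(\Lambda_1),L_1(\Lambda_1)],\qquad \partial_{t_k^{(1)}}L_2(\Lambda_2)=[\pi_2^-(B_k^{(1)}(\Lambda_1)),L_2(\Lambda_2)],$$ $$\partial_{t_k^{(1)}}L_3(\Lambda_1)=[B_k^{(1)}(\Lambda_1),L_3(\Lambda_1)],\qquad \partial_{t_k^{(1)}}L_3(\Lambda_2^{-1})=[\pi_2^+(B_k^{(1)}(\Lambda_1)),L_3(\Lambda_2^{-1})].$$ * $t^{(2)}_k$-flow: $$\partial_{t_k^{(2)}}L_1(\Lambda_1)=[\pi_1^+(B_k^{(2)}(\Lambda_2)),L_1(\Lambda_1)],\qquad \partial_{t_k^{(2)}}L_2(\Lambda_2)=[B_k^{(2)}(\Lambda_2),L_2(\Lambda_2)],$$ $$\partial_{t_k^{(2)}}L_3(\Lambda_1)=[\pi_1^-(B_k^{(2)}(\Lambda_2)),L_3(\Lambda_1)],\qquad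 \partial_{t_k^{(2)}}L_3(\Lambda_2^{-1})=[B_k^{(2)}(\Lambda_2),L_3(\Lambda_2^{-1})].$$ * $t^{(3)}_k$-flow, in terms of $\Lambda_1$: $$\partial_{t_k^{(3)}}L_1(\Lambda_1)=[B_k^{(3)}(\Lambda_1),L_1(\Lambda_1)],\qquad \partial_{t_k^{(3)}}L_2(\Lambda_2)=[\pi_2^-(B_k^{(3)}(\Lambda_1)),L_2(\Lambda_2)],$$ $$\partial_{t_k^{(3)}}L_3(\Lambda_1)=[B_k^{(3)}(\Lambda_1),L_3(\Lambda_1)],\qquad \partial_{t_k^{(3)}}L_3(\Lambda_2^{-1})=[\pi_2^+(B_k^{(3)}(\Lambda_1)),L_3(\Lambda_2^{-1})].$$ * $t^{(3)}_k$-flow, in terms of $\Lambda_2$: $$\partial_{t_k^{(3)}}L_1(\Lambda_1)=[\pi_1^+(B_k^{(3)}(\Lambda_2^{-1})),L_1(\Lambda_1)],\qquad \partial_{t_k^{(3)}}L_2(\Lambda_2)=[B_k^{(3)}(\Lambda_2^{-1}),L_2(\Lambda_2)],$$ $$\partial_{t_k^{(3)}}L_3(\Lambda_1)=[\pi_1^-(B_k^{(3)}(\Lambda_2^{-1})),L_3(\Lambda_1)],\qquad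 \partial_{t_k^{(3)}}L_3(\Lambda_2^{-1})=[B_k^{(3)}(\Lambda_2^{-1}),L_3(\Lambda_2^{-1})].$$ -/

import Mathlib

noncomputable section

namespace ThreeKP

/-! ### Times, formal functions of the times, and derivations

The three families of times `t^(1), t^(2), t^(3)` are numbered by `Fin 3` and the two discrete
variables `m_1, m_2` (and the shifts `Λ_1, Λ_2`) by `Fin 2`; in both cases the index `0` stands
for the first one. -/

/-- `(i, k)` is the index of the time variable `t_k^{(i+1)}`, `k ≥ 1`. -/
abbrev TimeIdx : Type := Fin 3 × ℕ+

/-- Formal power series in all the times `t = (t^(1), t^(2), t^(3))`. -/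
abbrev TSeries : Type := MvPowerSeries TimeIdx ℂ

/-- Formal power series in two independent copies `t`, `t'` of the times
(`Sum.inl` for `t`, `Sum.inr` for `t'`). -/
abbrev TSeries₂ : Type := MvPowerSeries (TimeIdx ⊕ TimeIdx) ℂ

/-- The field of fractions of the ring of formal power series in `t`. -/
abbrev TField : Type := FractionRing TSeries

/-- The embedding of power series in their field of fractions. -/
def ι : TSeries →+* TField := algebraMap TSeries TField

/-- `∂/∂t_s` on the field of fractions, by the quotient rule. -/
def dt (s : TimeIdx) (x : TField) : TField :=
  let p := IsLocalization.sec (nonZeroDivisors TSeries) x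
  (ι (MvPowerSeries.pderiv ℂ s p.1) * ι p.2 - ι p.1 * ι (MvPowerSeries.pderiv ℂ s p.2)) /
    ι p.2 ^ 2

/-- The quotient rule holds for every way of writing an element as a fraction, so `dt s` does not
depend on the choice made in its definition. -/
theorem dt_div (s : TimeIdx) (a b : TSeries) (hb : b ≠ 0) :
    dt s (ι a / ι b) =
      (ι (MvPowerSeries.pderiv ℂ s a) * ι b - ι a * ι (MvPowerSeries.pderiv ℂ s b)) /
        ι b ^ 2 := by
  have inj : Function.Injective ι := IsFractionRing.injective TSeries TField
  have ne : ∀ c : TSeries, c ≠ 0 → ι c ≠ 0 := fun c hc h => hc (inj (by simpa using h))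
  unfold dt
  obtain ⟨p, hp⟩ : ∃ p, p = IsLocalization.sec (nonZeroDivisors TSeries) (ι a / ι b) := ⟨_, rfl⟩
  simp only [← hp]
  have hs := IsLocalization.sec_spec (nonZeroDivisors TSeries) (ι a / ι b)
  rw [← hp] at hs
  change ι a / ι b * ι p.2 = ι p.1 at hs
  have hq0 : (p.2 : TSeries) ≠ 0 := nonZeroDivisors.ne_zero p.2.2
  have hq := ne _ hq0
  have hb' := ne _ hb
  have e : a * p.2 = b * p.1 := by
    apply inj
    rw [map_mul, map_mul, ← hs]
    field_simp
  have e2 := congrArg (fun f => ι (MvPowerSeries.pderiv ℂ s f)) e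
  have e1 := congrArg ι e
  simp only [Derivation.leibniz, smul_eq_mul, map_add, map_mul] at e2 e1
  rw [div_eq_div_iff (pow_ne_zero 2 hq) (pow_ne_zero 2 hb')]
  linear_combination (-ι b * ι p.2) * e2 +
    (ι b * ι (MvPowerSeries.pderiv ℂ s p.2) + ι p.2 * ι (MvPowerSeries.pderiv ℂ s b)) * e1

/-! ### The bilinear equation -/

/-- The series to be substituted for the times in order to form `f (t + c [w]_i)`, where
`[w] = (w, w²/2, w³/3, …)`. The variable `w` is `none`. -/
def miwaArg (i : Fin 3) (c : ℂ) (s : TimeIdx) : MvPowerSeries (Option TimeIdx) ℂ :=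
  MvPowerSeries.X (some s) +
    if s.1 = i then MvPowerSeries.C (c / ((s.2 : ℕ) : ℂ)) * MvPowerSeries.X none ^ (s.2 : ℕ)
    else 0

/-- This substitution is admissible for formal power series. -/
theorem miwaArg_hasSubst (i : Fin 3) (c : ℂ) : MvPowerSeries.HasSubst (miwaArg i c) where
  const_coeff s := by
    have h : (s.2 : ℕ) ≠ 0 := s.2.ne_zero
    unfold miwaArg
    split_ifs <;> simp [h]
  coeff_zero d := by
    classical
    refine Set.Finite.subset
      (s := {s | Finsupp.single (some s) 1 = d} ∪
        {s | s.1 = i ∧ Finsupp.single none (s.2 : ℕ) = d}) (Set.Finite.union ?_ ?_) ?_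
    · refine Set.Subsingleton.finite fun x hx y hy => ?_
      have hxy := (Set.mem_ofPred_eq ▸ hx).trans (Set.mem_ofPred_eq ▸ hy).symm
      simpa using Finsupp.single_left_injective one_ne_zero hxy
    · refine Set.Subsingleton.finite fun x hx y hy => ?_
      have hxy := Finsupp.single_injective _ (hx.2.trans hy.2.symm)
      exact Prod.ext (hx.1.trans hy.1.symm) (PNat.coe_injective hxy)
    · intro s hs
      by_contra hn
      simp only [Set.mem_union, Set.mem_ofPred_eq, not_or, not_and] at hn
      apply hs
      unfold miwaArg
      split_ifs with h
      · rw [map_add, MvPowerSeries.coeff_X, if_neg (Ne.symm hn.1), MvPowerSeries.coeff_C_mul,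
          MvPowerSeries.coeff_X_pow, if_neg (Ne.symm (hn.2 h))]
        simp
      · rw [add_zero, MvPowerSeries.coeff_X, if_neg (Ne.symm hn.1)]

/-- The coefficient of `w^n`, a power series in `t`, of a power series in `t` and `w`. -/
def wCoeff (n : ℕ) (F : MvPowerSeries (Option TimeIdx) ℂ) : TSeries := fun d =>
  MvPowerSeries.coeff (Finsupp.embDomain Function.Embedding.some d + Finsupp.single none n) F

/-- `f (t + c [w]_i)` as a power series in `w` whose coefficients are power series in `t`. -/
def miwa (i : Fin 3) (c : ℂ) (f : TSeries) : PowerSeries TSeries :=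
  PowerSeries.mk fun n => wCoeff n (MvPowerSeries.subst (miwaArg i c) f)

/-- `exp (ξ(t^{(i)} - t'^{(i)}, w))` with `ξ(x, w) = ∑_{k ≥ 1} x_k w^k`, as a power series
in `w`. -/
def expXi (i : Fin 3) : PowerSeries TSeries₂ :=
  (PowerSeries.exp ℂ).subst
    (PowerSeries.mk fun k : ℕ =>
      if h : 0 < k then
        (MvPowerSeries.X (Sum.inl (i, ⟨k, h⟩)) - MvPowerSeries.X (Sum.inr (i, ⟨k, h⟩)) : TSeries₂)
      else 0 : PowerSeries TSeries₂)

/-- `f (t - [w]_i) * g (t' + [w]_i)` as a power series in `w`. -/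
def miwaProd (i : Fin 3) (f g : TSeries) : PowerSeries TSeries₂ :=
  PowerSeries.map
      (MvPowerSeries.rename (R := ℂ)
        (Function.Embedding.inl : TimeIdx ↪ TimeIdx ⊕ TimeIdx)).toRingHom
      (miwa i (-1) f) *
    PowerSeries.map
      (MvPowerSeries.rename (R := ℂ)
        (Function.Embedding.inr : TimeIdx ↪ TimeIdx ⊕ TimeIdx)).toRingHom
      (miwa i 1 g)

/-- For `E(w) = ∑ E_a w^a` and `F(w) = ∑ F_b w^b`, the coefficient of `w^s` in `E(w) F(w⁻¹)`,
i.e. `∑_{a - b = s} E_a F_b`. The sum is taken coefficientwise in `t, t'`; it is locally finite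
for `E = expXi i`, because the coefficient of `w^a` in that series has only terms of weight `a`. -/
def laurentCoeff (s : ℤ) (E F : PowerSeries TSeries₂) : TSeries₂ :=
  fun d => ∑ᶠ p : ℕ × ℕ,
    if (p.1 : ℤ) - (p.2 : ℤ) = s then
      MvPowerSeries.coeff d (PowerSeries.coeff p.1 E * PowerSeries.coeff p.2 F)
    else 0

/-- `∮_{C_R} dz/(2πi) z^a E(z) F(z⁻¹)` (expansion at `z = ∞`). -/
def resInfty (a : ℤ) (E F : PowerSeries TSeries₂) : TSeries₂ := laurentCoeff (-1 - a) E F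

/-- `∮_{C_r} dz/(2πi) z^a E(z⁻¹) F(z)` (expansion at `z = 0`). -/
def resZero (a : ℤ) (E F : PowerSeries TSeries₂) : TSeries₂ := laurentCoeff (a + 1) E F

/-- The lattice `ℤ²` of the discrete variables `m = (m_1, m_2)`. -/
abbrev Lattice : Type := Fin 2 → ℤ

/-- `e_1 = (1, 0)`. -/
def e₁ : Lattice := ![1, 0]

/-- `e = e_1 + e_2 = (1, 1)`. -/
def e : Lattice := ![1, 1]

/-- The tau functions (in the sign convention of the functions `τ̃`) of the 3-KP hierarchy: nonzero
families of power series that satisfy the bilinear equation. -/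
structure IsTau (τ : Lattice → TSeries) : Prop where
  ne_zero : ∀ m, τ m ≠ 0
  bilinear : ∀ m m' : Lattice,
    resInfty (m 0 - m' 0) (expXi 0) (miwaProd 0 (τ m) (τ m')) =
      resZero (m 1 - m' 1) (expXi 1) (miwaProd 1 (τ (m + e)) (τ (m' - e))) +
      ((Int.negOnePow (m 1 + m' 1) : ℤ) : TSeries₂) *
        resZero (m 0 - m 1 - m' 0 + m' 1) (expXi 2) (miwaProd 2 (τ (m + e₁)) (τ (m' - e₁)))

/-! ### Formal operators in two shifts -/

/-- A formal operator `∑_{j ∈ ℤ²} a_j(m) Λ_1^{j_1} Λ_2^{j_2}`: `A j m` is the value at `m` of the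
coefficient of `Λ_1^{j_1} Λ_2^{j_2}`, an element of the field of fractions of the power series
in `t`. -/
def Op : Type := Lattice → Lattice → TField

namespace Op

instance : AddCommGroup Op := inferInstanceAs (AddCommGroup (Lattice → Lattice → TField))

/-- Multiplication by a function of `m` and `t`. -/
def ofFun (f : Lattice → TField) : Op := fun j m => if j = 0 then f m else 0

instance : One Op := ⟨ofFun fun _ => 1⟩

/-- The operator product, `(a Λ^k) (b Λ^l) = a(m) b(m + k) Λ^{k + l}`. All products that are used
below are products of two operators for which only finitely many terms contribute to each
coefficient. -/
instance : Mul Op := ⟨fun A B j m => ∑ᶠ k : Lattice, A k m * B (j - k) (m + k)⟩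

/-- The powers `A^n`. -/
def pow (A : Op) : ℕ → Op
  | 0 => 1
  | n + 1 => pow A n * A

/-- The commutator `[A, B] = A B - B A`. -/
def comm (A B : Op) : Op := A * B - B * A

/-- The shift power `Λ_{α+1}^n`. -/
def Lam (α : Fin 2) (n : ℤ) : Op := fun j _ => if j = Pi.single α n then 1 else 0

/-- The derivative with respect to the time `t_s` of the coefficients. -/
def deriv (s : TimeIdx) (A : Op) : Op := fun j m => dt s (A j m)

/-- The operator `∑_{n ≥ 0} a_n(m) Λ_{α+1}^{δ n}`, `δ = ±1`. -/
def series (α : Fin 2) (δ : ℤˣ) (a : ℕ → Lattice → TField) : Op := fun j m =>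
  if (∀ β, β ≠ α → j β = 0) ∧ 0 ≤ (δ : ℤ) * j α then a ((δ : ℤ) * j α).toNat m else 0

/-- The part `A_{α+1, P}` of `A` of the terms whose order in `Λ_{α+1}` has the property `P`. -/
def part (α : Fin 2) (P : ℤ → Prop) (A : Op) : Op :=
  open scoped Classical in fun j m => if P (j α) then A j m else 0

/-- The coefficient of `Δ^k`, `k ≥ 0`, in the expansion of an operator `A` in `Λ_{α+1}` alone in
powers of `Δ = Q - 1`, where `Q = Λ_{α+1}^δ`. Here `Q^n = ∑_k (n choose k) Δ^k` for `n ≥ 0`, while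
for `n < 0` the power `Q^n` is expanded in negative powers of `Δ` only. -/
def deltaCoeff (α : Fin 2) (δ : ℤˣ) (A : Op) (k : ℕ) (m : Lattice) : TField :=
  ∑ᶠ n : ℕ, ((n.choose k : ℕ) : TField) * A (Pi.single α ((δ : ℤ) * (n : ℤ))) m

/-- The part `A_{Δ, ≥ 1} = ∑_{k ≥ 1} d_k Δ^k` of `A = ∑_k d_k Δ^k`, where `Δ = Λ_{α+1}^δ - 1`,
written in powers of `Q = Λ_{α+1}^δ` by means of `Δ^k = ∑_l (-1)^{k-l} (k choose l) Q^l`. -/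
def deltaPartPos (α : Fin 2) (δ : ℤˣ) (A : Op) : Op :=
  series α δ fun l m => ∑ᶠ k : ℕ,
    if 1 ≤ k then (-1) ^ (k + l) * ((k.choose l : ℕ) : TField) * deltaCoeff α δ A k m else 0

/-- The Laurent polynomials in `Λ_1` and `Λ_2`. -/
def IsLaurentPoly (A : Op) : Prop := ∃ N : ℤ, ∀ j, A j ≠ 0 → ∀ α, |j α| ≤ N

/-- The ring `𝓔^{0,ε}_{(α+1)}` of the Laurent series in `Λ_{α+1}⁻¹` (for `ε = 1`) or in
`Λ_{α+1}` (for `ε = -1`), without the other shift. -/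
def IsSeries (α : Fin 2) (ε : ℤˣ) (A : Op) : Prop :=
  ∃ N : ℤ, ∀ j, A j ≠ 0 → (∀ β, β ≠ α → j β = 0) ∧ (ε : ℤ) * j α ≤ N

/-- The ring `𝓔^ε_{(α+1)}` of the Laurent polynomials in the other shift with coefficients in
`𝓔^{0,ε}_{(α+1)}`. -/
def IsMixed (α : Fin 2) (ε : ℤˣ) (A : Op) : Prop :=
  ∃ N : ℤ, ∀ j, A j ≠ 0 → (∀ β, β ≠ α → |j β| ≤ N) ∧ (ε : ℤ) * j α ≤ N

/-- `T` is the inverse of `S` in `𝓔^{0,ε}_{(α+1)}`. -/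
def IsInv (α : Fin 2) (ε : ℤˣ) (S T : Op) : Prop :=
  IsSeries α ε T ∧ S * T = 1 ∧ T * S = 1

/-- The inverse of `S` in `𝓔^{0,ε}_{(α+1)}`. -/
def inv (α : Fin 2) (ε : ℤˣ) (S : Op) : Op :=
  haveI : Nonempty Op := ⟨1⟩
  Classical.epsilon (IsInv α ε S)

end Op

open Op

/-! ### Wave operators, Lax operators and projections -/

section Lax

variable (τ : Lattice → TSeries)

/-- `S_1(Λ_1) = ∑_k a_k Λ_1^{-k}` with `∑_k a_k z^{-k} = τ_m(t - [z⁻¹]_1) / τ_m(t)`. -/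
def S₁ : Op := series 0 (-1) fun k m => ι (PowerSeries.coeff k (miwa 0 (-1) (τ m))) / ι (τ m)

/-- `S_2(Λ_2) = ∑_k a_k Λ_2^k` with `∑_k a_k z^k = τ_{m+e}(t - [z]_2) / τ_m(t)`. -/
def S₂ : Op := series 1 1 fun k m => ι (PowerSeries.coeff k (miwa 1 (-1) (τ (m + e)))) / ι (τ m)

/-- The coefficients `a_k` with `∑_k a_k z^k = (-1)^{m_2} τ_{m+e_1}(t - [z]_3) / τ_m(t)`. -/
def a₃ (k : ℕ) (m : Lattice) : TField :=
  ((Int.negOnePow (m 1) : ℤ) : TField) *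
    (ι (PowerSeries.coeff k (miwa 2 (-1) (τ (m + e₁)))) / ι (τ m))

/-- `S_3(Λ_1) = ∑_k a_k Λ_1^k`. -/
def S₃ : Op := series 0 1 (a₃ τ)

/-- `S_3(Λ_2⁻¹) = ∑_k a_k Λ_2^{-k}`, with the same coefficients. -/
def S₃' : Op := series 1 (-1) (a₃ τ)

/-- `L_1(Λ_1) = S_1 Λ_1 S_1⁻¹`. -/
def L₁ : Op := S₁ τ * Lam 0 1 * inv 0 1 (S₁ τ)

/-- `L_2(Λ_2) = S_2 Λ_2⁻¹ S_2⁻¹`. -/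
def L₂ : Op := S₂ τ * Lam 1 (-1) * inv 1 (-1) (S₂ τ)

/-- `L_3(Λ_1) = S_3(Λ_1) Λ_1⁻¹ S_3(Λ_1)⁻¹`. -/
def L₃ : Op := S₃ τ * Lam 0 (-1) * inv 0 (-1) (S₃ τ)

/-- `L_3(Λ_2⁻¹) = S_3(Λ_2⁻¹) Λ_2 S_3(Λ_2⁻¹)⁻¹`. -/
def L₃' : Op := S₃' τ * Lam 1 1 * inv 1 1 (S₃' τ)

/-- `B_k^{(1)}(Λ_1) = (L_1^k)_{1, ≥ 0}`. -/
def B₁ (k : ℕ+) : Op := part 0 (fun n => 0 ≤ n) (pow (L₁ τ) k)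

/-- `B_k^{(2)}(Λ_2) = (L_2^k)_{Δ_2^*, ≥ 1}`, where `Δ_2^* = Λ_2⁻¹ - 1`. -/
def B₂ (k : ℕ+) : Op := deltaPartPos 1 (-1) (pow (L₂ τ) k)

/-- `B_k^{(3)}(Λ_1) = (L_3(Λ_1)^k)_{1, < 0}`. -/
def B₃ (k : ℕ+) : Op := part 0 (fun n => n < 0) (pow (L₃ τ) k)

/-- `B_k^{(3)}(Λ_2⁻¹) = (L_3(Λ_2⁻¹)^k)_{Δ_2, ≥ 1}`, where `Δ_2 = Λ_2 - 1`. -/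
def B₃' (k : ℕ+) : Op := deltaPartPos 1 1 (pow (L₃' τ) k)

/-- `ρ(m) = τ_m τ_{m+e+e_1} / (τ_{m+e_1} τ_{m+e})`. -/
def ρ (m : Lattice) : TField :=
  ι (τ m) / ι (τ (m + e₁)) * (ι (τ (m + e + e₁)) / ι (τ (m + e)))

/-- `H = Λ_1 Δ_2 + ρ`, where `Δ_2 = Λ_2 - 1`. -/
def H : Op := Lam 0 1 * (Lam 1 1 - 1) + ofFun (ρ τ)

/-- `P` is the component of `A` in `𝓔^{0,ε}_{(α+1)}` for the decomposition
`𝓔^ε_{(α+1)} = 𝓔^{0,ε}_{(α+1)} ⊕ 𝓔^ε_{(α+1)} H`. -/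
def IsProj (α : Fin 2) (ε : ℤˣ) (A P : Op) : Prop :=
  IsSeries α ε P ∧ ∃ Q : Op, IsMixed α ε Q ∧ A = P + Q * H τ

/-- The projection `π_{α+1}^ε : 𝓔^ε_{(α+1)} → 𝓔^{0,ε}_{(α+1)}`. -/
def proj (α : Fin 2) (ε : ℤˣ) (A : Op) : Op :=
  haveI : Nonempty Op := ⟨1⟩
  Classical.epsilon (IsProj τ α ε A)

end Lax

end ThreeKP

end

/-!
The three quotients of tau functions, multiplied by the exponential factors, are wave functions
`ψ_j(m; z)`, which have duals `ψ*_j(m'; z)` obtained from the opposite shifts of the times. Both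
sides of the bilinear equation pair wave functions at `m` with duals at `m'`. Restricted to
`t' = t`, where the exponential factors disappear, the equation and its derivatives with respect to
`t` become `⟨U_1, ψ*_1(m')⟩ = ⟨U_2, ψ*_2(m')⟩ + ⟨U_3, ψ*_3(m')⟩` for all `m'`, with `U` the triple
of wave functions at `m` or its time derivative; by linearity this relation persists when a Laurent
polynomial in the shifts is applied to `U`.

As `m'` varies, the leading exponents of the duals run through `ℤ`, so the pairings are
triangular, and a triple `U` that satisfies the relation and starts beyond the leading orders of
the wave functions vanishes. Applied to `U = H ψ`, this gives `H ψ = 0`: the value of `ρ` is what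
makes the leading coefficients cancel. Applied to `U = ∂ψ - B ψ`, it gives `∂ψ = B ψ` for each of
the four families of operators `B`, whose truncations are what controls the leading orders of the
difference.

Since `H` kills the wave functions, `B` can be replaced by its remainder on division by `H`, which
is a series in one shift. For such a series `C`, the equations `∂ψ_j = C ψ_j` determine the time
derivative of the wave operator, and conjugation turns the resulting Sato equation into the Lax
equation. Division by `H` is possible because its two coefficients with respect to either shift
are invertible series in the other one.
-/

noncomputable section

namespace ThreeKP

/-! ### Derivations of the field of fractions -/

theorem ι_injective : Function.Injective ι := IsFractionRing.injective TSeries TField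

theorem ι_ne_zero {a : TSeries} (ha : a ≠ 0) : ι a ≠ 0 :=
  (map_ne_zero_iff ι ι_injective).mpr ha

theorem exists_eq_div (x : TField) : ∃ a b : TSeries, b ≠ 0 ∧ x = ι a / ι b := by
  obtain ⟨a, b, hb, rfl⟩ := IsFractionRing.div_surjective (A := TSeries) x
  exact ⟨a, b, nonZeroDivisors.ne_zero hb, rfl⟩

theorem dt_ι (s : TimeIdx) (a : TSeries) : dt s (ι a) = ι (MvPowerSeries.pderiv ℂ s a) := by
  simpa using dt_div s a 1 one_ne_zero

theorem dt_add (s : TimeIdx) (x y : TField) : dt s (x + y) = dt s x + dt s y := by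
  obtain ⟨a, b, hb, rfl⟩ := exists_eq_div x
  obtain ⟨c, d, hd, rfl⟩ := exists_eq_div y
  have hb' := ι_ne_zero hb
  have hd' := ι_ne_zero hd
  have common_denominator : ι a / ι b + ι c / ι d = ι (a * d + b * c) / ι (b * d) := by
    simp only [map_add, map_mul]
    field_simp
  rw [common_denominator, dt_div s _ _ (mul_ne_zero hb hd), dt_div s _ _ hb, dt_div s _ _ hd]
  simp only [Derivation.leibniz, smul_eq_mul, map_add, map_mul]
  field_simp
  ring

theorem dt_mul (s : TimeIdx) (x y : TField) : dt s (x * y) = x * dt s y + y * dt s x := by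
  obtain ⟨a, b, hb, rfl⟩ := exists_eq_div x
  obtain ⟨c, d, hd, rfl⟩ := exists_eq_div y
  have hb' := ι_ne_zero hb
  have hd' := ι_ne_zero hd
  have common_denominator : ι a / ι b * (ι c / ι d) = ι (a * c) / ι (b * d) := by
    simp only [map_mul]
    field_simp
  rw [common_denominator, dt_div s _ _ (mul_ne_zero hb hd), dt_div s _ _ hb, dt_div s _ _ hd]
  simp only [Derivation.leibniz, smul_eq_mul, map_add, map_mul]
  field_simp
  ring

/-- `∂/∂t_s` as an additive endomorphism of the field of fractions. -/
def dtHom (s : TimeIdx) : TField →+ TField := AddMonoidHom.mk' (dt s) (dt_add s)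

@[simp] theorem dtHom_apply (s : TimeIdx) (x : TField) : dtHom s x = dt s x := rfl

@[simp] theorem dt_zero (s : TimeIdx) : dt s 0 = 0 := map_zero (dtHom s)

@[simp] theorem dt_one (s : TimeIdx) : dt s 1 = 0 := by
  simpa using dt_mul s 1 1

theorem dt_intCast_mul (s : TimeIdx) (c : ℤ) (x : TField) : dt s (c * x) = c * dt s x := by
  simpa only [zsmul_eq_mul, dtHom_apply] using map_zsmul (dtHom s) c x

theorem dt_finsum {κ : Type*} (s : TimeIdx) {f : κ → TField} (hf : f.support.Finite) :
    dt s (∑ᶠ k, f k) = ∑ᶠ k, dt s (f k) :=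
  (dtHom s).map_finsum hf

theorem dt_div_of_ne_zero (s : TimeIdx) (x : TField) {y : TField} (hy : y ≠ 0) :
    dt s (x / y) = (dt s x - x / y * dt s y) / y := by
  have product_rule := dt_mul s (x / y) y
  rw [div_mul_cancel₀ x hy] at product_rule
  rw [eq_div_iff hy, product_rule]
  ring

/-! ### Restriction to the diagonal -/

section Rename

variable {σ κ R : Type*} [CommSemiring R] (g : σ ↪ κ)

theorem pderiv_rename_apply (i : σ) (f : MvPowerSeries σ R) :
    MvPowerSeries.pderiv R (g i) (MvPowerSeries.rename g f) =
      MvPowerSeries.rename g (MvPowerSeries.pderiv R i f) := by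
  ext d
  rw [MvPowerSeries.coeff_pderiv]
  by_cases hd : d ∈ Set.range (Finsupp.mapDomain (M := ℕ) g)
  · obtain ⟨c, rfl⟩ := hd
    have exponent_succ : c.embDomain g + Finsupp.single (g i) 1 =
        (c + Finsupp.single i 1).embDomain g := by
      rw [Finsupp.embDomain_add, Finsupp.embDomain_single]
    rw [← Finsupp.embDomain_eq_mapDomain, exponent_succ, MvPowerSeries.coeff_embDomain_rename,
      MvPowerSeries.coeff_embDomain_rename, MvPowerSeries.coeff_pderiv,
      Finsupp.embDomain_apply_self]
  · have hd' : d + Finsupp.single (g i) 1 ∉ Set.range (Finsupp.mapDomain (M := ℕ) g) := by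
      rintro ⟨c, hc⟩
      have hci : Finsupp.single i 1 ≤ c := by
        have := DFunLike.congr_fun hc (g i)
        rw [Finsupp.mapDomain_apply g.injective, Finsupp.add_apply, Finsupp.single_eq_same] at this
        exact Finsupp.single_le_iff.mpr (by omega)
      refine hd ⟨c - Finsupp.single i 1, add_right_cancel (b := Finsupp.single (g i) 1) ?_⟩
      rw [← hc, ← Finsupp.mapDomain_single, ← Finsupp.mapDomain_add, tsub_add_cancel_of_le hci]
    rw [MvPowerSeries.coeff_rename_eq_zero g _ hd, MvPowerSeries.coeff_rename_eq_zero g _ hd',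
      zero_mul]

theorem pderiv_rename_of_notMem_range {i : κ} (hi : i ∉ Set.range g) (f : MvPowerSeries σ R) :
    MvPowerSeries.pderiv R i (MvPowerSeries.rename g f) = 0 := by
  ext d
  rw [MvPowerSeries.coeff_pderiv, MvPowerSeries.coeff_rename_eq_zero, zero_mul, map_zero]
  rintro ⟨c, hc⟩
  have := DFunLike.congr_fun hc i
  rw [Finsupp.mapDomain_of_notMem_range _ _ hi, Finsupp.add_apply, Finsupp.single_eq_same] at this
  omega

end Rename

instance : Filter.TendstoCofinite (Sum.elim id id : TimeIdx ⊕ TimeIdx → TimeIdx) := by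
  rw [Filter.tendstoCofinite_iff_finite_preimage_singleton]
  refine fun s => Set.Finite.subset (Set.toFinite {Sum.inl s, Sum.inr s}) ?_
  rintro (x | x) hx <;> simpa using hx

/-- The restriction of a power series in `t`, `t'` to `t' = t`. -/
def diag : TSeries₂ →ₐ[ℂ] TSeries := MvPowerSeries.rename (Sum.elim id id)

/-- The restriction to `t' = t` of the derivative with respect to `t_s`. -/
def diagDeriv (s : TimeIdx) : TSeries₂ →+ TSeries :=
  (diag.toLinearMap ∘ₗ (MvPowerSeries.pderiv ℂ (Sum.inl s)).toLinearMap).toAddMonoidHom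

theorem diagDeriv_apply (s : TimeIdx) (G : TSeries₂) :
    diagDeriv s G = diag (MvPowerSeries.pderiv ℂ (Sum.inl s) G) := rfl

theorem diagDeriv_mul (s : TimeIdx) (F G : TSeries₂) :
    diagDeriv s (F * G) = diag F * diagDeriv s G + diag G * diagDeriv s F := by
  simp [diagDeriv_apply, Derivation.leibniz]

/-- The embedding `f ↦ f (t)` of the series in one copy of the times. -/
abbrev inlHom : TSeries →ₐ[ℂ] TSeries₂ :=
  MvPowerSeries.rename (R := ℂ) (Function.Embedding.inl : TimeIdx ↪ TimeIdx ⊕ TimeIdx)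

/-- The embedding `f ↦ f (t')` of the series in one copy of the times. -/
abbrev inrHom : TSeries →ₐ[ℂ] TSeries₂ :=
  MvPowerSeries.rename (R := ℂ) (Function.Embedding.inr : TimeIdx ↪ TimeIdx ⊕ TimeIdx)

theorem diag_inlHom (f : TSeries) : diag (inlHom f) = f := by
  rw [diag, MvPowerSeries.rename_rename]
  exact MvPowerSeries.rename_id_apply f

theorem diag_inrHom (f : TSeries) : diag (inrHom f) = f := by
  rw [diag, MvPowerSeries.rename_rename]
  exact MvPowerSeries.rename_id_apply f

theorem diagDeriv_inlHom (s : TimeIdx) (f : TSeries) :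
    diagDeriv s (inlHom f) = MvPowerSeries.pderiv ℂ s f := by
  rw [diagDeriv_apply, inlHom,
    show Sum.inl s = (Function.Embedding.inl : TimeIdx ↪ TimeIdx ⊕ TimeIdx) s from rfl,
    pderiv_rename_apply, diag_inlHom]

theorem diagDeriv_inrHom (s : TimeIdx) (f : TSeries) : diagDeriv s (inrHom f) = 0 := by
  rw [diagDeriv_apply, pderiv_rename_of_notMem_range _ (by simp), map_zero]

/-! ### The Miwa shift and the exponential factor -/

theorem wCoeff_zero (F : MvPowerSeries (Option TimeIdx) ℂ) :
    wCoeff 0 F = MvPowerSeries.killCompl Function.Embedding.some F := by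
  ext d
  rw [MvPowerSeries.coeff_killCompl]
  change MvPowerSeries.coeff (_ + Finsupp.single none 0) F = _
  rw [Finsupp.single_zero, add_zero]

theorem killCompl_miwaArg (i : Fin 3) (c : ℂ) (s : TimeIdx) :
    MvPowerSeries.killCompl Function.Embedding.some (miwaArg i c s) = MvPowerSeries.X s := by
  have killCompl_X_some : MvPowerSeries.killCompl (R := ℂ) Function.Embedding.some
      (MvPowerSeries.X (some s)) = MvPowerSeries.X s := MvPowerSeries.killCompl_X s
  have killCompl_X_none : MvPowerSeries.killCompl (R := ℂ) (Function.Embedding.some : TimeIdx ↪ _)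
      (MvPowerSeries.X none) = 0 := MvPowerSeries.killCompl_X_eq_zero (by simp)
  unfold miwaArg
  split_ifs <;> simp [killCompl_X_some, killCompl_X_none]

theorem coeff_zero_miwa (i : Fin 3) (c : ℂ) (f : TSeries) :
    PowerSeries.coeff 0 (miwa i c f) = f := by
  classical
  rw [miwa, PowerSeries.coeff_mk, wCoeff_zero]
  ext d
  have coeff_monomial (n : TimeIdx →₀ ℕ) :
      MvPowerSeries.coeff (d.embDomain Function.Embedding.some)
        (n.prod fun s e => miwaArg i c s ^ e) = if d = n then 1 else 0 := by
    rw [← MvPowerSeries.coeff_killCompl, map_finsuppProd]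
    simp only [map_pow, killCompl_miwaArg]
    rw [← MvPowerSeries.monomial_one_eq, MvPowerSeries.coeff_monomial]
  rw [MvPowerSeries.coeff_killCompl, MvPowerSeries.coeff_subst (miwaArg_hasSubst i c),
    finsum_eq_single _ d fun n hn => by simp [coeff_monomial, hn.symm]]
  simp [coeff_monomial]

/-- The weight of an exponent, where `t_k^{(i)}` and `t'_k^{(i)}` have weight `k`. -/
def wt : (TimeIdx ⊕ TimeIdx →₀ ℕ) →+ ℕ :=
  Finsupp.weight (Sum.elim (fun s : TimeIdx => (s.2 : ℕ)) fun s : TimeIdx => (s.2 : ℕ))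

/-- The series in `w` whose coefficient of `w^a` has only terms of weight at least `a`. For such a
series `E` the sums defining the coefficients of `E(w) F(w⁻¹)` are locally finite. -/
def Decays (E : PowerSeries TSeries₂) : Prop :=
  ∀ a d, MvPowerSeries.coeff d (PowerSeries.coeff a E) ≠ 0 → a ≤ wt d

theorem Decays.one : Decays 1 := by
  intro a d h
  rw [PowerSeries.coeff_one] at h
  split_ifs at h with ha
  · omega
  · simp at h

theorem Decays.mul {E F : PowerSeries TSeries₂} (hE : Decays E) (hF : Decays F) :
    Decays (E * F) := by
  classical
  intro a d h
  rw [PowerSeries.coeff_mul, map_sum] at h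
  obtain ⟨p, hp, h⟩ := Finset.exists_ne_zero_of_sum_ne_zero h
  rw [MvPowerSeries.coeff_mul] at h
  obtain ⟨q, hq, h⟩ := Finset.exists_ne_zero_of_sum_ne_zero h
  rw [Finset.HasAntidiagonal.mem_antidiagonal] at hp hq
  rw [← hp, ← hq, map_add]
  exact add_le_add (hE _ _ (left_ne_zero_of_mul h)) (hF _ _ (right_ne_zero_of_mul h))

theorem Decays.pow {E : PowerSeries TSeries₂} (hE : Decays E) (n : ℕ) : Decays (E ^ n) := by
  induction n with
  | zero => exact pow_zero E ▸ Decays.one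
  | succ n ih => exact pow_succ E n ▸ ih.mul hE

theorem Decays.subst {E : PowerSeries TSeries₂} (hE : Decays E) (hE' : PowerSeries.HasSubst E)
    (f : PowerSeries ℂ) : Decays (f.subst E) := by
  intro a d h
  rw [PowerSeries.coeff_subst' hE', finsum_eq_sum _ (PowerSeries.coeff_subst_finite' hE' _ _),
    map_sum] at h
  obtain ⟨n, -, h⟩ := Finset.exists_ne_zero_of_sum_ne_zero h
  rw [MvPowerSeries.coeff_smul] at h
  exact hE.pow n a d (right_ne_zero_of_mul h)

/-- The exponent `ξ(t^{(i)} - t'^{(i)}, w)` of `expXi`. -/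
def xi (i : Fin 3) : PowerSeries TSeries₂ :=
  PowerSeries.mk fun k : ℕ =>
    if h : 0 < k then
      (MvPowerSeries.X (Sum.inl (i, ⟨k, h⟩)) - MvPowerSeries.X (Sum.inr (i, ⟨k, h⟩)) : TSeries₂)
    else 0

theorem expXi_eq_subst (i : Fin 3) : expXi i = (PowerSeries.exp ℂ).subst (xi i) := rfl

theorem hasSubst_xi (i : Fin 3) : PowerSeries.HasSubst (xi i) :=
  PowerSeries.HasSubst.of_constantCoeff_zero' (by
    rw [← PowerSeries.coeff_zero_eq_constantCoeff_apply, xi, PowerSeries.coeff_mk]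
    simp)

theorem decays_xi (i : Fin 3) : Decays (xi i) := by
  classical
  intro a d h
  rw [xi, PowerSeries.coeff_mk] at h
  split_ifs at h with ha
  · rw [map_sub, MvPowerSeries.coeff_X, MvPowerSeries.coeff_X] at h
    have d_eq : d = Finsupp.single (Sum.inl (i, ⟨a, ha⟩)) 1 ∨
        d = Finsupp.single (Sum.inr (i, ⟨a, ha⟩)) 1 := by
      by_contra! hn
      simp [hn.1, hn.2] at h
    rcases d_eq with rfl | rfl <;> simp [wt, Finsupp.weight_single]
  · simp at h

theorem decays_expXi (i : Fin 3) : Decays (expXi i) :=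
  (decays_xi i).subst (hasSubst_xi i) _

theorem expXi_eq_one_add_xi_add (i : Fin 3) :
    ∃ G, expXi i = 1 + xi i + G * xi i ^ 2 := by
  have exp_sub : PowerSeries.X ^ 2 ∣ PowerSeries.exp ℂ - (1 + PowerSeries.X) := by
    rw [PowerSeries.X_pow_dvd_iff]
    intro n hn
    interval_cases n <;> simp [PowerSeries.coeff_exp, PowerSeries.coeff_one, PowerSeries.coeff_X]
  obtain ⟨g, hg⟩ := exp_sub
  refine ⟨PowerSeries.substAlgHom (hasSubst_xi i) g, ?_⟩
  rw [expXi_eq_subst, ← PowerSeries.coe_substAlgHom (hasSubst_xi i), eq_add_of_sub_eq' hg]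
  simp only [map_add, map_one, map_mul, map_pow, PowerSeries.substAlgHom_X]
  ring

theorem diag_coeff_xi (i : Fin 3) (a : ℕ) : diag (PowerSeries.coeff a (xi i)) = 0 := by
  rw [xi, PowerSeries.coeff_mk]
  split_ifs
  · simp [diag]
  · simp

theorem diag_coeff_mul_xi (i : Fin 3) (a : ℕ) (F : PowerSeries TSeries₂) :
    diag (PowerSeries.coeff a (F * xi i)) = 0 := by
  rw [PowerSeries.coeff_mul, map_sum]
  exact Finset.sum_eq_zero fun p _ => by rw [map_mul, diag_coeff_xi, mul_zero]

theorem diagDeriv_coeff_mul_xi_sq (s : TimeIdx) (i : Fin 3) (a : ℕ) (F : PowerSeries TSeries₂) :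
    diagDeriv s (PowerSeries.coeff a (F * xi i ^ 2)) = 0 := by
  rw [pow_two, ← mul_assoc, PowerSeries.coeff_mul, map_sum]
  exact Finset.sum_eq_zero fun p _ => by
    rw [diagDeriv_mul, diag_coeff_xi, diag_coeff_mul_xi, zero_mul, zero_mul, add_zero]

theorem diagDeriv_coeff_xi (s : TimeIdx) (i : Fin 3) (a : ℕ) :
    diagDeriv s (PowerSeries.coeff a (xi i)) = if s.1 = i ∧ (s.2 : ℕ) = a then 1 else 0 := by
  classical
  rw [xi, PowerSeries.coeff_mk, diagDeriv_apply]
  split_ifs with ha hs hs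
  · obtain ⟨rfl, rfl⟩ := hs
    have pderiv_self : MvPowerSeries.pderiv ℂ (Sum.inl s) (MvPowerSeries.X
        (Sum.inl (s.1, (⟨(s.2 : ℕ), ha⟩ : ℕ+))) : TSeries₂) = 1 := MvPowerSeries.pderiv_X_self
    rw [map_sub, MvPowerSeries.pderiv_X_of_ne (j := Sum.inr _) Sum.inr_ne_inl, pderiv_self,
      sub_zero, map_one]
  · have hne : (Sum.inl (i, ⟨a, ha⟩) : TimeIdx ⊕ TimeIdx) ≠ Sum.inl s := by
      rintro ⟨⟩
      exact hs ⟨rfl, rfl⟩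
    rw [map_sub, MvPowerSeries.pderiv_X_of_ne (j := Sum.inr _) Sum.inr_ne_inl,
      MvPowerSeries.pderiv_X_of_ne hne, sub_zero, map_zero]
  · exact absurd (hs.2 ▸ s.2.pos) ha
  · rw [map_zero, map_zero]

theorem diag_coeff_expXi (i : Fin 3) (a : ℕ) :
    diag (PowerSeries.coeff a (expXi i)) = if a = 0 then 1 else 0 := by
  obtain ⟨G, hG⟩ := expXi_eq_one_add_xi_add i
  rw [hG, pow_two, ← mul_assoc]
  simp only [map_add, diag_coeff_xi, diag_coeff_mul_xi, add_zero, PowerSeries.coeff_one]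
  split_ifs <;> simp

theorem diagDeriv_coeff_expXi (s : TimeIdx) (i : Fin 3) (a : ℕ) :
    diagDeriv s (PowerSeries.coeff a (expXi i)) = if s.1 = i ∧ (s.2 : ℕ) = a then 1 else 0 := by
  obtain ⟨G, hG⟩ := expXi_eq_one_add_xi_add i
  have diagDeriv_coeff_one : diagDeriv s (PowerSeries.coeff a 1) = 0 := by
    rw [PowerSeries.coeff_one]
    split_ifs <;> simp [diagDeriv_apply]
  simp only [hG, map_add, diagDeriv_coeff_one, diagDeriv_coeff_mul_xi_sq, diagDeriv_coeff_xi,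
    zero_add, add_zero]

/-! ### Restriction of the bilinear residues to the diagonal -/

section IntCoeff

variable {R S : Type*} [CommSemiring R] [CommSemiring S]

/-- The coefficient of `z^n` for `n ∈ ℤ`, which is `0` for `n < 0`. -/
def intCoeff (P : PowerSeries R) (n : ℤ) : R :=
  if 0 ≤ n then PowerSeries.coeff n.toNat P else 0

theorem intCoeff_of_neg (P : PowerSeries R) {n : ℤ} (hn : n < 0) : intCoeff P n = 0 :=
  if_neg hn.not_ge

@[simp] theorem intCoeff_natCast (P : PowerSeries R) (n : ℕ) :
    intCoeff P n = PowerSeries.coeff n P := by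
  simp [intCoeff]

theorem intCoeff_map (φ : R →+* S) (P : PowerSeries R) (n : ℤ) :
    intCoeff (PowerSeries.map φ P) n = φ (intCoeff P n) := by
  unfold intCoeff
  split_ifs
  · exact PowerSeries.coeff_map ..
  · rw [map_zero]

theorem support_intCoeff_mul_intCoeff_subset (P Q : PowerSeries R) (n : ℕ) :
    (fun a : ℤ => intCoeff P a * intCoeff Q (n - a)).support ⊆
      ↑((Finset.range (n + 1)).map Nat.castEmbedding : Finset ℤ) := by
  intro a ha
  have nonneg : 0 ≤ a := by
    by_contra! h
    exact left_ne_zero_of_mul ha (intCoeff_of_neg P h)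
  have le : a ≤ n := by
    by_contra! h
    exact right_ne_zero_of_mul ha (intCoeff_of_neg Q (by omega))
  lift a to ℕ using nonneg
  simpa using le

theorem intCoeff_mul (P Q : PowerSeries R) (n : ℤ) :
    intCoeff (P * Q) n = ∑ᶠ a : ℤ, intCoeff P a * intCoeff Q (n - a) := by
  rcases lt_or_ge n 0 with hn | hn
  · rw [intCoeff_of_neg _ hn, finsum_eq_zero_of_forall_eq_zero]
    intro a
    rcases lt_or_ge a 0 with ha | ha
    · rw [intCoeff_of_neg P ha, zero_mul]
    · rw [intCoeff_of_neg Q (by omega), mul_zero]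
  · lift n to ℕ using hn
    rw [finsum_eq_sum_of_support_subset _ (support_intCoeff_mul_intCoeff_subset P Q n),
      intCoeff_natCast, PowerSeries.coeff_mul, Finset.Nat.sum_antidiagonal_eq_sum_range_succ_mk,
      Finset.sum_map]
    refine Finset.sum_congr rfl fun k hk => ?_
    rw [Nat.castEmbedding_apply, intCoeff_natCast,
      ← Nat.cast_sub (Finset.mem_range_succ_iff.mp hk), intCoeff_natCast]

end IntCoeff

/-- The partial sums of `laurentCoeff s E F`. -/
def laurentPartialSum (s : ℤ) (E F : PowerSeries TSeries₂) (N : ℕ) : TSeries₂ :=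
  ∑ a ∈ Finset.range N, PowerSeries.coeff a E * intCoeff F (a - s)

theorem Decays.wt_ge_of_coeff_mul_ne_zero {E : PowerSeries TSeries₂} (hE : Decays E) {a : ℕ}
    {d : TimeIdx ⊕ TimeIdx →₀ ℕ} {G : TSeries₂}
    (h : MvPowerSeries.coeff d (PowerSeries.coeff a E * G) ≠ 0) : a ≤ wt d := by
  classical
  rw [MvPowerSeries.coeff_mul] at h
  obtain ⟨q, hq, h⟩ := Finset.exists_ne_zero_of_sum_ne_zero h
  rw [Finset.HasAntidiagonal.mem_antidiagonal] at hq
  rw [← hq, map_add]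
  exact (hE _ _ (left_ne_zero_of_mul h)).trans (Nat.le_add_right _ _)

theorem Decays.coeff_laurentCoeff {E : PowerSeries TSeries₂} (hE : Decays E) (s : ℤ)
    (F : PowerSeries TSeries₂) {d : TimeIdx ⊕ TimeIdx →₀ ℕ} {N : ℕ} (hN : wt d < N) :
    MvPowerSeries.coeff d (laurentCoeff s E F) =
      MvPowerSeries.coeff d (laurentPartialSum s E F N) := by
  have finite : (Function.support fun p : ℕ × ℕ => if (p.1 : ℤ) - (p.2 : ℤ) = s then
      MvPowerSeries.coeff d (PowerSeries.coeff p.1 E * PowerSeries.coeff p.2 F) else 0).Finite := by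
    refine Set.Finite.subset (Finset.finite_toSet
      (Finset.range N ×ˢ Finset.range (N + s.natAbs))) fun p hp => ?_
    obtain ⟨hs, hp⟩ := ite_ne_right_iff.mp hp
    have := hE.wt_ge_of_coeff_mul_ne_zero hp
    simp only [Finset.coe_product, Finset.coe_range, Set.mem_prod, Set.mem_Iio]
    omega
  have inner_sum (a : ℕ) : (∑ᶠ b : ℕ, if (a : ℤ) - (b : ℤ) = s then
      MvPowerSeries.coeff d (PowerSeries.coeff a E * PowerSeries.coeff b F) else 0) =
      MvPowerSeries.coeff d (PowerSeries.coeff a E * intCoeff F (a - s)) := by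
    rw [finsum_eq_single _ ((a : ℤ) - s).toNat fun b hb => if_neg (by omega), intCoeff]
    split_ifs <;> first | rfl | omega | simp
  rw [laurentPartialSum, map_sum]
  refine (finsum_curry _ finite).trans ?_
  simp only [inner_sum]
  refine finsum_eq_sum_of_support_subset _ fun a ha => ?_
  simpa using (hE.wt_ge_of_coeff_mul_ne_zero ha).trans_lt hN

theorem eventually_coeff_diag_eq {G : TSeries₂} {T : ℕ → TSeries₂}
    (h : ∀ d, ∀ᶠ N in Filter.atTop, MvPowerSeries.coeff d G = MvPowerSeries.coeff d (T N))
    (d : TimeIdx →₀ ℕ) :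
    ∀ᶠ N in Filter.atTop, MvPowerSeries.coeff d (diag G) = MvPowerSeries.coeff d (diag (T N)) := by
  have on_fiber := (Filter.eventually_all_finset (Filter.TendstoCofinite.finite_preimage_singleton
    (Finsupp.mapDomain (Sum.elim id id : TimeIdx ⊕ TimeIdx → TimeIdx)) d).toFinset).mpr
      fun x _ => h x
  filter_upwards [on_fiber] with N hN
  rw [diag, MvPowerSeries.coeff_rename, MvPowerSeries.coeff_rename]
  exact Finset.sum_congr rfl hN

theorem Decays.eventually_coeff_diag {E : PowerSeries TSeries₂} (hE : Decays E) (s : ℤ)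
    (F : PowerSeries TSeries₂) (d : TimeIdx →₀ ℕ) : ∀ᶠ N in Filter.atTop,
      MvPowerSeries.coeff d (diag (laurentCoeff s E F)) =
        MvPowerSeries.coeff d (diag (laurentPartialSum s E F N)) :=
  eventually_coeff_diag_eq (fun x => (Filter.eventually_gt_atTop (wt x)).mono fun _ hN =>
    hE.coeff_laurentCoeff s F hN) d

theorem Decays.eventually_coeff_diagDeriv {E : PowerSeries TSeries₂} (hE : Decays E)
    (σ : TimeIdx) (s : ℤ) (F : PowerSeries TSeries₂) (d : TimeIdx →₀ ℕ) :
    ∀ᶠ N in Filter.atTop, MvPowerSeries.coeff d (diagDeriv σ (laurentCoeff s E F)) =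
      MvPowerSeries.coeff d (diagDeriv σ (laurentPartialSum s E F N)) := by
  simp only [diagDeriv_apply]
  refine eventually_coeff_diag_eq (fun x => ?_) d
  filter_upwards [Filter.eventually_gt_atTop (wt (x + Finsupp.single (Sum.inl σ) 1))] with N hN
  rw [MvPowerSeries.coeff_pderiv, MvPowerSeries.coeff_pderiv, hE.coeff_laurentCoeff s F hN]

/-- The coefficientwise derivative. -/
def pderivCoeff (s : TimeIdx) (P : PowerSeries TSeries) : PowerSeries TSeries :=
  PowerSeries.mk fun n => MvPowerSeries.pderiv ℂ s (PowerSeries.coeff n P)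

theorem intCoeff_pderivCoeff (s : TimeIdx) (P : PowerSeries TSeries) (n : ℤ) :
    intCoeff (pderivCoeff s P) n = MvPowerSeries.pderiv ℂ s (intCoeff P n) := by
  unfold intCoeff
  split_ifs
  · exact PowerSeries.coeff_mk ..
  · rw [map_zero]

theorem map_diag_miwaProd (i : Fin 3) (f g : TSeries) :
    PowerSeries.map diag.toRingHom (miwaProd i f g) = miwa i (-1) f * miwa i 1 g := by
  rw [miwaProd, map_mul]
  congr 1 <;> ext1 n <;> simp only [PowerSeries.coeff_map]
  · exact diag_inlHom _
  · exact diag_inrHom _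

theorem diag_intCoeff_miwaProd (i : Fin 3) (f g : TSeries) (n : ℤ) :
    diag (intCoeff (miwaProd i f g) n) = intCoeff (miwa i (-1) f * miwa i 1 g) n := by
  rw [← map_diag_miwaProd, intCoeff_map]
  rfl

theorem diagDeriv_coeff_miwaProd (s : TimeIdx) (i : Fin 3) (f g : TSeries) (n : ℕ) :
    diagDeriv s (PowerSeries.coeff n (miwaProd i f g)) =
      PowerSeries.coeff n (pderivCoeff s (miwa i (-1) f) * miwa i 1 g) := by
  rw [miwaProd, PowerSeries.coeff_mul, PowerSeries.coeff_mul, map_sum]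
  refine Finset.sum_congr rfl fun p _ => ?_
  rw [PowerSeries.coeff_map, PowerSeries.coeff_map, diagDeriv_mul, pderivCoeff,
    PowerSeries.coeff_mk, mul_comm (MvPowerSeries.pderiv ℂ s _)]
  refine (congrArg₂ (· + ·) (congrArg₂ (· * ·) (diag_inlHom _) (diagDeriv_inrHom s _))
    (congrArg₂ (· * ·) (diag_inrHom _) (diagDeriv_inlHom s _))).trans ?_
  rw [mul_zero, zero_add]

theorem diagDeriv_intCoeff_miwaProd (s : TimeIdx) (i : Fin 3) (f g : TSeries) (n : ℤ) :
    diagDeriv s (intCoeff (miwaProd i f g) n) =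
      intCoeff (pderivCoeff s (miwa i (-1) f) * miwa i 1 g) n := by
  unfold intCoeff
  split_ifs
  · exact diagDeriv_coeff_miwaProd ..
  · rw [map_zero]

theorem diag_laurentCoeff (s : ℤ) (i : Fin 3) (f g : TSeries) :
    diag (laurentCoeff s (expXi i) (miwaProd i f g)) =
      intCoeff (miwa i (-1) f * miwa i 1 g) (-s) := by
  ext d
  obtain ⟨N, hd, hN⟩ := (((decays_expXi i).eventually_coeff_diag s (miwaProd i f g) d).and
    (Filter.eventually_gt_atTop 0)).exists
  rw [hd, laurentPartialSum, map_sum, Finset.sum_eq_single_of_mem 0 (Finset.mem_range.mpr hN)]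
  · rw [map_mul, diag_coeff_expXi, if_pos rfl, one_mul, diag_intCoeff_miwaProd, Nat.cast_zero,
      zero_sub]
  · intro a _ ha
    rw [map_mul, diag_coeff_expXi, if_neg ha, zero_mul]

theorem diagDeriv_laurentCoeff (σ : TimeIdx) (s : ℤ) (i : Fin 3) (f g : TSeries) :
    diagDeriv σ (laurentCoeff s (expXi i) (miwaProd i f g)) =
      intCoeff (pderivCoeff σ (miwa i (-1) f) * miwa i 1 g) (-s) +
        if σ.1 = i then intCoeff (miwa i (-1) f * miwa i 1 g) (σ.2 - s) else 0 := by
  ext d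
  obtain ⟨N, hd, hN⟩ := (((decays_expXi i).eventually_coeff_diagDeriv σ s (miwaProd i f g) d).and
    (Filter.eventually_gt_atTop (σ.2 : ℕ))).exists
  rw [hd, laurentPartialSum, map_sum]
  congr 1
  simp only [diagDeriv_mul, diag_coeff_expXi, diagDeriv_coeff_expXi, diag_intCoeff_miwaProd,
    diagDeriv_intCoeff_miwaProd, Finset.sum_add_distrib]
  congr 1
  · rw [Finset.sum_eq_single_of_mem 0 (Finset.mem_range.mpr (by omega))]
    · simp
    · intro a _ ha
      rw [if_neg ha, zero_mul]
  · rw [Finset.sum_eq_single_of_mem (σ.2 : ℕ) (Finset.mem_range.mpr hN)]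
    · simp
    · intro a _ ha
      rw [if_neg fun h => ha h.2.symm, mul_zero]

/-- The coefficient of `z^n`, `n ∈ ℤ`, as an element of the field of fractions. -/
def zCoeff (P : PowerSeries TSeries) (n : ℤ) : TField := ι (intCoeff P n)

theorem zCoeff_of_neg (P : PowerSeries TSeries) {n : ℤ} (hn : n < 0) : zCoeff P n = 0 := by
  rw [zCoeff, intCoeff_of_neg P hn, map_zero]

theorem zCoeff_natCast (P : PowerSeries TSeries) (n : ℕ) :
    zCoeff P n = ι (PowerSeries.coeff n P) := by
  rw [zCoeff, intCoeff_natCast]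

theorem zCoeff_mul (P Q : PowerSeries TSeries) (n : ℤ) :
    zCoeff (P * Q) n = ∑ᶠ a : ℤ, zCoeff P a * zCoeff Q (n - a) := by
  simp only [zCoeff, ← intCoeff_map]
  rw [map_mul, intCoeff_mul]

theorem dt_zCoeff (s : TimeIdx) (P : PowerSeries TSeries) (n : ℤ) :
    dt s (zCoeff P n) = zCoeff (pderivCoeff s P) n := by
  rw [zCoeff, dt_ι, zCoeff, intCoeff_pderivCoeff]

/-! ### Wave functions and their duals -/

/-- The direction in which the three wave functions are expanded. -/
def dir : Fin 3 → ℤˣ := ![-1, 1, 1]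

/-- The exponent of the leading power of `z` in the three wave functions. -/
def lead (j : Fin 3) (m : Lattice) : ℤ := ![m 0, m 1, m 0 - m 1] j

/-- The lattice shift in the three wave functions. -/
def latShift : Fin 3 → Lattice := ![0, e, e₁]

/-- The sign in the three wave functions. -/
def sgn (j : Fin 3) (m : Lattice) : ℤ := ![1, 1, (Int.negOnePow (m 1) : ℤ)] j

theorem units_mul_self (δ : ℤˣ) : (δ : ℤ) * δ = 1 := by
  rw [← Units.val_mul, Int.units_mul_self, Units.val_one]

theorem sgn_cast_mul_self (j : Fin 3) (m : Lattice) : (sgn j m : TField) * sgn j m = 1 := by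
  have sgn_mul_self : sgn j m * sgn j m = 1 := by
    fin_cases j <;> simp [sgn]
  rw [← Int.cast_mul, sgn_mul_self, Int.cast_one]

theorem sgn_cast_ne_zero (j : Fin 3) (m : Lattice) : (sgn j m : TField) ≠ 0 :=
  left_ne_zero_of_mul (sgn_cast_mul_self j m ▸ one_ne_zero)

section Waves

variable (τ : Lattice → TSeries)

/-- The coefficient of `z^n` in `τ m` times the `j`-th wave function at `m`. -/
def tauWave (j : Fin 3) (n : ℤ) (m : Lattice) : TField :=
  sgn j m * zCoeff (miwa j (-1) (τ (m + latShift j))) (dir j * (n - lead j m))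

/-- The coefficient of `z^n` in the `j`-th wave function at `m`. -/
def wave (j : Fin 3) (n : ℤ) (m : Lattice) : TField := tauWave τ j n m / ι (τ m)

/-- The `k`-th coefficient, counted from the leading one, of the `j`-th wave function at `m`: the
sequence `a_k^{(j+1)}` that defines the wave operators. -/
def waveCoeff (j : Fin 3) (k : ℕ) (m : Lattice) : TField :=
  sgn j m * (ι (PowerSeries.coeff k (miwa j (-1) (τ (m + latShift j)))) / ι (τ m))

/-- The coefficient of `z^(-1-n)` in the `j`-th dual wave function at `m`. -/
def dual (j : Fin 3) (m : Lattice) (n : ℤ) : TField :=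
  sgn j m * zCoeff (miwa j 1 (τ (m - latShift j))) (dir j * (lead j m - 1 - n))

/-- The action of `∂/∂t_σ` on the `j`-th wave function, including the exponential factor. -/
def flowD (σ : TimeIdx) (j : Fin 3) (φ : ℤ → Lattice → TField) (n : ℤ) (m : Lattice) : TField :=
  dt σ (φ n m) + if σ.1 = j then φ (n + dir j * (σ.2 : ℕ)) m else 0

/-- The product of the two tau functions in the `j`-th term of the bilinear equation. -/
def tauProd (j : Fin 3) (m m' : Lattice) : PowerSeries TSeries :=
  miwa j (-1) (τ (m + latShift j)) * miwa j 1 (τ (m' - latShift j))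

/-- The product `tauProd` with the first factor differentiated. -/
def tauProdDeriv (σ : TimeIdx) (j : Fin 3) (m m' : Lattice) : PowerSeries TSeries :=
  pderivCoeff σ (miwa j (-1) (τ (m + latShift j))) * miwa j 1 (τ (m' - latShift j))

end Waves

/-- The order of the coefficient of the product `tauProd` that enters the `j`-th term of the
bilinear equation: the residue pairs the wave function at `m` with the dual one at `m'`. -/
def resArg (j : Fin 3) (m m' : Lattice) : ℤ := dir j * (lead j m' - 1 - lead j m)

variable {τ : Lattice → TSeries}

theorem tauWave_eq_zero {j : Fin 3} {n : ℤ} {m : Lattice}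
    (h : (dir j : ℤ) * (n - lead j m) < 0) : tauWave τ j n m = 0 := by
  rw [tauWave, zCoeff_of_neg _ h, mul_zero]

theorem wave_eq_zero {j : Fin 3} {n : ℤ} {m : Lattice} (h : (dir j : ℤ) * (n - lead j m) < 0) :
    wave τ j n m = 0 := by
  rw [wave, tauWave_eq_zero h, zero_div]

theorem dual_eq_zero {j : Fin 3} {n : ℤ} {m : Lattice}
    (h : (dir j : ℤ) * (lead j m - 1 - n) < 0) : dual τ j m n = 0 := by
  rw [dual, zCoeff_of_neg _ h, mul_zero]

theorem wave_eq_waveCoeff {j : Fin 3} {n : ℤ} {k : ℕ} {m : Lattice}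
    (hk : (k : ℤ) = dir j * (n - lead j m)) : wave τ j n m = waveCoeff τ j k m := by
  rw [wave, tauWave, ← hk, zCoeff_natCast, mul_div_assoc]
  rfl

theorem waveCoeff_zero (j : Fin 3) (m : Lattice) :
    waveCoeff τ j 0 m = sgn j m * (ι (τ (m + latShift j)) / ι (τ m)) := by
  rw [waveCoeff, coeff_zero_miwa]

theorem wave_lead (j : Fin 3) (m : Lattice) :
    wave τ j (lead j m) m = sgn j m * (ι (τ (m + latShift j)) / ι (τ m)) := by
  rw [wave_eq_waveCoeff (k := 0) (by simp), waveCoeff_zero]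

theorem dual_lead (j : Fin 3) (m : Lattice) :
    dual τ j m (lead j m - 1) = sgn j m * ι (τ (m - latShift j)) := by
  have leading_coeff := zCoeff_natCast (miwa j 1 (τ (m - latShift j))) 0
  rw [coeff_zero_miwa, Nat.cast_zero] at leading_coeff
  rw [dual, sub_self, mul_zero, leading_coeff]

theorem dual_lead_ne_zero (hτ : ∀ m, τ m ≠ 0) (j : Fin 3) (m : Lattice) :
    dual τ j m (lead j m - 1) ≠ 0 := by
  rw [dual_lead]
  exact mul_ne_zero (sgn_cast_ne_zero j m) (ι_ne_zero (hτ _))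

/-- The bijection `n ↦ δ (n - c)` of `ℤ`. -/
def affineEquiv (δ : ℤˣ) (c : ℤ) : ℤ ≃ ℤ where
  toFun n := δ * (n - c)
  invFun a := δ * a + c
  left_inv n := by linear_combination (n - c) * units_mul_self δ
  right_inv a := by linear_combination a * units_mul_self δ

theorem finsum_zCoeff_mul_dual (P : PowerSeries TSeries) (k : ℤ) (j : Fin 3) (m m' : Lattice) :
    ∑ᶠ n, zCoeff P (dir j * (n - lead j m) + k) * dual τ j m' n =
      sgn j m' * zCoeff (P * miwa j 1 (τ (m' - latShift j))) (resArg j m m' + k) := by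
  rw [zCoeff_mul, mul_finsum]
  conv_rhs => rw [← finsum_comp_equiv
    ((affineEquiv (dir j) (lead j m)).trans (Equiv.addRight k))]
  refine finsum_congr fun n => ?_
  have order_eq : resArg j m m' + k - (dir j * (n - lead j m) + k) =
      dir j * (lead j m' - 1 - n) := by
    rw [resArg]
    ring
  simp only [Equiv.trans_apply, affineEquiv, Equiv.coe_fn_mk, Equiv.coe_addRight, order_eq, dual]
  ring

theorem finsum_tauWave_mul_dual (j : Fin 3) (m m' : Lattice) :
    ∑ᶠ n, tauWave τ j n m * dual τ j m' n =
      sgn j m * (sgn j m' * zCoeff (tauProd τ j m m') (resArg j m m')) := by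
  have shift_zero := finsum_zCoeff_mul_dual (τ := τ) (miwa j (-1) (τ (m + latShift j))) 0 j m m'
  simp only [add_zero] at shift_zero
  rw [tauProd, ← shift_zero, mul_finsum]
  exact finsum_congr fun n => mul_assoc ..

theorem mul_dual_support_finite {j : Fin 3} {U : ℤ → TField} {c : ℤ}
    (hU : ∀ n, (dir j : ℤ) * n < c → U n = 0) (m' : Lattice) :
    (Function.support fun n => U n * dual τ j m' n).Finite := by
  refine ((Set.finite_Icc c (dir j * (lead j m' - 1))).preimage
    (affineEquiv (dir j) 0).injective.injOn).subset fun n hn => ?_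
  simp only [affineEquiv, Equiv.coe_fn_mk, sub_zero, Set.mem_preimage]
  refine ⟨?_, ?_⟩
  · by_contra! h
    exact left_ne_zero_of_mul hn (hU n h)
  · by_contra! h
    exact right_ne_zero_of_mul hn (dual_eq_zero (by rw [mul_sub]; linarith))

theorem flowD_tauWave (σ : TimeIdx) (j : Fin 3) (n : ℤ) (m : Lattice) :
    flowD σ j (tauWave τ j) n m = sgn j m *
      (zCoeff (pderivCoeff σ (miwa j (-1) (τ (m + latShift j)))) (dir j * (n - lead j m) + 0) +
        if σ.1 = j then
          zCoeff (miwa j (-1) (τ (m + latShift j))) (dir j * (n - lead j m) + (σ.2 : ℕ))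
        else 0) := by
  have order_eq : (dir j : ℤ) * (n + dir j * (σ.2 : ℕ) - lead j m) =
      dir j * (n - lead j m) + (σ.2 : ℕ) := by
    linear_combination ((σ.2 : ℕ) : ℤ) * units_mul_self (dir j)
  rw [flowD, tauWave, dt_intCast_mul, dt_zCoeff, tauWave, order_eq, add_zero, mul_add, mul_ite,
    mul_zero]

theorem finsum_flowD_tauWave_mul_dual (σ : TimeIdx) (j : Fin 3) (m m' : Lattice) :
    ∑ᶠ n, flowD σ j (tauWave τ j) n m * dual τ j m' n =
      sgn j m * (sgn j m' * (zCoeff (tauProdDeriv τ σ j m m') (resArg j m m') +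
        if σ.1 = j then zCoeff (tauProd τ j m m') (resArg j m m' + (σ.2 : ℕ)) else 0)) := by
  have finite_support (P : PowerSeries TSeries) (k : ℤ) : (Function.support fun n =>
      zCoeff P (dir j * (n - lead j m) + k) * dual τ j m' n).Finite :=
    mul_dual_support_finite (c := dir j * lead j m - k)
      (fun n hn => zCoeff_of_neg P (by rw [mul_sub]; linarith)) m'
  simp only [flowD_tauWave, mul_assoc]
  rw [← mul_finsum]
  congr 1
  split_ifs
  · simp only [add_mul]
    rw [finsum_add_distrib (finite_support _ _) (finite_support _ _), finsum_zCoeff_mul_dual,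
      finsum_zCoeff_mul_dual, add_zero, mul_add]
    rfl
  · rw [tauProdDeriv]
    simpa only [add_zero] using finsum_zCoeff_mul_dual (τ := τ)
      (pderivCoeff σ (miwa j (-1) (τ (m + latShift j)))) 0 j m m'

theorem resArg_zero (m m' : Lattice) : resArg 0 m m' = -(-1 - (m 0 - m' 0)) := by
  simp only [resArg, lead, dir, Matrix.cons_val, Units.val_neg, Units.val_one]
  ring

theorem resArg_one (m m' : Lattice) : resArg 1 m m' = -(m 1 - m' 1 + 1) := by
  simp only [resArg, lead, dir, Matrix.cons_val, Units.val_one]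
  ring

theorem resArg_two (m m' : Lattice) : resArg 2 m m' = -(m 0 - m 1 - m' 0 + m' 1 + 1) := by
  simp only [resArg, lead, dir, Matrix.cons_val, Units.val_one]
  ring

theorem IsTau.pairing_tauWave (hτ : IsTau τ) (m m' : Lattice) :
    ∑ᶠ n, tauWave τ 0 n m * dual τ 0 m' n =
      ∑ᶠ n, tauWave τ 1 n m * dual τ 1 m' n + ∑ᶠ n, tauWave τ 2 n m * dual τ 2 m' n := by
  have bilinear_diag := congrArg (fun G => ι (diag G)) (hτ.bilinear m m')
  simp only [map_add, map_mul, map_intCast, resInfty, resZero, diag_laurentCoeff,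
    Int.negOnePow_add, Units.val_mul, Int.cast_mul, mul_assoc] at bilinear_diag
  simp only [finsum_tauWave_mul_dual, resArg_zero, resArg_one, resArg_two]
  simpa only [zCoeff, tauProd, sgn, latShift, Matrix.cons_val, add_zero, sub_zero, Int.cast_one,
    one_mul] using bilinear_diag

theorem IsTau.pairing_flowD_tauWave (hτ : IsTau τ) (σ : TimeIdx) (m m' : Lattice) :
    ∑ᶠ n, flowD σ 0 (tauWave τ 0) n m * dual τ 0 m' n =
      ∑ᶠ n, flowD σ 1 (tauWave τ 1) n m * dual τ 1 m' n +
        ∑ᶠ n, flowD σ 2 (tauWave τ 2) n m * dual τ 2 m' n := by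
  have bilinear_deriv := congrArg (fun G => ι (diagDeriv σ G)) (hτ.bilinear m m')
  simp only [← zsmul_eq_mul, map_add, map_zsmul, resInfty, resZero] at bilinear_deriv
  simp only [diagDeriv_laurentCoeff, zsmul_eq_mul, Int.negOnePow_add, Units.val_mul, Int.cast_mul,
    map_add, apply_ite ι, map_zero, mul_assoc] at bilinear_deriv
  simp only [finsum_flowD_tauWave_mul_dual, resArg_zero, resArg_one, resArg_two, neg_add_eq_sub]
  simpa only [zCoeff, tauProd, tauProdDeriv, sgn, latShift, Matrix.cons_val, add_zero, sub_zero,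
    Int.cast_one, one_mul] using bilinear_deriv

theorem flowD_wave (hτ : ∀ m, τ m ≠ 0) (σ : TimeIdx) (j : Fin 3) (n : ℤ) (m : Lattice) :
    flowD σ j (wave τ j) n m = (ι (τ m))⁻¹ * flowD σ j (tauWave τ j) n m -
      dt σ (ι (τ m)) / ι (τ m) * wave τ j n m := by
  rw [flowD, flowD, wave, dt_div_of_ne_zero σ _ (ι_ne_zero (hτ m)), wave]
  split_ifs <;> ring

theorem flowD_tauWave_eq_zero {σ : TimeIdx} {j : Fin 3} {n : ℤ} {m : Lattice}
    (h : (dir j : ℤ) * n < dir j * lead j m - (σ.2 : ℕ)) : flowD σ j (tauWave τ j) n m = 0 := by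
  rw [flowD, tauWave_eq_zero (by rw [mul_sub]; omega), tauWave_eq_zero, ite_self, dt_zero, add_zero]
  rw [mul_sub, mul_add, ← mul_assoc, units_mul_self]
  linarith

theorem finsum_wave_mul_dual (j : Fin 3) (m m' : Lattice) :
    ∑ᶠ n, wave τ j n m * dual τ j m' n =
      (ι (τ m))⁻¹ * ∑ᶠ n, tauWave τ j n m * dual τ j m' n := by
  rw [mul_finsum]
  refine finsum_congr fun n => ?_
  rw [wave]
  ring

theorem finsum_flowD_wave_mul_dual (hτ : ∀ m, τ m ≠ 0) (σ : TimeIdx) (j : Fin 3)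
    (m m' : Lattice) : ∑ᶠ n, flowD σ j (wave τ j) n m * dual τ j m' n =
      (ι (τ m))⁻¹ * ∑ᶠ n, flowD σ j (tauWave τ j) n m * dual τ j m' n -
        dt σ (ι (τ m)) / ι (τ m) * ∑ᶠ n, wave τ j n m * dual τ j m' n := by
  have finite_flowD : (Function.support fun n =>
      (ι (τ m))⁻¹ * (flowD σ j (tauWave τ j) n m * dual τ j m' n)).Finite :=
    (mul_dual_support_finite (fun n => flowD_tauWave_eq_zero) m').subset
      fun n hn => right_ne_zero_of_mul hn
  have finite_wave : (Function.support fun n =>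
      dt σ (ι (τ m)) / ι (τ m) * (wave τ j n m * dual τ j m' n)).Finite :=
    (mul_dual_support_finite (c := dir j * lead j m)
      (fun n hn => wave_eq_zero (by rw [mul_sub]; omega)) m').subset
        fun n hn => right_ne_zero_of_mul hn
  rw [mul_finsum, mul_finsum, ← finsum_sub_distrib finite_flowD finite_wave]
  refine finsum_congr fun n => ?_
  rw [flowD_wave hτ]
  ring

theorem IsTau.pairing (hτ : IsTau τ) (m m' : Lattice) :
    ∑ᶠ n, wave τ 0 n m * dual τ 0 m' n =
      ∑ᶠ n, wave τ 1 n m * dual τ 1 m' n + ∑ᶠ n, wave τ 2 n m * dual τ 2 m' n := by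
  simp only [finsum_wave_mul_dual]
  rw [hτ.pairing_tauWave, mul_add]

theorem IsTau.pairing_flowD (hτ : IsTau τ) (σ : TimeIdx) (m m' : Lattice) :
    ∑ᶠ n, flowD σ 0 (wave τ 0) n m * dual τ 0 m' n =
      ∑ᶠ n, flowD σ 1 (wave τ 1) n m * dual τ 1 m' n +
        ∑ᶠ n, flowD σ 2 (wave τ 2) n m * dual τ 2 m' n := by
  simp only [finsum_flowD_wave_mul_dual hτ.ne_zero]
  rw [hτ.pairing_flowD_tauWave, hτ.pairing]
  ring

/-! ### Uniqueness of solutions of the bilinear equation -/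

theorem eq_zero_of_triangular {R : Type*} [Semiring R] [NoZeroDivisors R] (δ : ℤˣ) {U : ℤ → R}
    {χ : ℤ → ℤ → R} {c : ℤ} (hU : ∀ n, (δ : ℤ) * n < c → U n = 0)
    (hχ : ∀ r n, (δ : ℤ) * r < δ * n → χ r n = 0) (hχ_diag : ∀ r, χ r r ≠ 0)
    (hUχ : ∀ r, c ≤ (δ : ℤ) * r → ∑ᶠ n, U n * χ r n = 0) : U = 0 := by
  have vanish_below (k : ℕ) : ∀ n, (δ : ℤ) * n < c + k → U n = 0 := by
    induction k with
    | zero => simpa using hU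
    | succ k ih =>
      intro r hr
      rcases lt_or_ge ((δ : ℤ) * r) (c + k) with r_lt | r_ge
      · exact ih r r_lt
      have row := hUχ r (by omega)
      rw [finsum_eq_single _ r fun n hn => ?_] at row
      · exact (mul_eq_zero.mp row).resolve_right (hχ_diag r)
      have order_ne : (δ : ℤ) * n ≠ δ * r := fun h => hn (mul_left_cancel₀ δ.ne_zero h)
      rcases lt_or_gt_of_ne order_ne with n_lt | n_gt
      · rw [ih n (by push_cast at hr; omega), zero_mul]
      · rw [hχ r n n_gt, mul_zero]
  funext n
  exact vanish_below (δ * n - c + 1).toNat n (by omega)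

theorem finsum_mul_dual_eq_zero {j : Fin 3} {U : ℤ → TField} {c : ℤ} {m' : Lattice}
    (hU : ∀ n, (dir j : ℤ) * n < c → U n = 0) (hc : (dir j : ℤ) * (lead j m' - 1) < c) :
    ∑ᶠ n, U n * dual τ j m' n = 0 := by
  refine finsum_eq_zero_of_forall_eq_zero fun n => ?_
  rcases lt_or_ge ((dir j : ℤ) * n) c with n_lt | n_ge
  · rw [hU n n_lt, zero_mul]
  · rw [dual_eq_zero (by rw [mul_sub]; omega), mul_zero]

theorem eq_zero_of_finsum_mul_dual_eq_zero (hτ : ∀ m, τ m ≠ 0) {j : Fin 3} (p : ℤ → Lattice)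
    (hp : ∀ r, lead j (p r) = r + 1) {U : ℤ → TField} {c : ℤ}
    (hU : ∀ n, (dir j : ℤ) * n < c → U n = 0)
    (h : ∀ r, c ≤ (dir j : ℤ) * r → ∑ᶠ n, U n * dual τ j (p r) n = 0) : U = 0 := by
  refine eq_zero_of_triangular (dir j) hU (χ := fun r n => dual τ j (p r) n) (fun r n hrn => ?_)
    (fun r => ?_) h
  · exact dual_eq_zero (by rw [hp, add_sub_cancel_right, mul_sub]; omega)
  · simpa only [hp, add_sub_cancel_right] using dual_lead_ne_zero hτ j (p r)

theorem eq_zero_of_pairing (hτ : ∀ m, τ m ≠ 0) {U : Fin 3 → ℤ → TField} {M : Lattice}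
    (hU₀ : ∀ n, lead 0 M ≤ n → U 0 n = 0) (hU₁ : ∀ n < lead 1 M, U 1 n = 0)
    (hU₂ : ∀ n < lead 2 M, U 2 n = 0)
    (pairing : ∀ m', ∑ᶠ n, U 0 n * dual τ 0 m' n =
      ∑ᶠ n, U 1 n * dual τ 1 m' n + ∑ᶠ n, U 2 n * dual τ 2 m' n) : ∀ j, U j = 0 := by
  have hU₀' (n : ℤ) (hn : ((dir 0 : ℤˣ) : ℤ) * n < 1 - lead 0 M) : U 0 n = 0 :=
    hU₀ n (by simp [dir] at hn; omega)
  have hU₁' (n : ℤ) (hn : ((dir 1 : ℤˣ) : ℤ) * n < lead 1 M) : U 1 n = 0 :=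
    hU₁ n (by simpa [dir] using hn)
  have hU₂' (n : ℤ) (hn : ((dir 2 : ℤˣ) : ℤ) * n < lead 2 M) : U 2 n = 0 :=
    hU₂ n (by simpa [dir] using hn)
  -- At the points `m'` with `m'₂ = M₂` the second residue vanishes; if moreover `m'₁ ≤ M₁`, so
  -- does the third one, which isolates the first.
  have second_term (x : ℤ) : ∑ᶠ n, U 1 n * dual τ 1 ![x, M 1] n = 0 :=
    finsum_mul_dual_eq_zero hU₁' (by simp [dir, lead])
  have U₀_eq_zero : U 0 = 0 := by
    refine eq_zero_of_finsum_mul_dual_eq_zero hτ (fun r => ![r + 1, M 1]) (fun r => by simp [lead])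
      hU₀' fun r hr => ?_
    rw [pairing, second_term, zero_add]
    refine finsum_mul_dual_eq_zero hU₂' ?_
    simp only [dir, lead, Matrix.cons_val, Units.val_neg, Units.val_one] at hr ⊢
    omega
  have U₂_eq_zero : U 2 = 0 := by
    refine eq_zero_of_finsum_mul_dual_eq_zero hτ (fun r => ![r + 1 + M 1, M 1])
      (fun r => by simp [lead]) hU₂' fun r _ => ?_
    simpa [second_term, U₀_eq_zero] using (pairing ![r + 1 + M 1, M 1]).symm
  have U₁_eq_zero : U 1 = 0 := by
    refine eq_zero_of_finsum_mul_dual_eq_zero hτ (fun r => ![0, r + 1]) (fun r => by simp [lead])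
      hU₁' fun r _ => ?_
    simpa [U₀_eq_zero, U₂_eq_zero] using (pairing ![0, r + 1]).symm
  intro j
  fin_cases j
  exacts [U₀_eq_zero, U₁_eq_zero, U₂_eq_zero]

/-! ### Products of formal operators -/

theorem finsum_mul_finsum_assoc {κ κ' R : Type*} [Semiring R] [NoZeroDivisors R] (f : κ → R)
    (g : κ → κ' → R) (h : κ' → R)
    (hfin : {p : κ × κ' | f p.1 * (g p.1 p.2 * h p.2) ≠ 0}.Finite) :
    ∑ᶠ k, (∑ᶠ l, f l * g l k) * h k = ∑ᶠ l, f l * ∑ᶠ k, g l k * h k := by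
  simp only [finsum_mul, mul_finsum, mul_assoc]
  rw [← finsum_curry (fun p : κ × κ' => f p.1 * (g p.1 p.2 * h p.2)) hfin,
    ← finsum_comp_equiv (Equiv.prodComm κ' κ), finsum_curry]
  · rfl
  · exact hfin.preimage (Equiv.prodComm κ' κ).injective.injOn

namespace Op

variable {α : Fin 2} {ε : ℤˣ}

@[ext] theorem ext {A B : Op} (h : ∀ j m, A j m = B j m) : A = B := funext fun j => funext (h j)

theorem add_apply (A B : Op) (j m : Lattice) : (A + B) j m = A j m + B j m := rfl
theorem sub_apply (A B : Op) (j m : Lattice) : (A - B) j m = A j m - B j m := rfl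
theorem neg_apply (A : Op) (j m : Lattice) : (-A) j m = -A j m := rfl
theorem zero_apply (j m : Lattice) : (0 : Op) j m = 0 := rfl
theorem one_apply (j m : Lattice) : (1 : Op) j m = if j = 0 then 1 else 0 := rfl
theorem mul_apply (A B : Op) (j m : Lattice) :
    (A * B) j m = ∑ᶠ k : Lattice, A k m * B (j - k) (m + k) := rfl

theorem ne_zero_of_apply {A : Op} {j m : Lattice} (h : A j m ≠ 0) : A j ≠ 0 :=
  fun h0 => h (by rw [h0]; rfl)

theorem exists_of_mul_ne_zero {A B : Op} {j : Lattice} (h : (A * B) j ≠ 0) :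
    ∃ k, A k ≠ 0 ∧ B (j - k) ≠ 0 := by
  obtain ⟨m, hm⟩ := Function.ne_iff.mp h
  obtain ⟨k, hk⟩ : ∃ k, A k m * B (j - k) (m + k) ≠ 0 := by
    by_contra! all_zero
    exact hm (finsum_eq_zero_of_forall_eq_zero all_zero)
  exact ⟨k, ne_zero_of_apply (left_ne_zero_of_mul hk), ne_zero_of_apply (right_ne_zero_of_mul hk)⟩

theorem support_add_subset (A B : Op) :
    Function.support (A + B) ⊆ Function.support A ∪ Function.support B :=
  Function.support_add (M := Lattice → TField) A B

theorem support_neg (A : Op) : Function.support (-A) = Function.support A :=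
  Function.support_neg (G := Lattice → TField) A

/-- The half strip of width `2R` around the axis `α`, bounded above by `N` in the direction `ε`:
the supports of mixed operators lie in half strips, those of series in half strips with `R = 0`. -/
def halfStrip (α : Fin 2) (ε : ℤˣ) (R N : ℤ) : Set Lattice :=
  {j | (∀ β, β ≠ α → |j β| ≤ R) ∧ (ε : ℤ) * j α ≤ N}

theorem halfStrip_mono {R R' N N' : ℤ} (hR : R ≤ R') (hN : N ≤ N') :
    halfStrip α ε R N ⊆ halfStrip α ε R' N' :=
  fun _ hj => ⟨fun β hβ => (hj.1 β hβ).trans hR, hj.2.trans hN⟩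

theorem add_mem_halfStrip {R R' N N' : ℤ} {j k : Lattice} (hj : j ∈ halfStrip α ε R N)
    (hk : k ∈ halfStrip α ε R' N') : j + k ∈ halfStrip α ε (R + R') (N + N') :=
  ⟨fun β hβ => (abs_add_le _ _).trans (add_le_add (hj.1 β hβ) (hk.1 β hβ)), by
    rw [Pi.add_apply, mul_add]
    exact add_le_add hj.2 hk.2⟩

theorem support_mul_subset_halfStrip {A B : Op} {R R' N N' : ℤ}
    (hA : Function.support A ⊆ halfStrip α ε R N) (hB : Function.support B ⊆ halfStrip α ε R' N') :
    Function.support (A * B) ⊆ halfStrip α ε (R + R') (N + N') := by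
  intro j hj
  obtain ⟨k, hk, hjk⟩ := exists_of_mul_ne_zero hj
  simpa only [add_sub_cancel] using add_mem_halfStrip (hA hk) (hB hjk)

theorem abs_eq_abs_units_mul (ε : ℤˣ) (x : ℤ) : |x| = |(ε : ℤ) * x| := by
  rcases Int.units_eq_one_or ε with rfl | rfl <;> simp

theorem finite_halfStrip_inter (α : Fin 2) (ε : ℤˣ) (R N c : ℤ) :
    (halfStrip α ε R N ∩ {k | c ≤ (ε : ℤ) * k α}).Finite := by
  refine (Set.finite_Icc (fun _ => -max R (max |c| |N|) : Lattice)
    (fun _ => max R (max |c| |N|))).subset ?_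
  rintro k ⟨⟨abs_le_R, le_N⟩, ge_c⟩
  have abs_le_max (β : Fin 2) : |k β| ≤ max R (max |c| |N|) := by
    rcases eq_or_ne β α with rfl | hβ
    · rw [abs_eq_abs_units_mul ε]
      exact (abs_le_max_abs_abs ge_c le_N).trans (le_max_right _ _)
    · exact (abs_le_R β hβ).trans (le_max_left _ _)
  exact ⟨fun β => (abs_le.mp (abs_le_max β)).1, fun β => (abs_le.mp (abs_le_max β)).2⟩

/-- The set `K` is bounded below in the direction `ε` of the axis `α` along the lines parallel to
this axis, uniformly for the lines at bounded distance from it. -/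
def BddBelowAlong (α : Fin 2) (ε : ℤˣ) (K : Lattice → Prop) : Prop :=
  ∀ M : ℤ, ∃ c : ℤ, ∀ k, K k → (∀ β, β ≠ α → |k β| ≤ M) → c ≤ (ε : ℤ) * k α

theorem IsMixed.finite {A : Op} (hA : IsMixed α ε A) {K : Lattice → Prop}
    (hK : BddBelowAlong α ε K) : {k : Lattice | A k ≠ 0 ∧ K k}.Finite := by
  obtain ⟨N, hN⟩ := hA
  obtain ⟨c, hc⟩ := hK N
  exact (finite_halfStrip_inter α ε N N c).subset fun k hk =>
    ⟨hN k hk.1, hc k hk.2 (hN k hk.1).1⟩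

theorem IsMixed.finite_pairs {A B : Op} (hA : IsMixed α ε A) (hB : IsMixed α ε B)
    {K : Lattice → Prop} (hK : BddBelowAlong α ε K) :
    {p : Lattice × Lattice | A p.1 ≠ 0 ∧ B (p.2 - p.1) ≠ 0 ∧ K p.2}.Finite := by
  obtain ⟨N, hN⟩ := hA
  obtain ⟨N', hN'⟩ := hB
  obtain ⟨c, hc⟩ := hK (N + N')
  refine ((finite_halfStrip_inter α ε N N (c - N')).prod
    (finite_halfStrip_inter α ε (N + N') (N + N') c)).subset ?_
  rintro ⟨l, k⟩ ⟨hAl, hBkl, hKk⟩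
  have k_mem : k ∈ halfStrip α ε (N + N') (N + N') := by
    simpa only [add_sub_cancel] using add_mem_halfStrip (hN l hAl) (hN' (k - l) hBkl)
  have ge_c := hc k hKk k_mem.1
  have sub_le := (hN' (k - l) hBkl).2
  rw [Pi.sub_apply, mul_sub] at sub_le
  refine ⟨⟨hN l hAl, ?_⟩, k_mem, ge_c⟩
  rw [Set.mem_ofPred_eq]
  linarith

theorem IsMixed.bddBelowAlong {C : Op} (hC : IsMixed α ε C) (j : Lattice) :
    BddBelowAlong α ε fun k => C (j - k) ≠ 0 := by
  obtain ⟨N, hN⟩ := hC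
  refine fun M => ⟨(ε : ℤ) * j α - N, fun k hk _ => ?_⟩
  have sub_le := (hN (j - k) hk).2
  rw [Pi.sub_apply, mul_sub] at sub_le
  linarith

theorem IsMixed.mul_support_finite {A B : Op} (hA : IsMixed α ε A) (hB : IsMixed α ε B)
    (j m : Lattice) : (Function.support fun k => A k m * B (j - k) (m + k)).Finite :=
  (hA.finite (hB.bddBelowAlong j)).subset fun _ hk =>
    ⟨ne_zero_of_apply (left_ne_zero_of_mul hk), ne_zero_of_apply (right_ne_zero_of_mul hk)⟩

theorem IsMixed.finsum_mul_apply_mul {A B : Op} (hA : IsMixed α ε A) (hB : IsMixed α ε B)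
    {f : Lattice → TField} (hf : BddBelowAlong α ε fun k => f k ≠ 0) (m : Lattice) :
    ∑ᶠ k, (A * B) k m * f k = ∑ᶠ l, A l m * ∑ᶠ k, B k (m + l) * f (l + k) := by
  have finite_pairs : {p : Lattice × Lattice |
      A p.1 m * (B (p.2 - p.1) (m + p.1) * f p.2) ≠ 0}.Finite :=
    (hA.finite_pairs hB hf).subset fun p hp =>
      ⟨ne_zero_of_apply (left_ne_zero_of_mul hp),
        ne_zero_of_apply (left_ne_zero_of_mul (right_ne_zero_of_mul hp)),
        right_ne_zero_of_mul (right_ne_zero_of_mul hp)⟩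
  simp only [mul_apply]
  rw [finsum_mul_finsum_assoc (fun l => A l m) (fun l k => B (k - l) (m + l)) f finite_pairs]
  refine finsum_congr fun l => ?_
  rw [← finsum_comp_equiv (Equiv.addLeft l)]
  simp only [Equiv.coe_addLeft, add_sub_cancel_left]

theorem IsMixed.mul_assoc {A B C : Op} (hA : IsMixed α ε A) (hB : IsMixed α ε B)
    (hC : IsMixed α ε C) : A * B * C = A * (B * C) := by
  ext j m
  rw [mul_apply (A * B), hA.finsum_mul_apply_mul hB (f := fun k => C (j - k) (m + k))]
  · simp only [mul_apply A, mul_apply B, sub_sub, add_assoc]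
  · intro M
    obtain ⟨c, hc⟩ := hC.bddBelowAlong j M
    exact ⟨c, fun k hk => hc k (ne_zero_of_apply hk)⟩

/-! ### Actions on functions of the lattice -/

/-- The action of an operator on a function of `m`. -/
def act (A : Op) (φ : Lattice → TField) (m : Lattice) : TField := ∑ᶠ k, A k m * φ (m + k)

/-- The functions on which `𝓔^ε_{(α+1)}` acts: the sums in `act` are then finite. -/
def Admissible (α : Fin 2) (ε : ℤˣ) (φ : Lattice → TField) : Prop :=
  BddBelowAlong α ε fun m => φ m ≠ 0

theorem BddBelowAlong.translate {K : Lattice → Prop} (hK : BddBelowAlong α ε K) (m : Lattice) :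
    BddBelowAlong α ε fun k => K (m + k) := by
  intro M
  obtain ⟨c, hc⟩ := hK (|m 0| + |m 1| + M)
  refine ⟨c - (ε : ℤ) * m α, fun k hk hM => ?_⟩
  have abs_le_add (β : Fin 2) : |m β| ≤ |m 0| + |m 1| := by
    fin_cases β
    exacts [le_add_of_nonneg_right (abs_nonneg _), le_add_of_nonneg_left (abs_nonneg _)]
  have ge_c := hc (m + k) hk fun β hβ =>
    (abs_add_le _ _).trans (add_le_add (abs_le_add β) (hM β hβ))
  rw [Pi.add_apply, mul_add] at ge_c
  linarith

theorem Admissible.translate {φ : Lattice → TField} (hφ : Admissible α ε φ) (m : Lattice) :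
    BddBelowAlong α ε fun k => φ (m + k) ≠ 0 :=
  BddBelowAlong.translate hφ m

theorem act_support_finite {A : Op} {φ : Lattice → TField} (hA : IsMixed α ε A)
    (hφ : Admissible α ε φ) (m : Lattice) : (Function.support fun k => A k m * φ (m + k)).Finite :=
  (hA.finite (hφ.translate m)).subset fun _ hk =>
    ⟨ne_zero_of_apply (left_ne_zero_of_mul hk), right_ne_zero_of_mul hk⟩

theorem act_mul {A B : Op} {φ : Lattice → TField} (hA : IsMixed α ε A) (hB : IsMixed α ε B)
    (hφ : Admissible α ε φ) : act (A * B) φ = act A (act B φ) := by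
  funext m
  rw [act, hA.finsum_mul_apply_mul hB (hφ.translate m)]
  simp only [act, add_assoc]

theorem act_add {A B : Op} {φ : Lattice → TField} (hA : IsMixed α ε A) (hB : IsMixed α ε B)
    (hφ : Admissible α ε φ) : act (A + B) φ = act A φ + act B φ := by
  funext m
  rw [Pi.add_apply, act, act, act, ← finsum_add_distrib (act_support_finite hA hφ m)
    (act_support_finite hB hφ m)]
  exact finsum_congr fun k => add_mul _ _ _

theorem act_zero_right (A : Op) : act A (fun _ => 0) = fun _ => 0 := by
  funext m
  exact finsum_eq_zero_of_forall_eq_zero fun k => mul_zero _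

/-! ### The ring of mixed operators -/

theorem isMixed_of_support_subset {A : Op} {R N : ℤ}
    (hA : Function.support A ⊆ halfStrip α ε R N) : IsMixed α ε A :=
  ⟨max R N, fun _ hj => halfStrip_mono (le_max_left _ _) (le_max_right _ _) (hA hj)⟩

theorem isSeries_iff {A : Op} :
    IsSeries α ε A ↔ ∃ N, Function.support A ⊆ halfStrip α ε 0 N := by
  simp only [IsSeries, halfStrip, abs_nonpos_iff]
  rfl

theorem IsSeries.isMixed {A : Op} (hA : IsSeries α ε A) : IsMixed α ε A := by
  obtain ⟨N, hN⟩ := isSeries_iff.mp hA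
  exact isMixed_of_support_subset hN

theorem support_add_subset_halfStrip {A B : Op} {R R' N N' : ℤ}
    (hA : Function.support A ⊆ halfStrip α ε R N) (hB : Function.support B ⊆ halfStrip α ε R' N') :
    Function.support (A + B) ⊆ halfStrip α ε (max R R') (max N N') :=
  (support_add_subset A B).trans <| Set.union_subset
    (hA.trans (halfStrip_mono (le_max_left _ _) (le_max_left _ _)))
    (hB.trans (halfStrip_mono (le_max_right _ _) (le_max_right _ _)))

theorem IsMixed.zero (α : Fin 2) (ε : ℤˣ) : IsMixed α ε 0 := ⟨0, fun _ h => absurd rfl h⟩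

theorem IsMixed.add {A B : Op} (hA : IsMixed α ε A) (hB : IsMixed α ε B) :
    IsMixed α ε (A + B) := by
  obtain ⟨N, hN⟩ := hA
  obtain ⟨N', hN'⟩ := hB
  exact isMixed_of_support_subset (support_add_subset_halfStrip hN hN')

theorem IsMixed.neg {A : Op} (hA : IsMixed α ε A) : IsMixed α ε (-A) := by
  obtain ⟨N, hN⟩ := hA
  exact isMixed_of_support_subset ((support_neg A).trans_subset hN)

theorem IsMixed.sub {A B : Op} (hA : IsMixed α ε A) (hB : IsMixed α ε B) :
    IsMixed α ε (A - B) := by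
  rw [sub_eq_add_neg]
  exact hA.add hB.neg

theorem IsMixed.mul {A B : Op} (hA : IsMixed α ε A) (hB : IsMixed α ε B) :
    IsMixed α ε (A * B) := by
  obtain ⟨N, hN⟩ := hA
  obtain ⟨N', hN'⟩ := hB
  exact isMixed_of_support_subset (support_mul_subset_halfStrip hN hN')

theorem IsSeries.zero (α : Fin 2) (ε : ℤˣ) : IsSeries α ε 0 := ⟨0, fun _ h => absurd rfl h⟩

theorem IsSeries.add {A B : Op} (hA : IsSeries α ε A) (hB : IsSeries α ε B) :
    IsSeries α ε (A + B) := by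
  obtain ⟨N, hN⟩ := isSeries_iff.mp hA
  obtain ⟨N', hN'⟩ := isSeries_iff.mp hB
  exact isSeries_iff.mpr ⟨max N N', support_add_subset_halfStrip hN hN'⟩

theorem IsSeries.neg {A : Op} (hA : IsSeries α ε A) : IsSeries α ε (-A) := by
  obtain ⟨N, hN⟩ := isSeries_iff.mp hA
  exact isSeries_iff.mpr ⟨N, (support_neg A).trans_subset hN⟩

theorem IsSeries.mul {A B : Op} (hA : IsSeries α ε A) (hB : IsSeries α ε B) :
    IsSeries α ε (A * B) := by
  obtain ⟨N, hN⟩ := isSeries_iff.mp hA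
  obtain ⟨N', hN'⟩ := isSeries_iff.mp hB
  exact isSeries_iff.mpr ⟨N + N', support_mul_subset_halfStrip hN hN'⟩

theorem ofFun_eq_zero (f : Lattice → TField) {j : Lattice} (hj : j ≠ 0) : ofFun f j = 0 :=
  funext fun _ => if_neg hj

theorem isSeries_ofFun (α : Fin 2) (ε : ℤˣ) (f : Lattice → TField) : IsSeries α ε (ofFun f) := by
  refine ⟨0, fun j hj => ?_⟩
  obtain rfl : j = 0 := not_imp_comm.mp (ofFun_eq_zero f) hj
  simp

theorem isSeries_one (α : Fin 2) (ε : ℤˣ) : IsSeries α ε 1 := isSeries_ofFun α ε _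

theorem Lam_apply (α : Fin 2) (n : ℤ) (j m : Lattice) :
    Lam α n j m = if j = Pi.single α n then 1 else 0 := rfl

theorem eq_single_of_Lam_ne_zero {γ : Fin 2} {n : ℤ} {j : Lattice} (hj : Lam γ n j ≠ 0) :
    j = Pi.single γ n := by
  by_contra h
  exact hj (funext fun _ => if_neg h)

theorem isSeries_Lam (α : Fin 2) (ε : ℤˣ) (n : ℤ) : IsSeries α ε (Lam α n) := by
  refine ⟨(ε : ℤ) * n, fun j hj => ?_⟩
  rw [eq_single_of_Lam_ne_zero hj]
  exact ⟨fun β hβ => Pi.single_eq_of_ne hβ _, by rw [Pi.single_eq_same]⟩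

theorem isMixed_Lam (α γ : Fin 2) (ε : ℤˣ) (n : ℤ) : IsMixed α ε (Lam γ n) := by
  refine ⟨|n|, fun j hj => ?_⟩
  have abs_le (β : Fin 2) : |j β| ≤ |n| := by
    rw [eq_single_of_Lam_ne_zero hj, Pi.single_apply]
    split_ifs <;> simp
  exact ⟨fun β _ => abs_le β, (le_abs_self _).trans (abs_eq_abs_units_mul ε (j α) ▸ abs_le α)⟩

theorem ofFun_mul_apply (f : Lattice → TField) (A : Op) (j m : Lattice) :
    (ofFun f * A) j m = f m * A j m := by
  rw [mul_apply, finsum_eq_single _ 0]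
  · simp [ofFun]
  · intro k hk
    simp [ofFun, hk]

theorem mul_ofFun_apply (f : Lattice → TField) (A : Op) (j m : Lattice) :
    (A * ofFun f) j m = A j m * f (m + j) := by
  rw [mul_apply, finsum_eq_single _ j]
  · simp [ofFun]
  · intro k hk
    simp [ofFun, sub_eq_zero, hk.symm]

theorem Lam_mul_apply (α : Fin 2) (n : ℤ) (A : Op) (j m : Lattice) :
    (Lam α n * A) j m = A (j - Pi.single α n) (m + Pi.single α n) := by
  rw [mul_apply, finsum_eq_single _ (Pi.single α n)]
  · simp [Lam_apply]
  · intro k hk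
    simp [Lam_apply, hk]

theorem mul_Lam_apply (α : Fin 2) (n : ℤ) (A : Op) (j m : Lattice) :
    (A * Lam α n) j m = A (j - Pi.single α n) m := by
  rw [mul_apply, finsum_eq_single _ (j - Pi.single α n)]
  · simp [Lam_apply]
  · intro k hk
    have ne_single : j - k ≠ Pi.single α n := fun h => hk (by rw [← h, sub_sub_cancel])
    rw [Lam_apply, if_neg ne_single, mul_zero]

protected theorem one_mul (A : Op) : 1 * A = A := by
  ext j m
  exact (ofFun_mul_apply _ A j m).trans (by simp)

protected theorem mul_one (A : Op) : A * 1 = A := by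
  ext j m
  exact (mul_ofFun_apply _ A j m).trans (by simp)

theorem Lam_mul_Lam_apply (α β : Fin 2) (x y : ℤ) (j m : Lattice) :
    (Lam α x * Lam β y) j m = if j = Pi.single α x + Pi.single β y then 1 else 0 := by
  rw [Lam_mul_apply, Lam_apply]
  simp only [sub_eq_iff_eq_add, add_comm]

theorem Lam_zero (α : Fin 2) : Lam α 0 = 1 := by
  ext j m
  rw [Lam_apply, one_apply, Pi.single_zero]

theorem Lam_mul_Lam_self (α : Fin 2) (x y : ℤ) : Lam α x * Lam α y = Lam α (x + y) := by
  ext j m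
  rw [Lam_mul_Lam_apply, Lam_apply, Pi.single_add]

theorem Lam_comm (α β : Fin 2) (x y : ℤ) : Lam α x * Lam β y = Lam β y * Lam α x := by
  ext j m
  rw [Lam_mul_Lam_apply, Lam_mul_Lam_apply, add_comm]

/-- The additive group underlying the ring `𝓔^ε_{(α+1)}`. The product of `Op` is a ring product only
on mixed operators. -/
def mixedAddSubgroup (α : Fin 2) (ε : ℤˣ) : AddSubgroup Op where
  carrier := {A | IsMixed α ε A}
  add_mem' := IsMixed.add
  zero_mem' := IsMixed.zero α ε
  neg_mem' := IsMixed.neg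

/-- The ring `𝓔^ε_{(α+1)}`. -/
abbrev Mixed (α : Fin 2) (ε : ℤˣ) : Type := mixedAddSubgroup α ε

theorem Mixed.isMixed (A : Mixed α ε) : IsMixed α ε (A : Op) := A.2

instance : Mul (Mixed α ε) := ⟨fun A B => ⟨A.1 * B.1, A.isMixed.mul B.isMixed⟩⟩

instance : One (Mixed α ε) := ⟨⟨1, (isSeries_one α ε).isMixed⟩⟩

theorem IsMixed.mul_add {A B C : Op} (hA : IsMixed α ε A)
    (hB : IsMixed α ε B) (hC : IsMixed α ε C) : A * (B + C) = A * B + A * C := by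
  ext j m
  rw [add_apply, mul_apply, mul_apply, mul_apply,
    ← finsum_add_distrib (hA.mul_support_finite hB j m) (hA.mul_support_finite hC j m)]
  exact finsum_congr fun k => _root_.mul_add _ _ _

theorem IsMixed.add_mul {A B C : Op} (hA : IsMixed α ε A)
    (hB : IsMixed α ε B) (hC : IsMixed α ε C) : (A + B) * C = A * C + B * C := by
  ext j m
  rw [add_apply, mul_apply, mul_apply, mul_apply,
    ← finsum_add_distrib (hA.mul_support_finite hC j m) (hB.mul_support_finite hC j m)]
  exact finsum_congr fun k => _root_.add_mul _ _ _

protected theorem mul_zero (A : Op) : A * 0 = 0 := by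
  ext j m
  rw [mul_apply]
  exact finsum_eq_zero_of_forall_eq_zero fun k => by rw [zero_apply, MulZeroClass.mul_zero]

protected theorem zero_mul (A : Op) : 0 * A = 0 := by
  ext j m
  rw [mul_apply]
  exact finsum_eq_zero_of_forall_eq_zero fun k => by rw [zero_apply, MulZeroClass.zero_mul]

instance : Ring (Mixed α ε) where
  __ := (inferInstance : AddCommGroup (Mixed α ε))
  mul_assoc A B C := Subtype.ext (A.isMixed.mul_assoc B.isMixed C.isMixed)
  one_mul A := Subtype.ext (Op.one_mul A.1)
  mul_one A := Subtype.ext (Op.mul_one A.1)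
  left_distrib A B C := Subtype.ext (A.isMixed.mul_add B.isMixed C.isMixed)
  right_distrib A B C := Subtype.ext (A.isMixed.add_mul B.isMixed C.isMixed)
  zero_mul A := Subtype.ext (Op.zero_mul A.1)
  mul_zero A := Subtype.ext (Op.mul_zero A.1)

namespace Mixed

theorem coe_mul (A B : Mixed α ε) : ((A * B : Mixed α ε) : Op) = A.1 * B.1 := rfl

theorem coe_pow (A : Mixed α ε) (n : ℕ) : ((A ^ n : Mixed α ε) : Op) = Op.pow A.1 n := by
  induction n with
  | zero => rfl
  | succ n ih => rw [pow_succ, coe_mul, ih]; rfl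

/-- The subring `𝓔^{0,ε}_{(α+1)}`. -/
def seriesSubring (α : Fin 2) (ε : ℤˣ) : Subring (Mixed α ε) where
  carrier := {A | IsSeries α ε A.1}
  add_mem' := IsSeries.add
  zero_mem' := IsSeries.zero α ε
  neg_mem' := IsSeries.neg
  mul_mem' := IsSeries.mul
  one_mem' := isSeries_one α ε

/-- The shift `Λ_{γ+1}^n` in the ring of mixed operators. -/
def lam (γ : Fin 2) (n : ℤ) : Mixed α ε := ⟨Lam γ n, isMixed_Lam α γ ε n⟩

theorem lam_mul_lam (γ : Fin 2) (x y : ℤ) : (lam γ x * lam γ y : Mixed α ε) = lam γ (x + y) :=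
  Subtype.ext (Lam_mul_Lam_self γ x y)

theorem lam_zero (γ : Fin 2) : (lam γ 0 : Mixed α ε) = 1 := Subtype.ext (Lam_zero γ)

theorem lam_pow (γ : Fin 2) (x : ℤ) (n : ℕ) : (lam γ x : Mixed α ε) ^ n = lam γ (n * x) := by
  induction n with
  | zero => simp [lam_zero]
  | succ n ih =>
    rw [pow_succ, ih, lam_mul_lam]
    congr 1
    push_cast
    ring

end Mixed

/-! ### Derivatives with respect to the times -/

theorem deriv_apply (s : TimeIdx) (A : Op) (j m : Lattice) : A.deriv s j m = dt s (A j m) := rfl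

theorem deriv_ne_zero {s : TimeIdx} {A : Op} {j : Lattice} (h : A.deriv s j ≠ 0) : A j ≠ 0 := by
  refine fun hA => h (funext fun m => ?_)
  rw [deriv_apply, hA]
  exact dt_zero s

theorem IsMixed.deriv {A : Op} (hA : IsMixed α ε A) (s : TimeIdx) : IsMixed α ε (A.deriv s) := by
  obtain ⟨N, hN⟩ := hA
  exact ⟨N, fun j hj => hN j (deriv_ne_zero hj)⟩

theorem IsSeries.deriv {A : Op} (hA : IsSeries α ε A) (s : TimeIdx) :
    IsSeries α ε (A.deriv s) := by
  obtain ⟨N, hN⟩ := hA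
  exact ⟨N, fun j hj => hN j (deriv_ne_zero hj)⟩

theorem IsMixed.deriv_mul {A B : Op} (hA : IsMixed α ε A) (hB : IsMixed α ε B) (s : TimeIdx) :
    (A * B).deriv s = A.deriv s * B + A * B.deriv s := by
  ext j m
  rw [deriv_apply, mul_apply, dt_finsum _ (hA.mul_support_finite hB j m), add_apply, mul_apply,
    mul_apply, ← finsum_add_distrib ((hA.deriv s).mul_support_finite hB j m)
      (hA.mul_support_finite (hB.deriv s) j m)]
  refine finsum_congr fun k => ?_
  rw [dt_mul, deriv_apply, deriv_apply]
  ring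

theorem deriv_Lam (s : TimeIdx) (γ : Fin 2) (n : ℤ) : (Lam γ n).deriv s = 0 := by
  ext j m
  rw [deriv_apply, Lam_apply, zero_apply]
  split_ifs
  · exact dt_one s
  · exact dt_zero s

theorem deriv_inverse_of_sato {R : Type*} [Ring R] {S T C M dS dT : R} (hST : S * T = 1)
    (hTS : T * S = 1) (deriv_one : dS * T + S * dT = 0) (sato : C * S = dS + S * M) :
    dT = M * T - T * C := by
  calc dT = T * S * dT := by rw [hTS, one_mul]
    _ = -(T * dS * T) := by
      rw [mul_assoc, eq_neg_of_add_eq_zero_right deriv_one, mul_neg, mul_assoc]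
    _ = -(T * (C * S - S * M) * T) := by rw [sato, add_sub_cancel_right]
    _ = T * S * M * T - T * C * (S * T) := by noncomm_ring
    _ = M * T - T * C := by rw [hTS, hST, one_mul, mul_one]

theorem lax_of_sato_of_deriv_inverse {R : Type*} [Ring R] {S T C M Λ dS dT : R}
    (comm : M * Λ = Λ * M) (sato : C * S = dS + S * M) (deriv_inv : dT = M * T - T * C) :
    dS * Λ * T + S * Λ * dT = C * (S * Λ * T) - S * Λ * T * C := by
  calc dS * Λ * T + S * Λ * dT
      = (C * S - S * M) * Λ * T + S * Λ * (M * T - T * C) := by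
        rw [sato, add_sub_cancel_right, deriv_inv]
    _ = C * (S * Λ * T) - S * Λ * T * C - S * (M * Λ - Λ * M) * T := by noncomm_ring
    _ = C * (S * Λ * T) - S * Λ * T * C := by
        rw [comm, sub_self, mul_zero, zero_mul, sub_zero]

namespace Mixed

/-- The time derivative on the ring of mixed operators. -/
def deriv (s : TimeIdx) (A : Mixed α ε) : Mixed α ε := ⟨Op.deriv s A.1, A.isMixed.deriv s⟩

theorem deriv_mul (s : TimeIdx) (A B : Mixed α ε) :
    deriv s (A * B) = deriv s A * B + A * deriv s B :=
  Subtype.ext (A.isMixed.deriv_mul B.isMixed s)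

theorem deriv_lam (s : TimeIdx) (γ : Fin 2) (n : ℤ) : deriv s (lam γ n : Mixed α ε) = 0 :=
  Subtype.ext (deriv_Lam s γ n)

theorem deriv_one (s : TimeIdx) : deriv s (1 : Mixed α ε) = 0 := by rw [← lam_zero 0, deriv_lam]

theorem lax_of_sato {s : TimeIdx} {S T C M : Mixed α ε} (q : ℤ) (hST : S * T = 1)
    (hTS : T * S = 1) (comm : M * lam α q = lam α q * M) (sato : C * S = deriv s S + S * M) :
    deriv s (S * lam α q * T) = C * (S * lam α q * T) - S * lam α q * T * C := by
  have deriv_mul_inverse := congrArg (deriv s) hST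
  rw [deriv_mul, deriv_one] at deriv_mul_inverse
  rw [deriv_mul, deriv_mul, deriv_lam, mul_zero, add_zero]
  exact lax_of_sato_of_deriv_inverse comm sato
    (deriv_inverse_of_sato hST hTS deriv_mul_inverse sato)

end Mixed

theorem lax_of_sato {s : TimeIdx} {S T C M : Op} (q : ℤ) (hS : IsMixed α ε S) (hT : IsMixed α ε T)
    (hC : IsMixed α ε C) (hM : IsMixed α ε M) (hST : S * T = 1) (hTS : T * S = 1)
    (comm : M * Lam α q = Lam α q * M) (sato : C * S = S.deriv s + S * M) :
    (S * Lam α q * T).deriv s = C.comm (S * Lam α q * T) :=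
  congrArg Subtype.val <| Mixed.lax_of_sato (S := ⟨S, hS⟩) (T := ⟨T, hT⟩) (C := ⟨C, hC⟩)
    (M := ⟨M, hM⟩) q (Subtype.ext hST) (Subtype.ext hTS) (Subtype.ext comm) (Subtype.ext sato)

/-! ### Inverses of series -/

theorem units_mul_mul (δ : ℤˣ) (x : ℤ) : (δ : ℤ) * (δ * x) = x := by
  rw [← mul_assoc, units_mul_self, one_mul]

theorem series_single (α : Fin 2) (δ : ℤˣ) (a : ℕ → Lattice → TField) (p : ℕ) (m : Lattice) :
    series α δ a (Pi.single α ((δ : ℤ) * p)) m = a p m := by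
  have on_half_axis : (∀ β, β ≠ α → (Pi.single α ((δ : ℤ) * p) : Lattice) β = 0) ∧
      0 ≤ (δ : ℤ) * (Pi.single α ((δ : ℤ) * p) : Lattice) α :=
    ⟨fun β hβ => Pi.single_eq_of_ne hβ _, by rw [Pi.single_eq_same, units_mul_mul]; omega⟩
  rw [series, if_pos on_half_axis, Pi.single_eq_same, units_mul_mul, Int.toNat_natCast]

theorem eq_single_of_series_ne_zero {δ : ℤˣ} {a : ℕ → Lattice → TField} {j : Lattice}
    (h : series α δ a j ≠ 0) : ∃ p : ℕ, j = Pi.single α ((δ : ℤ) * p) := by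
  obtain ⟨m, hm⟩ := Function.ne_iff.mp h
  rw [series] at hm
  have on_half_axis : (∀ β, β ≠ α → j β = 0) ∧ 0 ≤ (δ : ℤ) * j α := by
    by_contra off_half_axis
    exact hm (if_neg off_half_axis)
  refine ⟨((δ : ℤ) * j α).toNat, funext fun β => ?_⟩
  rcases eq_or_ne β α with rfl | hβ
  · rw [Pi.single_eq_same, Int.toNat_of_nonneg on_half_axis.2, units_mul_mul]
  · rw [Pi.single_eq_of_ne hβ, on_half_axis.1 β hβ]

theorem eq_series {δ : ℤˣ} {a : ℕ → Lattice → TField} {A : Op}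
    (hA : ∀ j, A j ≠ 0 → ∃ n : ℕ, j = Pi.single α ((δ : ℤ) * n))
    (ha : ∀ (n : ℕ) m, A (Pi.single α ((δ : ℤ) * n)) m = a n m) : A = series α δ a := by
  ext j m
  by_cases hj : ∃ n : ℕ, j = Pi.single α ((δ : ℤ) * n)
  · obtain ⟨n, rfl⟩ := hj
    rw [ha, series_single]
  · rw [not_imp_comm.mp (hA j) hj, not_imp_comm.mp eq_single_of_series_ne_zero hj]

theorem isSeries_series (α : Fin 2) (ε : ℤˣ) (a : ℕ → Lattice → TField) :
    IsSeries α ε (series α (-ε) a) := by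
  refine ⟨0, fun j hj => ?_⟩
  obtain ⟨p, rfl⟩ := eq_single_of_series_ne_zero hj
  refine ⟨fun β hβ => Pi.single_eq_of_ne hβ _, ?_⟩
  rw [Pi.single_eq_same, Units.val_neg, neg_mul, mul_neg, units_mul_mul]
  omega

theorem single_mul_injective (α : Fin 2) (δ : ℤˣ) :
    Function.Injective fun p : ℕ => (Pi.single α ((δ : ℤ) * p) : Lattice) := fun p q h => by
  exact_mod_cast mul_left_cancel₀ δ.ne_zero (Pi.single_injective α h)

theorem series_mul_series (α : Fin 2) (δ : ℤˣ) (a b : ℕ → Lattice → TField) :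
    series α δ a * series α δ b = series α δ fun n m =>
      ∑ p ∈ Finset.range (n + 1), a p m * b (n - p) (m + Pi.single α ((δ : ℤ) * p)) := by
  have sub_single (x y : ℤ) : (Pi.single α x - Pi.single α y : Lattice) = Pi.single α (x - y) :=
    (Pi.single_sub (f := fun _ : Fin 2 => ℤ) α x y).symm
  refine eq_series (fun j hj => ?_) fun n m => ?_
  · obtain ⟨k, hk, hjk⟩ := exists_of_mul_ne_zero hj
    obtain ⟨p, rfl⟩ := eq_single_of_series_ne_zero hk
    obtain ⟨q, hq⟩ := eq_single_of_series_ne_zero hjk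
    refine ⟨q + p, ?_⟩
    rw [sub_eq_iff_eq_add.mp hq, ← Pi.single_add, ← mul_add, Nat.cast_add]
  · rw [mul_apply, finsum_eq_sum_of_support_subset _
      (s := (Finset.range (n + 1)).map ⟨_, single_mul_injective α δ⟩), Finset.sum_map]
    · refine Finset.sum_congr rfl fun p hp => ?_
      rw [Finset.mem_range] at hp
      rw [Function.Embedding.coeFn_mk, series_single, sub_single, ← mul_sub,
        ← Nat.cast_sub (by omega), series_single]
    · intro k hk
      obtain ⟨p, rfl⟩ :=
        eq_single_of_series_ne_zero (ne_zero_of_apply (left_ne_zero_of_mul hk))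
      obtain ⟨q, hq⟩ :=
        eq_single_of_series_ne_zero (ne_zero_of_apply (right_ne_zero_of_mul hk))
      rw [sub_single, ← mul_sub] at hq
      have sub_eq := mul_left_cancel₀ δ.ne_zero (Pi.single_injective α hq)
      simp only [Finset.coe_map, Function.Embedding.coeFn_mk, Finset.coe_range]
      exact ⟨p, by rw [Set.mem_Iio]; omega, rfl⟩

/-- The coefficients of the right inverse of a series. -/
def invCoeff (α : Fin 2) (δ : ℤˣ) (a : ℕ → Lattice → TField) : ℕ → Lattice → TField
  | 0, m => (a 0 m)⁻¹
  | n + 1, m => -(a 0 m)⁻¹ * ∑ p : Fin (n + 1),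
      a (p + 1) m * invCoeff α δ a (n - p) (m + Pi.single α ((δ : ℤ) * (p + 1 : ℕ)))
  termination_by n => n

theorem sum_mul_invCoeff (α : Fin 2) (δ : ℤˣ) {a : ℕ → Lattice → TField} (n : ℕ) {m : Lattice}
    (ha : a 0 m ≠ 0) : ∑ p ∈ Finset.range (n + 1),
      a p m * invCoeff α δ a (n - p) (m + Pi.single α ((δ : ℤ) * p)) = if n = 0 then 1 else 0 := by
  cases n with
  | zero => simp [invCoeff, ha]
  | succ n =>
    rw [Finset.sum_range_succ', if_neg (Nat.succ_ne_zero n), Nat.cast_zero, mul_zero,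
      Pi.single_zero, add_zero, Nat.sub_zero, invCoeff,
      ← Fin.sum_univ_eq_sum_range (fun p => a (p + 1) m * invCoeff α δ a (n + 1 - (p + 1))
        (m + (Pi.single α ((δ : ℤ) * ((p + 1 : ℕ) : ℤ)) : Lattice)))]
    simp only [Nat.add_sub_add_right]
    rw [← mul_assoc, mul_neg, mul_inv_cancel₀ ha, neg_one_mul, add_neg_cancel]

theorem series_mul_invCoeff (α : Fin 2) (δ : ℤˣ) {a : ℕ → Lattice → TField}
    (ha : ∀ m, a 0 m ≠ 0) : series α δ a * series α δ (invCoeff α δ a) = 1 := by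
  rw [series_mul_series]
  simp only [sum_mul_invCoeff α δ _ (ha _)]
  refine (eq_series (fun j hj => ⟨0, ?_⟩) fun n m => ?_).symm
  · rw [Nat.cast_zero, mul_zero, Pi.single_zero]
    exact not_imp_comm.mp (ofFun_eq_zero _) hj
  · rw [one_apply]
    simp [Pi.single_eq_zero_iff]

theorem exists_isInv_series (α : Fin 2) (ε : ℤˣ) {a : ℕ → Lattice → TField}
    (ha : ∀ m, a 0 m ≠ 0) : ∃ T, IsInv α ε (series α (-ε) a) T := by
  have isMixed (b : ℕ → Lattice → TField) : IsMixed α ε (series α (-ε) b) :=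
    (isSeries_series α ε b).isMixed
  set T := series α (-ε) (invCoeff α (-ε) a)
  set S' := series α (-ε) (invCoeff α (-ε) (invCoeff α (-ε) a))
  have right_inv : series α (-ε) a * T = 1 := series_mul_invCoeff α (-ε) ha
  have right_inv' : T * S' = 1 := series_mul_invCoeff α (-ε) fun m => by
    rw [invCoeff]
    exact inv_ne_zero (ha m)
  have eq_right_inv : series α (-ε) a = S' := by
    rw [← Op.mul_one (series α (-ε) a), ← right_inv',
      ← (isMixed _).mul_assoc (isMixed _) (isMixed _), right_inv, Op.one_mul]
  exact ⟨T, isSeries_series α ε _, right_inv, eq_right_inv ▸ right_inv'⟩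

theorem IsInv.unique {S T T' : Op} (hS : IsMixed α ε S) (h : IsInv α ε S T)
    (h' : IsInv α ε S T') : T' = T := by
  rw [← Op.mul_one T', ← h.2.1, ← h'.1.isMixed.mul_assoc hS h.1.isMixed, h'.2.2, Op.one_mul]

theorem existsUnique_isInv_series (α : Fin 2) (ε : ℤˣ) {a : ℕ → Lattice → TField}
    (ha : ∀ m, a 0 m ≠ 0) : ∃! T, IsInv α ε (series α (-ε) a) T := by
  obtain ⟨T, hT⟩ := exists_isInv_series α ε ha
  exact ⟨T, hT, fun T' hT' => hT.unique (isSeries_series α ε a).isMixed hT'⟩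

theorem isInv_inv {S : Op} (h : ∃ T, IsInv α ε S T) : IsInv α ε S (inv α ε S) :=
  Classical.epsilon_spec h

/-! ### Division by an operator of degree one in the other shift -/

/-- An element of `𝓔^{0,ε}_{(α+1)}` as an element of the corresponding subring of `𝓔^ε_{(α+1)}`. -/
def IsSeries.toSubring {A : Op} (hA : IsSeries α ε A) : Mixed.seriesSubring α ε :=
  ⟨⟨A, hA.isMixed⟩, hA⟩

theorem IsInv.isUnit {S T : Op} (hS : IsSeries α ε S) (h : IsInv α ε S T) :
    IsUnit hS.toSubring :=
  ⟨⟨hS.toSubring, h.1.toSubring, Subtype.ext (Subtype.ext h.2.1),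
    Subtype.ext (Subtype.ext h.2.2)⟩, rfl⟩

theorem isUnit_Lam (α : Fin 2) (ε : ℤˣ) (n : ℤ) : IsUnit (isSeries_Lam α ε n).toSubring :=
  IsInv.isUnit (T := Lam α (-n)) _ ⟨isSeries_Lam α ε _,
    by rw [Lam_mul_Lam_self, add_neg_cancel, Lam_zero],
    by rw [Lam_mul_Lam_self, neg_add_cancel, Lam_zero]⟩

theorem isUnit_ofFun (α : Fin 2) (ε : ℤˣ) {f : Lattice → TField} (hf : ∀ m, f m ≠ 0) :
    IsUnit (isSeries_ofFun α ε f).toSubring := by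
  refine IsInv.isUnit (T := ofFun fun m => (f m)⁻¹) _ ⟨isSeries_ofFun α ε _, ?_, ?_⟩ <;>
    ext j m <;> rw [ofFun_mul_apply, one_apply, ofFun] <;> split_ifs <;> simp [hf m]

theorem isSeries_binomial (α : Fin 2) (ε : ℤˣ) (f g : Lattice → TField) :
    IsSeries α ε (ofFun f + ofFun g * Lam α 1) :=
  (isSeries_ofFun α ε f).add ((isSeries_ofFun α ε g).mul (isSeries_Lam α ε 1))

theorem binomial_eq_series (α : Fin 2) (δ : ℤˣ) (f g : Lattice → TField) :
    ofFun f + ofFun g * Lam α δ =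
      series α δ fun n m => if n = 0 then f m else if n = 1 then g m else 0 := by
  refine eq_series (fun j hj => ?_) fun n m => ?_
  · by_contra! not_single
    obtain ⟨m, hm⟩ := Function.ne_iff.mp hj
    have hj0 : j ≠ 0 := by simpa using not_single 0
    have hj1 : j ≠ Pi.single α (δ : ℤ) := by simpa using not_single 1
    rw [add_apply, ofFun_mul_apply, Lam_apply, ofFun_eq_zero f hj0, if_neg hj1] at hm
    simp at hm
  · have single_eq_zero : (Pi.single α ((δ : ℤ) * n) : Lattice) = 0 ↔ n = 0 := by simp
    have single_eq_single :
        (Pi.single α ((δ : ℤ) * n) : Lattice) = Pi.single α (δ : ℤ) ↔ n = 1 := by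
      rw [(Pi.single_injective α).eq_iff, mul_eq_left₀ δ.ne_zero]
      norm_cast
    rw [add_apply, ofFun_mul_apply, Lam_apply, ofFun]
    simp only [single_eq_zero, single_eq_single]
    rcases n with _ | _ | n <;> simp

theorem isUnit_binomial (α : Fin 2) (ε : ℤˣ) {f g : Lattice → TField} (hf : ∀ m, f m ≠ 0)
    (hg : ∀ m, g m ≠ 0) : IsUnit (isSeries_binomial α ε f g).toSubring := by
  rcases Int.units_eq_one_or ε with rfl | rfl
  · let a : ℕ → Lattice → TField := fun n m => if n = 0 then g m else if n = 1 then f m else 0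
    obtain ⟨T, hT⟩ := exists_isInv_series α 1 (a := a) fun m => by simpa [a] using hg m
    have factor : (isSeries_binomial α 1 f g).toSubring =
        (isSeries_series α 1 a).toSubring * (isSeries_Lam α 1 1).toSubring := by
      refine Subtype.ext (Subtype.ext (Eq.symm ?_))
      change series α (-1) a * Lam α 1 = _
      have hf' := (isSeries_ofFun α 1 f).isMixed
      have hΛ (n : ℤ) := (isSeries_Lam α 1 n).isMixed
      rw [← binomial_eq_series, (isSeries_ofFun α 1 g).isMixed.add_mul (hf'.mul (hΛ _)) (hΛ 1),
        hf'.mul_assoc (hΛ _) (hΛ 1), Lam_mul_Lam_self, Units.val_neg, Units.val_one,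
        neg_add_cancel, Lam_zero, Op.mul_one, add_comm]
      rfl
    rw [factor]
    exact (hT.isUnit _).mul (isUnit_Lam α 1 1)
  · obtain ⟨T, hT⟩ := exists_isInv_series α (-1)
      (a := fun n m => if n = 0 then f m else if n = 1 then g m else 0) fun m => by simpa using hf m
    rw [neg_neg, ← binomial_eq_series, Units.val_one] at hT
    exact hT.isUnit _

/-- The other one of the two axes. -/
def other (α : Fin 2) : Fin 2 := 1 - α

theorem other_ne (α : Fin 2) : other α ≠ α := by
  fin_cases α <;> decide

theorem eq_other {α β : Fin 2} (h : β ≠ α) : β = other α := by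
  revert h; fin_cases α <;> fin_cases β <;> decide

theorem lattice_ext (α : Fin 2) {j k : Lattice} (h : j α = k α)
    (h_other : j (other α) = k (other α)) : j = k := by
  funext β
  by_cases hβ : β = α
  · rw [hβ, h]
  · rw [eq_other hβ, h_other]

theorem part_apply (γ : Fin 2) (P : ℤ → Prop) (A : Op) (j m : Lattice) [Decidable (P (j γ))] :
    part γ P A j m = if P (j γ) then A j m else 0 := by
  unfold part
  congr

theorem part_ne_zero {γ : Fin 2} {P : ℤ → Prop} {A : Op} {j : Lattice} (h : part γ P A j ≠ 0) :
    P (j γ) ∧ A j ≠ 0 := by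
  classical
  obtain ⟨m, hm⟩ := Function.ne_iff.mp h
  rw [part_apply] at hm
  split_ifs at hm with hP
  · exact ⟨hP, ne_zero_of_apply hm⟩
  · exact absurd rfl hm

theorem IsMixed.part {A : Op} (hA : IsMixed α ε A) (γ : Fin 2) (P : ℤ → Prop) :
    IsMixed α ε (part γ P A) := by
  obtain ⟨N, hN⟩ := hA
  exact ⟨N, fun j hj => hN j (part_ne_zero hj).2⟩

theorem IsSeries.part {A : Op} (hA : IsSeries α ε A) (γ : Fin 2) (P : ℤ → Prop) :
    IsSeries α ε (part γ P A) := by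
  obtain ⟨N, hN⟩ := hA
  exact ⟨N, fun j hj => hN j (part_ne_zero hj).2⟩

theorem part_add (γ : Fin 2) (P : ℤ → Prop) (A B : Op) :
    part γ P (A + B) = part γ P A + part γ P B := by
  classical
  ext j m
  rw [add_apply, part_apply, part_apply, part_apply]
  split_ifs
  · rfl
  · rw [add_zero]

/-- All terms of `A` have degree `r` in `Λ_{γ+1}`. -/
def IsHomog (γ : Fin 2) (r : ℤ) (A : Op) : Prop := ∀ j, A j ≠ 0 → j γ = r

theorem IsSeries.isHomog {A : Op} (hA : IsSeries α ε A) : IsHomog (other α) 0 A := by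
  obtain ⟨N, hN⟩ := hA
  exact fun j hj => (hN j hj).1 _ (other_ne α)

theorem IsHomog.mul_Lam {γ : Fin 2} {r : ℤ} {A : Op} (hA : IsHomog γ r A) (n : ℤ) :
    IsHomog γ (r + n) (A * Lam γ n) := by
  intro j hj
  obtain ⟨m, hm⟩ := Function.ne_iff.mp hj
  rw [mul_Lam_apply] at hm
  have degree := hA _ (ne_zero_of_apply hm)
  rw [Pi.sub_apply, Pi.single_eq_same] at degree
  omega

theorem part_mul {γ : Fin 2} {r : ℤ} {Q W : Op} (hW : IsHomog γ r W) (n : ℤ) :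
    part γ (· = n) (Q * W) = part γ (· = n - r) Q * W := by
  ext j m
  have term (k : Lattice) : part γ (· = n - r) Q k m * W (j - k) (m + k) =
      if j γ = n then Q k m * W (j - k) (m + k) else 0 := by
    rw [part_apply, ite_mul, MulZeroClass.zero_mul]
    by_cases hk : W (j - k) = 0
    · rw [hk, Pi.zero_apply, MulZeroClass.mul_zero, ite_self, ite_self]
    · have degree := hW _ hk
      rw [Pi.sub_apply] at degree
      exact if_congr (by omega) rfl rfl
  rw [part_apply, mul_apply, mul_apply, finsum_congr term]
  split_ifs
  · rfl
  · exact finsum_zero.symm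

/-- The operator with the coefficients of `A` translated by `k`. -/
def translate (k : Lattice) (A : Op) : Op := fun j m => A j (m + k)

theorem IsSeries.translate {A : Op} (hA : IsSeries α ε A) (k : Lattice) :
    IsSeries α ε (translate k A) := by
  obtain ⟨N, hN⟩ := hA
  refine ⟨N, fun j hj => hN j ?_⟩
  obtain ⟨m, hm⟩ := Function.ne_iff.mp hj
  exact ne_zero_of_apply hm

theorem Lam_mul_eq (γ : Fin 2) (n : ℤ) (A : Op) :
    Lam γ n * A = translate (Pi.single γ n) A * Lam γ n := by
  ext j m
  rw [Lam_mul_apply, mul_Lam_apply]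
  rfl

theorem eq_zero_of_two_term_recursion {R : Type*} [Ring R] {a a' b b' : R} (ha : a * a' = 1)
    (hb : b * b' = 1) {x : ℤ → R} {N : ℤ} (bounded : ∀ n, N < |n| → x n = 0)
    (recursion : ∀ n ≠ 0, x (n - 1) * a + x n * b = 0) (n : ℤ) : x n = 0 := by
  have pred_eq_zero (n : ℤ) (hn : n ≠ 0) (h : x n = 0) : x (n - 1) = 0 := by
    have step := recursion n hn
    rw [h, zero_mul, add_zero] at step
    rw [← mul_one (x (n - 1)), ← ha, ← mul_assoc, step, zero_mul]
  have eq_zero_of_pred (n : ℤ) (hn : n ≠ 0) (h : x (n - 1) = 0) : x n = 0 := by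
    have step := recursion n hn
    rw [h, zero_mul, zero_add] at step
    rw [← mul_one (x n), ← hb, ← mul_assoc, step, zero_mul]
  rcases lt_or_ge N |n| with hn | hn
  · exact bounded n hn
  obtain ⟨hn_neg, hn_pos⟩ := abs_le.mp hn
  rcases lt_or_ge n 0 with h0 | h0
  · refine Int.leInduction (m := -N - 1) (motive := fun n _ => n < 0 → x n = 0)
      (fun _ => bounded _ (by rw [abs_of_nonpos] <;> omega)) (fun n _ ih h => ?_) n (by omega) h0
    exact eq_zero_of_pred (n + 1) h.ne (by rw [add_sub_cancel_right]; exact ih (by omega))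
  · refine Int.leInductionDown (m := N + 1) (motive := fun n _ => 0 ≤ n → x n = 0)
      (fun _ => bounded _ (by rw [abs_of_nonneg] <;> omega)) (fun n _ ih h => ?_) n (by omega) h0
    exact pred_eq_zero n (by omega) (ih (by omega))

theorem eq_neg_mul_add_mul_binomial {R : Type*} [Ring R] {x y u v w a : R} (hw : w * v = 1)
    (comm : x * (w * u) = a * x) : x = -a * (x * y) + x * w * (u * y + v) := by
  calc x = x * (w * v) := by rw [hw, mul_one]
    _ = -(x * (w * u)) * y + x * w * (u * y + v) := by noncomm_ring
    _ = -a * (x * y) + x * w * (u * y + v) := by rw [comm, neg_mul, neg_mul, mul_assoc]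

namespace Mixed

theorem lam_comm (γ δ : Fin 2) (x y : ℤ) :
    (lam γ x * lam δ y : Mixed α ε) = lam δ y * lam γ x :=
  Subtype.ext (Lam_comm γ δ x y)

theorem exists_lam_mul {A : Mixed α ε} (hA : A ∈ seriesSubring α ε) (γ : Fin 2) (n : ℤ) :
    ∃ A' ∈ seriesSubring α ε, lam γ n * A = A' * lam γ n :=
  ⟨_, ((hA : IsSeries α ε A.1).translate (Pi.single γ n)).toSubring.2,
    Subtype.ext (Lam_mul_eq γ n A.1)⟩

/-- The part of `A` of degree `n` in the other shift. -/
def homogPart (n : ℤ) (A : Mixed α ε) : Mixed α ε :=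
  ⟨part (other α) (· = n) A.1, A.isMixed.part _ _⟩

theorem homogPart_apply (n : ℤ) (A : Mixed α ε) (j m : Lattice) :
    (homogPart n A).1 j m = if j (other α) = n then A.1 j m else 0 :=
  part_apply _ (· = n) _ _ _

theorem exists_homogPart_eq_zero (A : Mixed α ε) :
    ∃ N : ℤ, ∀ n, N < |n| → homogPart n A = 0 := by
  obtain ⟨N, hN⟩ := A.isMixed
  refine ⟨N, fun n hn => Subtype.ext (Op.ext fun j m => ?_)⟩
  by_contra hne
  have part_ne : part (other α) (· = n) A.1 j ≠ 0 := ne_zero_of_apply hne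
  obtain ⟨rfl, hA⟩ := part_ne_zero part_ne
  exact absurd ((hN j hA).1 _ (other_ne α)) (not_le.mpr hn)

theorem coe_sum_apply {ι : Type*} (s : Finset ι) (f : ι → Mixed α ε) (j m : Lattice) :
    (∑ i ∈ s, f i).1 j m = ∑ i ∈ s, (f i).1 j m :=
  map_sum (⟨⟨fun A : Mixed α ε => A.1 j m, rfl⟩, fun _ _ => rfl⟩ : Mixed α ε →+ TField) f s

theorem eq_sum_homogPart {A : Mixed α ε} {N : ℤ} (hN : ∀ n, N < |n| → homogPart n A = 0) :
    A = ∑ n ∈ Finset.Icc (-N) N, homogPart n A := by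
  refine Subtype.ext (Op.ext fun j m => ?_)
  simp only [coe_sum_apply, homogPart_apply, Finset.sum_ite_eq]
  split_ifs with hj
  · rfl
  · have degree_zero := hN (j (other α)) (by rwa [← not_le, abs_le, ← Finset.mem_Icc])
    have apply_zero := congrArg (fun B : Mixed α ε => B.1 j m) degree_zero
    exact (if_pos rfl).symm.trans ((homogPart_apply _ A j m).symm.trans apply_zero)

theorem homogPart_mul_lam_mem (n : ℤ) (A : Mixed α ε) :
    homogPart n A * lam (other α) (-n) ∈ seriesSubring α ε := by
  obtain ⟨N, hN⟩ := A.isMixed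
  refine ⟨N, fun j hj => ?_⟩
  obtain ⟨m, hm⟩ := Function.ne_iff.mp hj
  change (part (other α) (· = n) A.1 * Lam (other α) (-n)) j m ≠ 0 at hm
  rw [mul_Lam_apply] at hm
  obtain ⟨degree, hA⟩ := part_ne_zero (ne_zero_of_apply hm)
  rw [Pi.sub_apply, Pi.single_eq_same] at degree
  have bound := (hN _ hA).2
  rw [Pi.sub_apply, Pi.single_eq_of_ne (other_ne α).symm, sub_zero] at bound
  refine ⟨fun β hβ => ?_, bound⟩
  rw [eq_other hβ]
  omega

/-- Division by `K` is possible: `K` is a binomial in the other shift whose two coefficients are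
units of `𝓔^{0,ε}_{(α+1)}`. -/
def IsDivisor (K : Mixed α ε) : Prop :=
  ∃ u v : (seriesSubring α ε)ˣ, K = u.1.1 * lam (other α) 1 + v.1.1

/-- The subgroup `𝓔^{0,ε}_{(α+1)} + 𝓔^ε_{(α+1)} K` of `𝓔^ε_{(α+1)}`. -/
def remainderSubgroup (K : Mixed α ε) : AddSubgroup (Mixed α ε) :=
  (seriesSubring α ε).toAddSubgroup ⊔ (AddMonoidHom.mulRight K).range

theorem mem_remainderSubgroup {K A : Mixed α ε} : A ∈ remainderSubgroup K ↔
    ∃ P ∈ seriesSubring α ε, ∃ Q, P + Q * K = A := by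
  rw [remainderSubgroup, AddSubgroup.mem_sup]
  constructor
  · rintro ⟨P, hP, _, ⟨Q, rfl⟩, rfl⟩
    exact ⟨P, hP, Q, rfl⟩
  · rintro ⟨P, hP, Q, rfl⟩
    exact ⟨P, hP, _, ⟨Q, rfl⟩, rfl⟩

theorem mul_mem_remainderSubgroup {K C A : Mixed α ε} (hC : C ∈ seriesSubring α ε)
    (hA : A ∈ remainderSubgroup K) : C * A ∈ remainderSubgroup K := by
  obtain ⟨P, hP, Q, rfl⟩ := mem_remainderSubgroup.mp hA
  exact mem_remainderSubgroup.mpr ⟨C * P, mul_mem hC hP, C * Q, by rw [mul_add, mul_assoc]⟩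

theorem mul_right_mem_remainderSubgroup (K Q : Mixed α ε) : Q * K ∈ remainderSubgroup K :=
  mem_remainderSubgroup.mpr ⟨0, zero_mem _, Q, zero_add _⟩

theorem IsDivisor.lam_mem {K : Mixed α ε} (hK : IsDivisor K) (n : ℤ) :
    lam (other α) n ∈ remainderSubgroup K := by
  obtain ⟨u, v, rfl⟩ := hK
  have inv_mul (w : (seriesSubring α ε)ˣ) : (w⁻¹.1.1 * w.1.1 : Mixed α ε) = 1 :=
    congrArg Subtype.val w.inv_mul
  induction n using Int.induction_on with
  | zero => exact mem_remainderSubgroup.mpr ⟨1, one_mem _, 0, by rw [lam_zero, zero_mul, add_zero]⟩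
  | succ n ih =>
    obtain ⟨a, ha, comm⟩ := exists_lam_mul (mul_mem u⁻¹.1.2 v.1.2) (other α) n
    have reduce : (lam (other α) (n + 1) : Mixed α ε) = -a * lam (other α) n +
        lam (other α) n * u⁻¹.1.1 * (u.1.1 * lam (other α) 1 + v.1.1) := by
      have cancel : (lam (other α) n * u⁻¹.1.1 * (u.1.1 * lam (other α) 1) : Mixed α ε) =
          lam (other α) (n + 1) := by
        rw [mul_assoc, ← mul_assoc u⁻¹.1.1, inv_mul, one_mul, lam_mul_lam]
      rw [mul_add, cancel, neg_mul, ← comm, ← mul_assoc, add_comm (lam _ _), neg_add_cancel_left]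
    rw [reduce]
    exact add_mem (mul_mem_remainderSubgroup (neg_mem ha) ih)
      (mul_right_mem_remainderSubgroup _ _)
  | pred n ih =>
    obtain ⟨a, ha, comm⟩ := exists_lam_mul (mul_mem v⁻¹.1.2 u.1.2) (other α) (-n - 1)
    rw [eq_neg_mul_add_mul_binomial (y := lam (other α) 1) (inv_mul v) comm, lam_mul_lam,
      sub_add_cancel]
    exact add_mem (mul_mem_remainderSubgroup (neg_mem ha) ih)
      (mul_right_mem_remainderSubgroup _ _)

theorem IsDivisor.exists_remainder {K : Mixed α ε} (hK : IsDivisor K) (A : Mixed α ε) :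
    ∃ P ∈ seriesSubring α ε, ∃ Q, P + Q * K = A := by
  obtain ⟨N, hN⟩ := exists_homogPart_eq_zero A
  rw [← mem_remainderSubgroup, eq_sum_homogPart hN]
  refine sum_mem fun n _ => ?_
  rw [← mul_one (homogPart n A), ← lam_zero (other α), ← neg_add_cancel n, ← lam_mul_lam,
    ← mul_assoc]
  exact mul_mem_remainderSubgroup (homogPart_mul_lam_mem n A) (hK.lam_mem n)

theorem IsDivisor.eq_zero_of_mul_mem {K Q : Mixed α ε} (hK : IsDivisor K)
    (h : Q * K ∈ seriesSubring α ε) : Q = 0 := by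
  obtain ⟨u, v, rfl⟩ := hK
  have mul_inv (w : (seriesSubring α ε)ˣ) : (w.1.1 * w⁻¹.1.1 : Mixed α ε) = 1 :=
    congrArg Subtype.val w.mul_inv
  have isHomog (w : seriesSubring α ε) : IsHomog (other α) 0 w.1.1 :=
    IsSeries.isHomog (ε := ε) w.2
  have recursion (n : ℤ) (hn : n ≠ 0) :
      homogPart (n - 1) Q * (u.1.1 * lam (other α) 1) + homogPart n Q * v.1.1 = 0 := by
    have part_eq_zero : part (other α) (· = n) (Q * (u.1.1 * lam (other α) 1 + v.1.1)).1 = 0 := by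
      funext j
      by_contra hj
      obtain ⟨rfl, hne⟩ := part_ne_zero hj
      exact hn (IsSeries.isHomog h j hne)
    refine Subtype.ext (Eq.trans ?_ part_eq_zero)
    rw [mul_add]
    have degree_one := (isHomog u).mul_Lam 1
    rw [zero_add] at degree_one
    exact (congrArg₂ _ (part_mul degree_one n)
      ((part_mul (isHomog v) n).trans (by rw [sub_zero]; rfl))).symm.trans (part_add _ _ _ _).symm
  have lam_mul_lam_neg : (lam (other α) 1 * lam (other α) (-1) : Mixed α ε) = 1 := by
    rw [lam_mul_lam, add_neg_cancel, lam_zero]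
  obtain ⟨N, hN⟩ := exists_homogPart_eq_zero Q
  rw [eq_sum_homogPart hN]
  refine Finset.sum_eq_zero fun n _ => ?_
  refine eq_zero_of_two_term_recursion (a' := lam (other α) (-1) * u⁻¹.1.1) ?_ (mul_inv v) hN
    recursion n
  rw [mul_assoc, ← mul_assoc (lam _ _), lam_mul_lam_neg, one_mul, mul_inv]

theorem IsDivisor.existsUnique_remainder {K : Mixed α ε} (hK : IsDivisor K) (A : Mixed α ε) :
    ∃! P, P ∈ seriesSubring α ε ∧ ∃ Q, P + Q * K = A := by
  obtain ⟨P, hP, Q, hPQ⟩ := hK.exists_remainder A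
  refine ⟨P, ⟨hP, Q, hPQ⟩, ?_⟩
  rintro P' ⟨hP', Q', hPQ'⟩
  have difference : (Q' - Q) * K = P - P' := by
    rw [sub_mul, sub_eq_sub_iff_add_eq_add, add_comm, hPQ', ← hPQ, add_comm]
  have quotients_eq := hK.eq_zero_of_mul_mem (difference ▸ sub_mem hP hP')
  rw [quotients_eq, zero_mul] at difference
  exact (sub_eq_zero.mp difference.symm).symm

end Mixed

end Op

open Op

variable {α : Fin 2} {ε : ℤˣ}

theorem ρ_ne_zero (hτ : ∀ m, τ m ≠ 0) (m : Lattice) : ρ τ m ≠ 0 :=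
  mul_ne_zero (div_ne_zero (ι_ne_zero (hτ _)) (ι_ne_zero (hτ _)))
    (div_ne_zero (ι_ne_zero (hτ _)) (ι_ne_zero (hτ _)))

theorem isMixed_H (τ : Lattice → TSeries) (α : Fin 2) (ε : ℤˣ) : IsMixed α ε (H τ) :=
  ((isMixed_Lam α 0 ε 1).mul ((isMixed_Lam α 1 ε 1).sub (isSeries_one α ε).isMixed)).add
    (isSeries_ofFun α ε _).isMixed

theorem H_eq (τ : Lattice → TSeries) : H τ = Lam 0 1 * Lam 1 1 + -Lam 0 1 + ofFun (ρ τ) := by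
  have expand : (Mixed.lam 0 1 * (Mixed.lam 1 1 - 1) : Mixed 0 1) =
      Mixed.lam 0 1 * Mixed.lam 1 1 + -Mixed.lam 0 1 := by noncomm_ring
  exact congrArg (· + ofFun (ρ τ)) (congrArg Subtype.val expand)

theorem ofFun_neg_one : ofFun (fun _ => -1) = -1 := by
  ext j m
  rw [neg_apply, one_apply, ofFun]
  split_ifs
  · rfl
  · exact neg_zero.symm

theorem neg_one_mul_Lam (γ : Fin 2) (n : ℤ) : (-1 : Op) * Lam γ n = -Lam γ n := by
  ext j m
  rw [← ofFun_neg_one, ofFun_mul_apply, neg_apply, neg_one_mul]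

theorem isDivisor_H (hτ : ∀ m, τ m ≠ 0) (α : Fin 2) (ε : ℤˣ) :
    Mixed.IsDivisor (⟨H τ, isMixed_H τ α ε⟩ : Mixed α ε) := by
  have neg_one_ne_zero : ∀ _ : Lattice, (-1 : TField) ≠ 0 := fun _ => neg_ne_zero.mpr one_ne_zero
  let ρ' : Mixed α ε := ⟨ofFun (ρ τ), (isSeries_ofFun α ε _).isMixed⟩
  have H_eq : (⟨H τ, isMixed_H τ α ε⟩ : Mixed α ε) = Mixed.lam 0 1 * (Mixed.lam 1 1 - 1) + ρ' := rfl
  rw [H_eq]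
  obtain rfl | rfl : α = 0 ∨ α = 1 := by fin_cases α <;> simp
  · obtain ⟨u, hu⟩ := isUnit_Lam 0 ε 1
    obtain ⟨v, hv⟩ := isUnit_binomial 0 ε (ρ_ne_zero hτ) neg_one_ne_zero
    have v_eq : (v.1.1 : Mixed 0 ε) = ρ' - Mixed.lam 0 1 := by
      refine (congrArg Subtype.val hv).trans (Subtype.ext ?_)
      change ofFun (ρ τ) + ofFun (fun _ => -1) * Lam 0 1 = ofFun (ρ τ) - Lam 0 1
      rw [ofFun_neg_one, neg_one_mul_Lam, sub_eq_add_neg]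
    refine ⟨u, v, ?_⟩
    rw [v_eq, hu]
    change _ = Mixed.lam 0 1 * Mixed.lam 1 1 + _
    noncomm_ring
  · obtain ⟨u, hu⟩ := isUnit_binomial 1 ε neg_one_ne_zero (g := fun _ => 1) fun _ => one_ne_zero
    obtain ⟨v, hv⟩ := isUnit_ofFun 1 ε (ρ_ne_zero hτ)
    have u_eq : (u.1.1 : Mixed 1 ε) = Mixed.lam 1 1 - 1 := by
      refine (congrArg Subtype.val hu).trans (Subtype.ext ?_)
      change ofFun (fun _ => -1) + 1 * Lam 1 1 = Lam 1 1 - 1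
      rw [ofFun_neg_one, Op.one_mul, neg_add_eq_sub]
    refine ⟨u, v, ?_⟩
    rw [u_eq, hv]
    change _ = (Mixed.lam 1 1 - 1) * Mixed.lam 0 1 + ρ'
    rw [sub_mul, Mixed.lam_comm 1 0]
    noncomm_ring

theorem existsUnique_isProj (hτ : ∀ m, τ m ≠ 0) {A : Op} (hA : IsMixed α ε A) :
    ∃! P, IsProj τ α ε A P := by
  obtain ⟨P, ⟨hP, Q, hPQ⟩, unique⟩ := (isDivisor_H hτ α ε).existsUnique_remainder ⟨A, hA⟩
  refine ⟨P, ⟨hP, Q, Q.isMixed, (congrArg Subtype.val hPQ).symm⟩, ?_⟩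
  rintro P' ⟨hP', Q', hQ', hPQ'⟩
  exact congrArg Subtype.val
    (unique ⟨P', hP'.isMixed⟩ ⟨hP', ⟨Q', hQ'⟩, Subtype.ext hPQ'.symm⟩)

theorem isProj_proj (hτ : ∀ m, τ m ≠ 0) {A : Op} (hA : IsMixed α ε A) :
    IsProj τ α ε A (proj τ α ε A) :=
  Classical.epsilon_spec (existsUnique_isProj hτ hA).exists

/-! ### Laurent polynomials -/

namespace Op

theorem IsLaurentPoly.finite {A : Op} (hA : IsLaurentPoly A) : {k | A k ≠ 0}.Finite := by
  obtain ⟨N, hN⟩ := hA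
  exact (Set.finite_Icc (fun _ => -N : Lattice) (fun _ => N)).subset fun k hk =>
    ⟨fun β => (abs_le.mp (hN k hk β)).1, fun β => (abs_le.mp (hN k hk β)).2⟩

theorem isLaurentPoly_of_finite {A : Op} (h : {k | A k ≠ 0}.Finite) : IsLaurentPoly A := by
  obtain ⟨N₀, hN₀⟩ := (h.image fun k => |k 0|).bddAbove
  obtain ⟨N₁, hN₁⟩ := (h.image fun k => |k 1|).bddAbove
  refine ⟨max N₀ N₁, fun j hj β => ?_⟩
  fin_cases β
  · exact (hN₀ ⟨j, hj, rfl⟩).trans (le_max_left _ _)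
  · exact (hN₁ ⟨j, hj, rfl⟩).trans (le_max_right _ _)

theorem units_mul_le_abs (ε : ℤˣ) (x : ℤ) : (ε : ℤ) * x ≤ |x| :=
  (le_abs_self _).trans_eq (abs_eq_abs_units_mul ε x).symm

theorem IsLaurentPoly.isMixed {A : Op} (hA : IsLaurentPoly A) (α : Fin 2) (ε : ℤˣ) :
    IsMixed α ε A := by
  obtain ⟨N, hN⟩ := hA
  exact ⟨N, fun j hj => ⟨fun β _ => hN j hj β, (units_mul_le_abs ε _).trans (hN j hj α)⟩⟩

theorem IsLaurentPoly.isSeries {A : Op} (hA : IsLaurentPoly A) (h : IsHomog (other α) 0 A)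
    (ε : ℤˣ) : IsSeries α ε A := by
  obtain ⟨N, hN⟩ := hA
  exact ⟨N, fun j hj => ⟨fun β hβ => eq_other hβ ▸ h j hj,
    (units_mul_le_abs ε _).trans (hN j hj α)⟩⟩

theorem IsSeries.isLaurentPoly {A : Op} (hA : IsSeries α ε A) {c : ℤ}
    (h : ∀ j, A j ≠ 0 → c ≤ (ε : ℤ) * j α) : IsLaurentPoly A := by
  obtain ⟨N, hN⟩ := hA
  refine ⟨max |c| |N|, fun j hj β => ?_⟩
  by_cases hβ : β = α
  · subst hβ
    rw [abs_eq_abs_units_mul ε]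
    exact abs_le_max_abs_abs (h j hj) (hN j hj).2
  · rw [(hN j hj).1 β hβ, abs_zero]
    exact (abs_nonneg c).trans (le_max_left _ _)

theorem IsSeries.eq_single {A : Op} (hA : IsSeries α ε A) {k : Lattice} (hk : A k ≠ 0) :
    k = Pi.single α (k α) :=
  lattice_ext α (by rw [Pi.single_eq_same])
    (by rw [Pi.single_eq_of_ne (other_ne α), hA.isHomog k hk])

theorem act_neg (A : Op) (φ : Lattice → TField) : act (-A) φ = -act A φ := by
  funext m
  rw [Pi.neg_apply, act, act, ← finsum_neg_distrib]
  exact finsum_congr fun k => neg_mul _ _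

theorem act_Lam (γ : Fin 2) (n : ℤ) (φ : Lattice → TField) (m : Lattice) :
    act (Lam γ n) φ m = φ (m + Pi.single γ n) := by
  rw [act, finsum_eq_single _ (Pi.single γ n)]
  · rw [Lam_apply, if_pos rfl, _root_.one_mul]
  · intro k hk
    rw [Lam_apply, if_neg hk, MulZeroClass.zero_mul]

theorem act_ofFun (f : Lattice → TField) (φ : Lattice → TField) (m : Lattice) :
    act (ofFun f) φ m = f m * φ m := by
  rw [act, finsum_eq_single _ 0]
  · rw [ofFun, if_pos rfl, add_zero]
  · intro k hk
    rw [ofFun_eq_zero f hk, Pi.zero_apply, MulZeroClass.zero_mul]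

theorem act_eq_zero {A : Op} {φ : Lattice → TField} {m : Lattice}
    (h : ∀ k, A k ≠ 0 → φ (m + k) = 0) : act A φ m = 0 := by
  refine finsum_eq_zero_of_forall_eq_zero fun k => ?_
  by_cases hk : A k = 0
  · rw [hk, Pi.zero_apply, MulZeroClass.zero_mul]
  · rw [h k hk, MulZeroClass.mul_zero]

end Op

/-! ### Wave operators -/

/-- `S` is the wave operator in `𝓔^{0,ε}_{(α+1)}` of the `j`-th wave function: the series in
`Λ_{α+1}^{-ε}` with the coefficients of that wave function. The conditions on `α` and `ε` say that
`Λ_{α+1}^{-ε}` shifts the leading order as multiplication by the expansion variable does, and that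
`𝓔^ε_{(α+1)}` acts on the wave function. -/
structure IsWaveOp (τ : Lattice → TSeries) (j : Fin 3) (α : Fin 2) (ε : ℤˣ) (S : Op) : Prop where
  eq_series : S = series α (-ε) (waveCoeff τ j)
  dir_mul_lead : ∀ m x, (dir j : ℤ) * lead j (m + Pi.single α x) = dir j * lead j m - ε * x
  admissible : ∀ n, Admissible α ε (wave τ j n)

theorem dir_mul_nonneg_of_wave_ne_zero {j : Fin 3} {n : ℤ} {m : Lattice} (h : wave τ j n m ≠ 0) :
    0 ≤ (dir j : ℤ) * (n - lead j m) :=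
  not_lt.mp fun hlt => h (wave_eq_zero hlt)

theorem waveCoeff_zero_ne_zero (hτ : ∀ m, τ m ≠ 0) (j : Fin 3) (m : Lattice) :
    waveCoeff τ j 0 m ≠ 0 := by
  rw [waveCoeff_zero]
  exact mul_ne_zero (sgn_cast_ne_zero j m) (div_ne_zero (ι_ne_zero (hτ _)) (ι_ne_zero (hτ _)))

theorem isWaveOp_S₁ (τ : Lattice → TSeries) : IsWaveOp τ 0 0 1 (S₁ τ) where
  eq_series := congrArg (series 0 (-1)) (by funext k m; simp [waveCoeff, sgn, latShift])
  dir_mul_lead m x := by simp [dir, lead]; ring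
  admissible n M := by
    refine ⟨n, fun m hm _ => ?_⟩
    have order_nonneg := dir_mul_nonneg_of_wave_ne_zero hm
    simp only [dir, lead, Matrix.cons_val, Units.val_neg, Units.val_one] at order_nonneg ⊢
    omega

theorem isWaveOp_S₂ (τ : Lattice → TSeries) : IsWaveOp τ 1 1 (-1) (S₂ τ) where
  eq_series := by
    rw [neg_neg]
    exact congrArg (series 1 1) (by funext k m; simp [waveCoeff, sgn, latShift])
  dir_mul_lead m x := by simp [dir, lead]
  admissible n M := by
    refine ⟨-n, fun m hm _ => ?_⟩
    have order_nonneg := dir_mul_nonneg_of_wave_ne_zero hm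
    simp only [dir, lead, Matrix.cons_val, Units.val_neg, Units.val_one] at order_nonneg ⊢
    omega

theorem isWaveOp_S₃ (τ : Lattice → TSeries) : IsWaveOp τ 2 0 (-1) (S₃ τ) where
  eq_series := by rw [neg_neg]; rfl
  dir_mul_lead m x := by simp [dir, lead]; ring
  admissible n M := by
    refine ⟨-n - M, fun m hm hM => ?_⟩
    have order_nonneg := dir_mul_nonneg_of_wave_ne_zero hm
    have le_M := (abs_le.mp (hM 1 (by decide))).2
    simp only [dir, lead, Matrix.cons_val, Units.val_neg, Units.val_one] at order_nonneg ⊢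
    omega

theorem isWaveOp_S₃' (τ : Lattice → TSeries) : IsWaveOp τ 2 1 1 (S₃' τ) where
  eq_series := rfl
  dir_mul_lead m x := by simp [dir, lead]; ring
  admissible n M := by
    refine ⟨-n - M, fun m hm hM => ?_⟩
    have order_nonneg := dir_mul_nonneg_of_wave_ne_zero hm
    have neg_le := (abs_le.mp (hM 0 (by decide))).1
    simp only [dir, lead, Matrix.cons_val, Units.val_one] at order_nonneg ⊢
    omega

/-- The operator `M` for which `S M` has the coefficients of the wave function of `S` multiplied by
the `t_σ`-derivative of the exponent of its exponential factor. -/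
def expFactor (α : Fin 2) (ε : ℤˣ) (j : Fin 3) (σ : TimeIdx) : Op :=
  if σ.1 = j then Lam α (ε * (σ.2 : ℕ)) else 0

theorem isSeries_expFactor (α : Fin 2) (ε : ℤˣ) (j : Fin 3) (σ : TimeIdx) :
    IsSeries α ε (expFactor α ε j σ) := by
  unfold expFactor
  split_ifs
  · exact isSeries_Lam α ε _
  · exact IsSeries.zero α ε

theorem expFactor_mul_Lam (q : ℤ) (j : Fin 3) (σ : TimeIdx) :
    expFactor α ε j σ * Lam α q = Lam α q * expFactor α ε j σ := by
  unfold expFactor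
  split_ifs
  · exact Lam_comm α α _ _
  · rw [Op.zero_mul, Op.mul_zero]

namespace IsWaveOp

variable {j : Fin 3} {S : Op}

theorem isSeries (hS : IsWaveOp τ j α ε S) : IsSeries α ε S :=
  hS.eq_series ▸ isSeries_series α ε _

theorem existsUnique_isInv (hτ : ∀ m, τ m ≠ 0) (hS : IsWaveOp τ j α ε S) :
    ∃! T, IsInv α ε S T := by
  rw [hS.eq_series]
  exact existsUnique_isInv_series α ε (waveCoeff_zero_ne_zero hτ j)

theorem isInv_inv (hτ : ∀ m, τ m ≠ 0) (hS : IsWaveOp τ j α ε S) : IsInv α ε S (inv α ε S) :=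
  Op.isInv_inv (hS.existsUnique_isInv hτ).exists

theorem wave_eq (hS : IsWaveOp τ j α ε S) (n : ℤ) (m : Lattice) :
    wave τ j n m = S (Pi.single α (-ε * (dir j * (n - lead j m)))) m := by
  rw [hS.eq_series]
  rcases lt_or_ge ((dir j : ℤ) * (n - lead j m)) 0 with hn | hn
  · rw [wave_eq_zero hn]
    by_contra coeff_ne
    obtain ⟨p, hp⟩ := eq_single_of_series_ne_zero (ne_zero_of_apply (Ne.symm coeff_ne))
    have exponents_eq := Pi.single_injective α hp
    rw [Units.val_neg] at exponents_eq
    have order_eq := mul_left_cancel₀ (neg_ne_zero.mpr ε.ne_zero) exponents_eq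
    omega
  · obtain ⟨k, hk⟩ := Int.eq_ofNat_of_zero_le hn
    rw [wave_eq_waveCoeff hk.symm, hk]
    exact (series_single α (-ε) _ k m).symm

theorem act_wave (hS : IsWaveOp τ j α ε S) {C : Op} (hC : IsSeries α ε C) (n : ℤ) (m : Lattice) :
    act C (wave τ j n) m = (C * S) (Pi.single α (-ε * (dir j * (n - lead j m)))) m := by
  rw [act, mul_apply]
  refine finsum_congr fun k => ?_
  by_cases hk : C k = 0
  · rw [hk, Pi.zero_apply, MulZeroClass.zero_mul, MulZeroClass.zero_mul]
  · rw [hS.wave_eq]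
    congr 2
    rw [hC.eq_single hk, ← Pi.single_sub (f := fun _ : Fin 2 => ℤ)]
    congr 1
    linear_combination (ε : ℤ) * hS.dir_mul_lead m (k α) - units_mul_mul ε (k α)

theorem wave_shift (hS : IsWaveOp τ j α ε S) (n k : ℤ) (m : Lattice) :
    wave τ j (n + dir j * k) m =
      (S * Lam α (ε * k)) (Pi.single α (-ε * (dir j * (n - lead j m)))) m := by
  rw [mul_Lam_apply, ← Pi.single_sub (f := fun _ : Fin 2 => ℤ), hS.wave_eq]
  congr 2
  linear_combination (-(ε : ℤ) * k) * units_mul_self (dir j)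

theorem flowD_wave_eq (hS : IsWaveOp τ j α ε S) (σ : TimeIdx) (n : ℤ) (m : Lattice) :
    flowD σ j (wave τ j) n m = (S.deriv σ + S * expFactor α ε j σ)
      (Pi.single α (-ε * (dir j * (n - lead j m)))) m := by
  rw [flowD, add_apply, deriv_apply, ← hS.wave_eq, hS.wave_shift, expFactor]
  split_ifs
  · rfl
  · rw [Op.mul_zero, zero_apply]

theorem sato (hS : IsWaveOp τ j α ε S) {C : Op} (hC : IsSeries α ε C) (σ : TimeIdx)
    (linear : ∀ n m, act C (wave τ j n) m = flowD σ j (wave τ j) n m) :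
    C * S = S.deriv σ + S * expFactor α ε j σ := by
  have lhs_isSeries := hC.mul hS.isSeries
  have rhs_isSeries :=
    (hS.isSeries.deriv σ).add (hS.isSeries.mul (isSeries_expFactor α ε j σ))
  ext i m
  by_cases hi : i (other α) = 0
  · obtain ⟨n, rfl⟩ : ∃ n : ℤ, i = Pi.single α (-ε * (dir j * (n - lead j m))) := by
      refine ⟨lead j m - ε * dir j * i α, lattice_ext α ?_ ?_⟩
      · rw [Pi.single_eq_same]
        linear_combination (-(dir j : ℤ) * dir j * i α) * units_mul_self ε -
          i α * units_mul_self (dir j)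
      · rw [Pi.single_eq_of_ne (other_ne α), hi]
    rw [← hS.act_wave hC, linear, hS.flowD_wave_eq]
  · have apply_eq_zero {A : Op} (hA : IsSeries α ε A) : A i m = 0 := by
      by_contra hne
      exact hi (hA.isHomog i (ne_zero_of_apply hne))
    rw [apply_eq_zero lhs_isSeries, apply_eq_zero rhs_isSeries]

theorem lax (hτ : ∀ m, τ m ≠ 0) (hS : IsWaveOp τ j α ε S) {C : Op} (hC : IsSeries α ε C)
    (σ : TimeIdx) (linear : ∀ n m, act C (wave τ j n) m = flowD σ j (wave τ j) n m) (q : ℤ) :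
    (S * Lam α q * inv α ε S).deriv σ = C.comm (S * Lam α q * inv α ε S) := by
  obtain ⟨inv_isSeries, mul_inv, inv_mul⟩ := hS.isInv_inv hτ
  exact lax_of_sato q hS.isSeries.isMixed inv_isSeries.isMixed hC.isMixed
    (isSeries_expFactor α ε j σ).isMixed mul_inv inv_mul (expFactor_mul_Lam q j σ)
    (hS.sato hC σ linear)

theorem isSeries_lax (hτ : ∀ m, τ m ≠ 0) (hS : IsWaveOp τ j α ε S) (q : ℤ) :
    IsSeries α ε (S * Lam α q * inv α ε S) :=
  (hS.isSeries.mul (isSeries_Lam α ε q)).mul (hS.isInv_inv hτ).1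

theorem isSeries_lax_pow (hτ : ∀ m, τ m ≠ 0) (hS : IsWaveOp τ j α ε S) (q : ℤ) (k : ℕ) :
    IsSeries α ε (Op.pow (S * Lam α q * inv α ε S) k) := by
  let l : Mixed.seriesSubring α ε := (hS.isSeries_lax hτ q).toSubring
  have l_pow := Mixed.coe_pow l.1 k
  exact l_pow ▸ pow_mem l.2 k

theorem lax_pow_mul (hτ : ∀ m, τ m ≠ 0) (hS : IsWaveOp τ j α ε S) (q : ℤ) (k : ℕ) :
    Op.pow (S * Lam α q * inv α ε S) k * S = S * Lam α (q * k) := by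
  obtain ⟨inv_isSeries, -, inv_mul⟩ := hS.isInv_inv hτ
  let s : Mixed α ε := ⟨S, hS.isSeries.isMixed⟩
  let t : Mixed α ε := ⟨inv α ε S, inv_isSeries.isMixed⟩
  have intertwine : SemiconjBy s (Mixed.lam α q) (s * Mixed.lam α q * t) := by
    have inv_mul' : t * s = 1 := Subtype.ext inv_mul
    rw [SemiconjBy, _root_.mul_assoc _ t s, inv_mul', _root_.mul_one]
  have intertwine_pow := congrArg Subtype.val (intertwine.pow_right k)
  rw [Mixed.lam_pow, mul_comm, Mixed.coe_mul, Mixed.coe_mul, Mixed.coe_pow] at intertwine_pow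
  exact intertwine_pow.symm

theorem flowD_sub_act (hτ : ∀ m, τ m ≠ 0) (hS : IsWaveOp τ j α ε S) {k : ℕ+} {B R : Op}
    (hB : IsSeries α ε B) (hR : IsSeries α ε R)
    (pow_eq : Op.pow (S * Lam α ε * inv α ε S) k = B + R) (n : ℤ) (m : Lattice) :
    flowD (j, k) j (wave τ j) n m - act B (wave τ j n) m =
      dt (j, k) (wave τ j n m) + act R (wave τ j n) m := by
  have act_pow : act (B + R) (wave τ j n) m = wave τ j (n + dir j * (k : ℕ)) m := by
    rw [← pow_eq, hS.act_wave (hS.isSeries_lax_pow hτ ε k), hS.lax_pow_mul hτ, hS.wave_shift]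
  rw [act_add hB.isMixed hR.isMixed (hS.admissible n), Pi.add_apply] at act_pow
  rw [flowD, if_pos rfl, ← act_pow]
  ring

theorem act_wave_eq_zero (hS : IsWaveOp τ j α ε S) {R : Op} (hR : IsSeries α ε R) {c : ℤ}
    (order_le : ∀ i, R i ≠ 0 → (ε : ℤ) * i α ≤ c) {n : ℤ} {m : Lattice}
    (h : (dir j : ℤ) * (n - lead j m) + c < 0) : act R (wave τ j n) m = 0 := by
  refine act_eq_zero fun k hk => wave_eq_zero ?_
  have lead_shift := hS.dir_mul_lead m (k α)
  rw [← hR.eq_single hk] at lead_shift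
  have k_order := order_le k hk
  rw [mul_sub] at h ⊢
  linarith

end IsWaveOp

/-! ### The linear equations for the wave functions -/

theorem wave_eq_zero_of_lt {j : Fin 3} {m : Lattice} {n : ℤ}
    (h : (dir j : ℤ) * n < dir j * lead j m) : wave τ j n m = 0 :=
  wave_eq_zero (by rw [mul_sub]; linarith)

theorem flowD_wave_eq_zero {σ : TimeIdx} {j : Fin 3} {m : Lattice} {n : ℤ}
    (h : (dir j : ℤ) * n < dir j * lead j m - (σ.2 : ℕ)) : flowD σ j (wave τ j) n m = 0 := by
  rw [flowD, wave_eq_zero_of_lt (by omega), wave_eq_zero_of_lt, ite_self, dt_zero, add_zero]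
  rw [mul_add, ← mul_assoc, units_mul_self]
  linarith

theorem exists_act_wave_eq_zero {B : Op} (hB : IsLaurentPoly B) (j : Fin 3) (m : Lattice) :
    ∃ c, ∀ n, (dir j : ℤ) * n < c → act B (wave τ j n) m = 0 := by
  obtain ⟨c, hc⟩ := (hB.finite.image fun k => (dir j : ℤ) * lead j (m + k)).bddBelow
  exact ⟨c, fun n hn => act_eq_zero fun k hk =>
    wave_eq_zero_of_lt (hn.trans_le (hc ⟨k, hk, rfl⟩))⟩

theorem finsum_act_mul_dual {B : Op} (hB : IsLaurentPoly B) (j : Fin 3) (m m' : Lattice) :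
    ∑ᶠ n, act B (wave τ j n) m * dual τ j m' n =
      ∑ᶠ k, B k m * ∑ᶠ n, wave τ j n (m + k) * dual τ j m' n := by
  refine finsum_mul_finsum_assoc (fun k => B k m) (fun k n => wave τ j n (m + k))
    (fun n => dual τ j m' n) ?_
  refine (hB.finite.biUnion fun k _ => (mul_dual_support_finite (τ := τ)
    (U := fun n => wave τ j n (m + k)) (fun _ => wave_eq_zero_of_lt) m').image
      (Prod.mk k)).subset ?_
  rintro ⟨k, n⟩ hp
  exact Set.mem_biUnion (ne_zero_of_apply (left_ne_zero_of_mul hp))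
    ⟨n, right_ne_zero_of_mul hp, rfl⟩

theorem IsTau.pairing_act (hτ : IsTau τ) {B : Op} (hB : IsLaurentPoly B) (m m' : Lattice) :
    ∑ᶠ n, act B (wave τ 0 n) m * dual τ 0 m' n =
      ∑ᶠ n, act B (wave τ 1 n) m * dual τ 1 m' n + ∑ᶠ n, act B (wave τ 2 n) m * dual τ 2 m' n := by
  simp only [finsum_act_mul_dual hB]
  have finite_support (j : Fin 3) : (Function.support fun k => B k m *
      ∑ᶠ n, wave τ j n (m + k) * dual τ j m' n).Finite :=
    hB.finite.subset fun k hk => ne_zero_of_apply (left_ne_zero_of_mul hk)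
  rw [← finsum_add_distrib (finite_support 1) (finite_support 2)]
  exact finsum_congr fun k => by rw [hτ.pairing, mul_add]

theorem finsum_flowD_sub_act_mul_dual {B : Op} (hB : IsLaurentPoly B) (σ : TimeIdx) (j : Fin 3)
    (m m' : Lattice) :
    ∑ᶠ n, (flowD σ j (wave τ j) n m - act B (wave τ j n) m) * dual τ j m' n =
      ∑ᶠ n, flowD σ j (wave τ j) n m * dual τ j m' n -
        ∑ᶠ n, act B (wave τ j n) m * dual τ j m' n := by
  obtain ⟨c, hc⟩ := exists_act_wave_eq_zero (τ := τ) hB j m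
  rw [← finsum_sub_distrib (mul_dual_support_finite (fun _ => flowD_wave_eq_zero) m')
    (mul_dual_support_finite hc m')]
  exact finsum_congr fun n => sub_mul _ _ _

theorem IsTau.act_wave_eq_flowD (hτ : IsTau τ) {B : Op} (hB : IsLaurentPoly B) (σ : TimeIdx)
    (leading₀ : ∀ m n, lead 0 m ≤ n → flowD σ 0 (wave τ 0) n m - act B (wave τ 0 n) m = 0)
    (leading₁ : ∀ m, ∀ n < lead 1 m, flowD σ 1 (wave τ 1) n m - act B (wave τ 1 n) m = 0)
    (leading₂ : ∀ m, ∀ n < lead 2 m, flowD σ 2 (wave τ 2) n m - act B (wave τ 2 n) m = 0)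
    (j : Fin 3) (n : ℤ) (m : Lattice) :
    act B (wave τ j n) m = flowD σ j (wave τ j) n m := by
  have difference_eq_zero := eq_zero_of_pairing hτ.ne_zero
    (U := fun j n => flowD σ j (wave τ j) n m - act B (wave τ j n) m)
    (leading₀ m) (leading₁ m) (leading₂ m) (fun m' => ?_) j
  · exact (sub_eq_zero.mp (congrFun difference_eq_zero n)).symm
  · simp only [finsum_flowD_sub_act_mul_dual hB, hτ.pairing_flowD, hτ.pairing_act hB]
    ring

/-! ### The wave functions are annihilated by `H` -/

theorem isLaurentPoly_H (τ : Lattice → TSeries) : IsLaurentPoly (H τ) := by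
  refine isLaurentPoly_of_finite ((Set.toFinite {0, Pi.single 0 1,
    Pi.single 0 1 + Pi.single 1 1}).subset fun k hk => ?_)
  obtain ⟨m, hm⟩ := Function.ne_iff.mp hk
  rw [H_eq, add_apply, add_apply, neg_apply, Lam_mul_Lam_apply, Lam_apply, ofFun] at hm
  by_contra hn
  simp only [Set.mem_insert_iff, Set.mem_singleton_iff, not_or] at hn
  simp [hn.1, hn.2.1, hn.2.2] at hm

theorem exists_admissible_wave (τ : Lattice → TSeries) (j : Fin 3) :
    ∃ α ε, ∀ n, Admissible α ε (wave τ j n) := by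
  fin_cases j
  · exact ⟨_, _, (isWaveOp_S₁ τ).admissible⟩
  · exact ⟨_, _, (isWaveOp_S₂ τ).admissible⟩
  · exact ⟨_, _, (isWaveOp_S₃ τ).admissible⟩

theorem single_zero_one : (Pi.single 0 1 : Lattice) = e₁ := by
  funext β
  fin_cases β <;> simp [e₁]

theorem single_zero_one_add_single_one_one : (Pi.single 0 1 + Pi.single 1 1 : Lattice) = e := by
  funext β
  fin_cases β <;> simp [e]

theorem act_H_wave (τ : Lattice → TSeries) (j : Fin 3) (n : ℤ) (m : Lattice) :
    act (H τ) (wave τ j n) m =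
      wave τ j n (m + e) - wave τ j n (m + e₁) + ρ τ m * wave τ j n m := by
  obtain ⟨α, ε, admissible⟩ := exists_admissible_wave τ j
  have hΛ (γ : Fin 2) : IsMixed α ε (Lam γ 1) := isMixed_Lam α γ ε 1
  have hρ : IsMixed α ε (ofFun (ρ τ)) := (isSeries_ofFun α ε _).isMixed
  rw [H_eq, act_add (((hΛ 0).mul (hΛ 1)).add (hΛ 0).neg) hρ (admissible n),
    act_add ((hΛ 0).mul (hΛ 1)) (hΛ 0).neg (admissible n), act_mul (hΛ 0) (hΛ 1) (admissible n),
    act_neg, Pi.add_apply, Pi.add_apply, Pi.neg_apply, act_Lam, act_Lam, act_Lam, act_ofFun,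
    add_assoc m, single_zero_one_add_single_one_one, single_zero_one, sub_eq_add_neg]

theorem act_H_wave_zero_eq_zero (hτ : ∀ m, τ m ≠ 0) {n : ℤ} {m : Lattice}
    (h : lead 0 (m + e₁) ≤ n) : act (H τ) (wave τ 0 n) m = 0 := by
  have lead_e : lead 0 (m + e) = lead 0 (m + e₁) := by simp [lead, e, e₁]
  have lead_e₁ : lead 0 (m + e₁) = lead 0 m + 1 := by simp [lead, e₁]
  rw [act_H_wave, wave_eq_zero_of_lt (m := m) (by simp [dir]; omega), mul_zero, add_zero]
  rcases h.eq_or_lt with rfl | hn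
  · rw [← lead_e, wave_lead, lead_e, wave_lead]
    simp [sgn, latShift, ι_ne_zero (hτ _)]
  · rw [wave_eq_zero_of_lt (by simp [dir]; omega), wave_eq_zero_of_lt (by simp [dir]; omega),
      sub_zero]

theorem act_H_wave_one_eq_zero {n : ℤ} {m : Lattice} (h : n < lead 1 (m + e₁)) :
    act (H τ) (wave τ 1 n) m = 0 := by
  have lead_e : lead 1 (m + e) = lead 1 m + 1 := by simp [lead, e]
  have lead_e₁ : lead 1 (m + e₁) = lead 1 m := by simp [lead, e₁]
  rw [act_H_wave, wave_eq_zero_of_lt (m := m + e) (by simp [dir]; omega),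
    wave_eq_zero_of_lt (m := m + e₁) (by simp [dir]; omega),
    wave_eq_zero_of_lt (m := m) (by simp [dir]; omega), sub_zero, mul_zero, add_zero]

theorem act_H_wave_two_eq_zero (hτ : ∀ m, τ m ≠ 0) {n : ℤ} {m : Lattice}
    (h : n < lead 2 (m + e₁)) : act (H τ) (wave τ 2 n) m = 0 := by
  have lead_e : lead 2 (m + e) = lead 2 m := by simp [lead, e]
  have lead_e₁ : lead 2 (m + e₁) = lead 2 m + 1 := by simp [lead, e₁]; ring
  rw [act_H_wave, wave_eq_zero_of_lt (m := m + e₁) (by simp [dir]; omega), sub_zero]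
  rcases (show n ≤ lead 2 m by omega).eq_or_lt with rfl | hn
  · -- `ρ` is chosen so that the two leading coefficients cancel.
    have sgn_e : sgn 2 (m + e) = -sgn 2 m := by
      simp [sgn, e, Int.negOnePow_succ]
    have τ_m_ne_zero := ι_ne_zero (hτ m)
    have τ_e₁_ne_zero := ι_ne_zero (hτ (m + e₁))
    have τ_e_ne_zero := ι_ne_zero (hτ (m + e))
    rw [wave_lead, ← lead_e, wave_lead, sgn_e, ρ]
    simp only [latShift, Matrix.cons_val]
    push_cast
    field_simp
    ring
  · rw [wave_eq_zero_of_lt (by simp [dir]; omega),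
      wave_eq_zero_of_lt (m := m) (by simp [dir]; omega), mul_zero, add_zero]

theorem IsTau.act_H_wave_eq_zero (hτ : IsTau τ) (j : Fin 3) (n : ℤ) (m : Lattice) :
    act (H τ) (wave τ j n) m = 0 :=
  congrFun (eq_zero_of_pairing hτ.ne_zero (U := fun j n => act (H τ) (wave τ j n) m) (M := m + e₁)
    (fun _ => act_H_wave_zero_eq_zero hτ.ne_zero) (fun _ => act_H_wave_one_eq_zero)
    (fun _ => act_H_wave_two_eq_zero hτ.ne_zero) (hτ.pairing_act (isLaurentPoly_H τ) m) j) n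

theorem IsTau.act_proj (hτ : IsTau τ) {A : Op} (hA : IsMixed α ε A) {j : Fin 3} {n : ℤ}
    (admissible : Admissible α ε (wave τ j n)) (m : Lattice) :
    act (proj τ α ε A) (wave τ j n) m = act A (wave τ j n) m := by
  obtain ⟨hP, Q, hQ, decomposition⟩ := isProj_proj hτ.ne_zero hA
  have act_H : act (H τ) (wave τ j n) = fun _ => 0 := funext (hτ.act_H_wave_eq_zero j n)
  conv_rhs => rw [decomposition]
  rw [act_add hP.isMixed (hQ.mul (isMixed_H τ α ε)) admissible,
    act_mul hQ (isMixed_H τ α ε) admissible, act_H, act_zero_right, Pi.add_apply, add_zero]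

theorem IsWaveOp.lax_proj (hτ : IsTau τ) {j : Fin 3} {S : Op} (hS : IsWaveOp τ j α ε S) {B : Op}
    (hB : IsMixed α ε B) (σ : TimeIdx)
    (linear : ∀ n m, act B (wave τ j n) m = flowD σ j (wave τ j) n m) (q : ℤ) :
    (S * Lam α q * inv α ε S).deriv σ = (proj τ α ε B).comm (S * Lam α q * inv α ε S) :=
  hS.lax hτ.ne_zero (isProj_proj hτ.ne_zero hB).1 σ
    (fun n m => (hτ.act_proj hB (hS.admissible n) m).trans (linear n m)) q

/-! ### Truncations in powers of `Δ` -/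

theorem sum_neg_one_pow_mul_choose_mul_choose {R : Type*} [CommRing R] {N n : ℕ} (hn : n ≤ N)
    (l : ℕ) : ∑ k ∈ Finset.range (N + 1), (-1) ^ (k + l) * (k.choose l : R) * (n.choose k : R) =
      if n = l then 1 else 0 := by
  have binomial_inversion : ∑ k ∈ Finset.range (n + 1),
      ((-1 : R) ^ (n - k) * (n.choose k : R)) * (k.choose l : R) = if n = l then 1 else 0 := by
    have fwdDiff := fwdDiff_iter_choose_zero l n
    rw [fwdDiff_iter_eq_sum_shift] at fwdDiff
    simpa using congrArg (Int.cast (R := R)) fwdDiff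
  calc
    _ = ∑ k ∈ Finset.range (n + 1), (-1) ^ (k + l) * (k.choose l : R) * (n.choose k : R) := by
      refine (Finset.sum_subset (Finset.range_mono (by omega)) fun k _ hk => ?_).symm
      rw [Finset.mem_range] at hk
      rw [Nat.choose_eq_zero_of_lt (by omega : n < k), Nat.cast_zero, mul_zero]
    _ = (-1) ^ (n + l) * ∑ k ∈ Finset.range (n + 1),
        ((-1 : R) ^ (n - k) * (n.choose k : R)) * (k.choose l : R) := by
      rw [Finset.mul_sum]
      refine Finset.sum_congr rfl fun k hk => ?_
      obtain ⟨d, rfl⟩ := Nat.exists_eq_add_of_le (Finset.mem_range_succ_iff.mp hk)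
      have sign : (-1 : R) ^ (k + d + l) * (-1) ^ d = (-1) ^ (k + l) := by
        rw [← pow_add, show k + d + l + d = k + l + 2 * d by ring, pow_add _ (k + l), pow_mul]
        simp
      rw [Nat.add_sub_cancel_left, ← sign]
      ring
    _ = _ := by
      rw [binomial_inversion]
      split_ifs with h
      · rw [h, ← two_mul, pow_mul]
        simp
      · rw [mul_zero]

theorem sum_neg_one_pow_mul_choose_mul_sum {R : Type*} [CommRing R] {a : ℕ → R} {N : ℕ}
    (ha : ∀ n, N < n → a n = 0) (l : ℕ) :
    ∑ k ∈ Finset.range (N + 1), (-1) ^ (k + l) * (k.choose l : R) *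
      ∑ n ∈ Finset.range (N + 1), (n.choose k : R) * a n = a l := by
  simp only [Finset.mul_sum, ← mul_assoc]
  rw [Finset.sum_comm]
  simp only [← Finset.sum_mul]
  have inner (n : ℕ) (hn : n ∈ Finset.range (N + 1)) := congrArg (· * a n)
    (sum_neg_one_pow_mul_choose_mul_choose (R := R) (Finset.mem_range_succ_iff.mp hn) l)
  rw [Finset.sum_congr rfl inner]
  simp only [ite_mul, one_mul, zero_mul, Finset.sum_ite_eq', Finset.mem_range]
  exact ite_eq_left_iff.mpr fun hl => (ha l (by omega)).symm

namespace Op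

section OrderBound

variable {A : Op} {N : ℕ}

theorem apply_single_eq_zero (hN : ∀ j, A j ≠ 0 → (ε : ℤ) * j α ≤ N) {n : ℕ} (hn : N < n)
    (m : Lattice) : A (Pi.single α ((ε : ℤ) * n)) m = 0 := by
  by_contra hne
  have order_le := hN _ (ne_zero_of_apply hne)
  rw [Pi.single_eq_same, units_mul_mul] at order_le
  omega

theorem deltaCoeff_eq_sum (hN : ∀ j, A j ≠ 0 → (ε : ℤ) * j α ≤ N) (k : ℕ) (m : Lattice) :
    deltaCoeff α ε A k m = ∑ n ∈ Finset.range (N + 1),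
      ((n.choose k : ℕ) : TField) * A (Pi.single α ((ε : ℤ) * n)) m := by
  refine finsum_eq_sum_of_support_subset _ fun n hn => ?_
  rw [Finset.coe_range, Set.mem_Iio]
  by_contra hNn
  exact right_ne_zero_of_mul hn (apply_single_eq_zero hN (by omega) m)

theorem deltaCoeff_eq_zero (hN : ∀ j, A j ≠ 0 → (ε : ℤ) * j α ≤ N) {k : ℕ} (hk : N < k)
    (m : Lattice) : deltaCoeff α ε A k m = 0 := by
  rw [deltaCoeff_eq_sum hN]
  refine Finset.sum_eq_zero fun n hn => ?_
  rw [Nat.choose_eq_zero_of_lt ((Finset.mem_range_succ_iff.mp hn).trans_lt hk), Nat.cast_zero,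
    MulZeroClass.zero_mul]

theorem deltaPartPos_single (hN : ∀ j, A j ≠ 0 → (ε : ℤ) * j α ≤ N) (l : ℕ) (m : Lattice) :
    deltaPartPos α ε A (Pi.single α ((ε : ℤ) * l)) m = A (Pi.single α ((ε : ℤ) * l)) m -
      if l = 0 then ∑ n ∈ Finset.range (N + 1), A (Pi.single α ((ε : ℤ) * n)) m else 0 := by
  have support_subset : (Function.support fun k : ℕ => if 1 ≤ k then
      (-1) ^ (k + l) * ((k.choose l : ℕ) : TField) * deltaCoeff α ε A k m else 0) ⊆
        (Finset.range (N + 1) : Finset ℕ) := by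
    intro k hk
    rw [Finset.coe_range, Set.mem_Iio]
    by_contra hkN
    simp [deltaCoeff_eq_zero hN (by omega : N < k)] at hk
  have all_orders := sum_neg_one_pow_mul_choose_mul_sum
    (fun n hn => apply_single_eq_zero hN hn m) l
  simp only [← deltaCoeff_eq_sum hN] at all_orders
  rw [deltaPartPos, series_single, finsum_eq_sum_of_support_subset _ support_subset, ← all_orders,
    Finset.sum_range_succ', Finset.sum_range_succ', deltaCoeff_eq_sum hN 0]
  rcases l with _ | l <;> simp

theorem exists_eq_single_of_deltaPartPos_ne_zero (hN : ∀ j, A j ≠ 0 → (ε : ℤ) * j α ≤ N)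
    {j m : Lattice} (hj : deltaPartPos α ε A j m ≠ 0) :
    ∃ l ≤ N, j = Pi.single α ((ε : ℤ) * (l : ℕ)) := by
  obtain ⟨l, rfl⟩ := eq_single_of_series_ne_zero (ne_zero_of_apply hj)
  refine ⟨l, not_lt.mp fun hl => hj ?_, rfl⟩
  rw [deltaPartPos_single hN, apply_single_eq_zero hN hl, if_neg (by omega), sub_zero]

theorem finsum_deltaPartPos_of_le (hN : ∀ j, A j ≠ 0 → (ε : ℤ) * j α ≤ N) (m : Lattice) :
    ∑ᶠ j, deltaPartPos α ε A j m = 0 := by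
  rw [finsum_eq_sum_of_support_subset _
    (s := (Finset.range (N + 1)).map ⟨_, single_mul_injective α ε⟩), Finset.sum_map]
  · simp only [Function.Embedding.coeFn_mk, deltaPartPos_single hN]
    rw [Finset.sum_sub_distrib, Finset.sum_ite_eq', if_pos (by simp), sub_self]
  · intro j hj
    obtain ⟨l, hl, rfl⟩ := exists_eq_single_of_deltaPartPos_ne_zero hN hj
    rw [Finset.coe_map, Finset.coe_range]
    exact ⟨l, Set.mem_Iio.mpr (by omega), rfl⟩

end OrderBound

variable {A : Op}

theorem deltaPartPos_isHomog (α : Fin 2) (ε : ℤˣ) (A : Op) :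
    IsHomog (other α) 0 (deltaPartPos α ε A) := fun j hj => by
  obtain ⟨l, rfl⟩ := eq_single_of_series_ne_zero hj
  exact Pi.single_eq_of_ne (other_ne α) _

theorem deltaPartPos_order_nonneg {j : Lattice} (hj : deltaPartPos α ε A j ≠ 0) :
    0 ≤ (ε : ℤ) * j α := by
  obtain ⟨l, rfl⟩ := eq_single_of_series_ne_zero hj
  rw [Pi.single_eq_same, units_mul_mul]
  omega

theorem IsSeries.exists_nat_order_le (hA : IsSeries α ε A) :
    ∃ N : ℕ, ∀ j, A j ≠ 0 → (ε : ℤ) * j α ≤ N := by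
  obtain ⟨N, hN⟩ := hA
  exact ⟨N.toNat, fun j hj => (hN j hj).2.trans (Int.self_le_toNat N)⟩

theorem IsSeries.isLaurentPoly_deltaPartPos (hA : IsSeries α ε A) :
    IsLaurentPoly (deltaPartPos α ε A) := by
  obtain ⟨N, hN⟩ := hA.exists_nat_order_le
  refine isLaurentPoly_of_finite (((Set.finite_Iic N).image
    fun l : ℕ => (Pi.single α ((ε : ℤ) * l) : Lattice)).subset fun j hj => ?_)
  obtain ⟨m, hm⟩ := Function.ne_iff.mp hj
  obtain ⟨l, hl, rfl⟩ := exists_eq_single_of_deltaPartPos_ne_zero hN hm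
  exact ⟨l, hl, rfl⟩

theorem IsSeries.sub_deltaPartPos_order_nonpos (hA : IsSeries α ε A) {j : Lattice}
    (hj : (A - deltaPartPos α ε A) j ≠ 0) : (ε : ℤ) * j α ≤ 0 := by
  obtain ⟨N, hN⟩ := hA.exists_nat_order_le
  by_contra! order_pos
  apply hj
  funext m
  rw [sub_apply, Pi.zero_apply, sub_eq_zero]
  by_cases on_axis : j (other α) = 0
  · obtain ⟨l, rfl⟩ : ∃ l : ℕ, j = Pi.single α ((ε : ℤ) * l) := by
      refine ⟨((ε : ℤ) * j α).toNat, lattice_ext α ?_ ?_⟩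
      · rw [Pi.single_eq_same, Int.toNat_of_nonneg order_pos.le, units_mul_mul]
      · rw [Pi.single_eq_of_ne (other_ne α), on_axis]
    rw [Pi.single_eq_same, units_mul_mul] at order_pos
    rw [deltaPartPos_single hN, if_neg (by omega), sub_zero]
  · rw [not_imp_comm.mp (hA.isHomog j) on_axis,
      not_imp_comm.mp (deltaPartPos_isHomog α ε A j) on_axis]

theorem IsSeries.finsum_deltaPartPos (hA : IsSeries α ε A) (m : Lattice) :
    ∑ᶠ j, deltaPartPos α ε A j m = 0 := by
  obtain ⟨N, hN⟩ := hA.exists_nat_order_le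
  exact finsum_deltaPartPos_of_le hN m

end Op

/-! ### The four families of flows -/

theorem isSeries_L₁_pow (hτ : ∀ m, τ m ≠ 0) (k : ℕ) : IsSeries 0 1 (Op.pow (L₁ τ) k) :=
  (isWaveOp_S₁ τ).isSeries_lax_pow hτ 1 k

theorem isSeries_L₂_pow (hτ : ∀ m, τ m ≠ 0) (k : ℕ) : IsSeries 1 (-1) (Op.pow (L₂ τ) k) :=
  (isWaveOp_S₂ τ).isSeries_lax_pow hτ (-1) k

theorem isSeries_L₃_pow (hτ : ∀ m, τ m ≠ 0) (k : ℕ) : IsSeries 0 (-1) (Op.pow (L₃ τ) k) :=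
  (isWaveOp_S₃ τ).isSeries_lax_pow hτ (-1) k

theorem isSeries_L₃'_pow (hτ : ∀ m, τ m ≠ 0) (k : ℕ) : IsSeries 1 1 (Op.pow (L₃' τ) k) :=
  (isWaveOp_S₃' τ).isSeries_lax_pow hτ 1 k

theorem isLaurentPoly_B₁ (hτ : ∀ m, τ m ≠ 0) (k : ℕ+) : IsLaurentPoly (B₁ τ k) :=
  ((isSeries_L₁_pow hτ k).part 0 _).isLaurentPoly (c := 0) fun j hj => by
    simpa using (part_ne_zero hj).1

theorem isLaurentPoly_B₂ (hτ : ∀ m, τ m ≠ 0) (k : ℕ+) : IsLaurentPoly (B₂ τ k) :=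
  (isSeries_L₂_pow hτ k).isLaurentPoly_deltaPartPos

theorem isLaurentPoly_B₃ (hτ : ∀ m, τ m ≠ 0) (k : ℕ+) : IsLaurentPoly (B₃ τ k) :=
  ((isSeries_L₃_pow hτ k).part 0 _).isLaurentPoly (c := 0) fun j hj => by
    simpa using (part_ne_zero hj).1.le

theorem isLaurentPoly_B₃' (hτ : ∀ m, τ m ≠ 0) (k : ℕ+) : IsLaurentPoly (B₃' τ k) :=
  (isSeries_L₃'_pow hτ k).isLaurentPoly_deltaPartPos

theorem isSeries_B₁ (hτ : ∀ m, τ m ≠ 0) (k : ℕ+) (ε : ℤˣ) : IsSeries 0 ε (B₁ τ k) :=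
  (isLaurentPoly_B₁ hτ k).isSeries ((isSeries_L₁_pow hτ k).part 0 _).isHomog ε

theorem isSeries_B₂ (hτ : ∀ m, τ m ≠ 0) (k : ℕ+) (ε : ℤˣ) : IsSeries 1 ε (B₂ τ k) :=
  (isLaurentPoly_B₂ hτ k).isSeries (deltaPartPos_isHomog 1 (-1) _) ε

theorem isSeries_B₃ (hτ : ∀ m, τ m ≠ 0) (k : ℕ+) (ε : ℤˣ) : IsSeries 0 ε (B₃ τ k) :=
  (isLaurentPoly_B₃ hτ k).isSeries ((isSeries_L₃_pow hτ k).part 0 _).isHomog ε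

theorem isSeries_B₃' (hτ : ∀ m, τ m ≠ 0) (k : ℕ+) (ε : ℤˣ) : IsSeries 1 ε (B₃' τ k) :=
  (isLaurentPoly_B₃' hτ k).isSeries (deltaPartPos_isHomog 1 1 _) ε

theorem dt_wave_zero_eq_zero (hτ : ∀ m, τ m ≠ 0) (σ : TimeIdx) {n : ℤ} {m : Lattice}
    (hn : lead 0 m ≤ n) : dt σ (wave τ 0 n m) = 0 := by
  rcases hn.eq_or_lt with rfl | hn
  · rw [wave_lead]
    simp [sgn, latShift, ι_ne_zero (hτ m)]
  · rw [wave_eq_zero_of_lt (by simpa [dir] using hn), dt_zero]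

theorem dt_wave_eq_zero (σ : TimeIdx) {j : Fin 3} {n : ℤ} {m : Lattice}
    (h : (dir j : ℤ) * n < dir j * lead j m) : dt σ (wave τ j n m) = 0 := by
  rw [wave_eq_zero_of_lt h, dt_zero]

theorem flowD_of_ne {σ : TimeIdx} {j : Fin 3} (h : σ.1 ≠ j) (n : ℤ) (m : Lattice) :
    flowD σ j (wave τ j) n m = dt σ (wave τ j n m) := by
  rw [flowD, if_neg h, add_zero]

theorem flowD_sub_act_eq_zero {σ : TimeIdx} {j : Fin 3} (hσ : σ.1 ≠ j) {B : Op} {n : ℤ}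
    {m : Lattice} (dt_wave : dt σ (wave τ j n m) = 0)
    (lt_lead : ∀ i, B i ≠ 0 → (dir j : ℤ) * n < dir j * lead j (m + i)) :
    flowD σ j (wave τ j) n m - act B (wave τ j n) m = 0 := by
  rw [flowD_of_ne hσ, dt_wave, act_eq_zero fun i hi => wave_eq_zero_of_lt (lt_lead i hi), sub_zero]

/-- An operator in `Λ_2` alone preserves the leading exponent of the first wave function, whose
leading coefficient is one. -/
theorem flowD_sub_act_wave_zero_eq_zero (hτ : ∀ m, τ m ≠ 0) {σ : TimeIdx} (hσ : σ.1 ≠ 0) {B : Op}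
    (hB : IsHomog 0 0 B) (sum_eq_zero : ∀ m, ∑ᶠ j, B j m = 0) {n : ℤ} {m : Lattice}
    (hn : lead 0 m ≤ n) : flowD σ 0 (wave τ 0) n m - act B (wave τ 0 n) m = 0 := by
  have lead_add (k : Lattice) (hk : B k ≠ 0) : lead 0 (m + k) = lead 0 m := by
    simp [lead, hB k hk]
  rcases hn.eq_or_lt with rfl | hn
  · rw [flowD_of_ne hσ, dt_wave_zero_eq_zero hτ σ le_rfl, zero_sub, neg_eq_zero, act,
      ← sum_eq_zero m]
    refine finsum_congr fun k => ?_
    by_cases hk : B k = 0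
    · rw [hk, Pi.zero_apply, MulZeroClass.zero_mul]
    · rw [← lead_add k hk, wave_lead]
      simp [sgn, latShift, ι_ne_zero (hτ (m + k))]
  · refine flowD_sub_act_eq_zero hσ (dt_wave_zero_eq_zero hτ σ hn.le) fun k hk => ?_
    rw [lead_add k hk]
    simpa [dir] using hn

theorem IsWaveOp.flowD_sub_act_eq_zero (hτ : ∀ m, τ m ≠ 0) {j : Fin 3} {S : Op}
    (hS : IsWaveOp τ j α ε S) {k : ℕ+} {B : Op} (hB : IsSeries α ε B) {c : ℤ}
    (order_le : ∀ i, (Op.pow (S * Lam α ε * inv α ε S) k - B) i ≠ 0 → (ε : ℤ) * i α ≤ c)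
    {n : ℤ} {m : Lattice} (dt_wave : dt (j, k) (wave τ j n m) = 0)
    (h : (dir j : ℤ) * (n - lead j m) + c < 0) :
    flowD (j, k) j (wave τ j) n m - act B (wave τ j n) m = 0 := by
  have remainder_isSeries : IsSeries α ε (Op.pow (S * Lam α ε * inv α ε S) k - B) := by
    rw [sub_eq_add_neg]
    exact (hS.isSeries_lax_pow hτ ε k).add hB.neg
  rw [hS.flowD_sub_act hτ hB remainder_isSeries (add_sub_cancel _ _).symm, dt_wave,
    hS.act_wave_eq_zero remainder_isSeries order_le h, add_zero]

theorem sub_part_ne_zero {γ : Fin 2} {P : ℤ → Prop} {A : Op} {j : Lattice}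
    (h : (A - part γ P A) j ≠ 0) : ¬ P (j γ) := fun hP => h <| by
  classical
  funext m
  rw [sub_apply, part_apply, if_pos hP, sub_self, Pi.zero_apply]

theorem IsTau.act_B₁ (hτ : IsTau τ) (k : ℕ+) (j : Fin 3) (n : ℤ) (m : Lattice) :
    act (B₁ τ k) (wave τ j n) m = flowD (0, k) j (wave τ j) n m := by
  have hB (i : Lattice) (hi : B₁ τ k i ≠ 0) : 0 ≤ i 0 ∧ i 1 = 0 :=
    ⟨(part_ne_zero hi).1, (isSeries_B₁ hτ.ne_zero k 1).isHomog i hi⟩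
  refine hτ.act_wave_eq_flowD (isLaurentPoly_B₁ hτ.ne_zero k) (0, k) (fun m n hn => ?_)
    (fun m n hn => ?_) (fun m n hn => ?_) j n m
  · refine (isWaveOp_S₁ τ).flowD_sub_act_eq_zero hτ.ne_zero (isSeries_B₁ hτ.ne_zero k 1) (c := -1)
      (fun i hi => ?_) (dt_wave_zero_eq_zero hτ.ne_zero _ hn) (by simp [dir]; omega)
    have order_neg := sub_part_ne_zero hi
    simp only [Units.val_one]
    omega
  · refine flowD_sub_act_eq_zero (by simp) (dt_wave_eq_zero _ (by simpa [dir] using hn))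
      fun i hi => ?_
    simpa [dir, lead, (hB i hi).2] using hn
  · refine flowD_sub_act_eq_zero (by simp) (dt_wave_eq_zero _ (by simpa [dir] using hn))
      fun i hi => ?_
    have order := hB i hi
    simp only [dir, lead, Matrix.cons_val, Units.val_one, Pi.add_apply] at hn ⊢
    omega

theorem IsTau.act_B₂ (hτ : IsTau τ) (k : ℕ+) (j : Fin 3) (n : ℤ) (m : Lattice) :
    act (B₂ τ k) (wave τ j n) m = flowD (1, k) j (wave τ j) n m := by
  have pow_isSeries := isSeries_L₂_pow hτ.ne_zero k
  have homog : IsHomog 0 0 (B₂ τ k) := deltaPartPos_isHomog 1 (-1) _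
  refine hτ.act_wave_eq_flowD (isLaurentPoly_B₂ hτ.ne_zero k) (1, k) (fun m n hn => ?_)
    (fun m n hn => ?_) (fun m n hn => ?_) j n m
  · exact flowD_sub_act_wave_zero_eq_zero hτ.ne_zero (by simp) homog
      pow_isSeries.finsum_deltaPartPos hn
  · exact (isWaveOp_S₂ τ).flowD_sub_act_eq_zero hτ.ne_zero (isSeries_B₂ hτ.ne_zero k (-1))
      (fun i => pow_isSeries.sub_deltaPartPos_order_nonpos)
      (dt_wave_eq_zero _ (by simpa [dir] using hn)) (by simpa [dir] using hn)
  · refine flowD_sub_act_eq_zero (by simp) (dt_wave_eq_zero _ (by simpa [dir] using hn))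
      fun i hi => ?_
    have degree_zero := homog i hi
    have order_nonneg := deltaPartPos_order_nonneg hi
    simp only [dir, lead, Matrix.cons_val, Units.val_neg, Units.val_one,
      Pi.add_apply] at hn order_nonneg ⊢
    omega

theorem IsTau.act_B₃ (hτ : IsTau τ) (k : ℕ+) (j : Fin 3) (n : ℤ) (m : Lattice) :
    act (B₃ τ k) (wave τ j n) m = flowD (2, k) j (wave τ j) n m := by
  have hB (i : Lattice) (hi : B₃ τ k i ≠ 0) : i 0 < 0 ∧ i 1 = 0 :=
    ⟨(part_ne_zero hi).1, (isSeries_B₃ hτ.ne_zero k 1).isHomog i hi⟩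
  refine hτ.act_wave_eq_flowD (isLaurentPoly_B₃ hτ.ne_zero k) (2, k) (fun m n hn => ?_)
    (fun m n hn => ?_) (fun m n hn => ?_) j n m
  · refine flowD_sub_act_eq_zero (by simp) (dt_wave_zero_eq_zero hτ.ne_zero _ hn) fun i hi => ?_
    have order := hB i hi
    simp only [dir, lead, Matrix.cons_val, Units.val_neg, Units.val_one, Pi.add_apply] at hn ⊢
    omega
  · refine flowD_sub_act_eq_zero (by simp) (dt_wave_eq_zero _ (by simpa [dir] using hn))
      fun i hi => ?_
    simpa [dir, lead, (hB i hi).2] using hn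
  · refine (isWaveOp_S₃ τ).flowD_sub_act_eq_zero hτ.ne_zero (isSeries_B₃ hτ.ne_zero k (-1))
      (c := 0) (fun i hi => ?_) (dt_wave_eq_zero _ (by simpa [dir] using hn))
      (by simpa [dir] using hn)
    simpa using sub_part_ne_zero hi

theorem IsTau.act_B₃' (hτ : IsTau τ) (k : ℕ+) (j : Fin 3) (n : ℤ) (m : Lattice) :
    act (B₃' τ k) (wave τ j n) m = flowD (2, k) j (wave τ j) n m := by
  have pow_isSeries := isSeries_L₃'_pow hτ.ne_zero k
  have homog : IsHomog 0 0 (B₃' τ k) := deltaPartPos_isHomog 1 1 _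
  refine hτ.act_wave_eq_flowD (isLaurentPoly_B₃' hτ.ne_zero k) (2, k) (fun m n hn => ?_)
    (fun m n hn => ?_) (fun m n hn => ?_) j n m
  · exact flowD_sub_act_wave_zero_eq_zero hτ.ne_zero (by simp) homog
      pow_isSeries.finsum_deltaPartPos hn
  · refine flowD_sub_act_eq_zero (by simp) (dt_wave_eq_zero _ (by simpa [dir] using hn))
      fun i hi => ?_
    have order_nonneg := deltaPartPos_order_nonneg hi
    simp only [dir, lead, Matrix.cons_val, Units.val_one, Pi.add_apply] at hn order_nonneg ⊢
    omega
  · exact (isWaveOp_S₃' τ).flowD_sub_act_eq_zero hτ.ne_zero (isSeries_B₃' hτ.ne_zero k 1)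
      (fun i => pow_isSeries.sub_deltaPartPos_order_nonpos)
      (dt_wave_eq_zero _ (by simpa [dir] using hn)) (by simpa [dir] using hn)

theorem IsTau.lax_of_isHomog_one (hτ : IsTau τ) {B : Op} (hB : IsLaurentPoly B)
    (homog : IsHomog 1 0 B) {σ : TimeIdx}
    (linear : ∀ j n m, act B (wave τ j n) m = flowD σ j (wave τ j) n m) :
    (L₁ τ).deriv σ = B.comm (L₁ τ) ∧
      (L₂ τ).deriv σ = (proj τ 1 (-1) B).comm (L₂ τ) ∧
      (L₃ τ).deriv σ = B.comm (L₃ τ) ∧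
      (L₃' τ).deriv σ = (proj τ 1 1 B).comm (L₃' τ) :=
  ⟨(isWaveOp_S₁ τ).lax hτ.ne_zero (hB.isSeries (α := 0) homog 1) σ (linear 0) 1,
    (isWaveOp_S₂ τ).lax_proj hτ (hB.isMixed 1 (-1)) σ (linear 1) (-1),
    (isWaveOp_S₃ τ).lax hτ.ne_zero (hB.isSeries (α := 0) homog (-1)) σ (linear 2) (-1),
    (isWaveOp_S₃' τ).lax_proj hτ (hB.isMixed 1 1) σ (linear 2) 1⟩

theorem IsTau.lax_of_isHomog_zero (hτ : IsTau τ) {B : Op} (hB : IsLaurentPoly B)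
    (homog : IsHomog 0 0 B) {σ : TimeIdx}
    (linear : ∀ j n m, act B (wave τ j n) m = flowD σ j (wave τ j) n m) :
    (L₁ τ).deriv σ = (proj τ 0 1 B).comm (L₁ τ) ∧
      (L₂ τ).deriv σ = B.comm (L₂ τ) ∧
      (L₃ τ).deriv σ = (proj τ 0 (-1) B).comm (L₃ τ) ∧
      (L₃' τ).deriv σ = B.comm (L₃' τ) :=
  ⟨(isWaveOp_S₁ τ).lax_proj hτ (hB.isMixed 0 1) σ (linear 0) 1,
    (isWaveOp_S₂ τ).lax hτ.ne_zero (hB.isSeries (α := 1) homog (-1)) σ (linear 1) (-1),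
    (isWaveOp_S₃ τ).lax_proj hτ (hB.isMixed 0 (-1)) σ (linear 2) (-1),
    (isWaveOp_S₃' τ).lax hτ.ne_zero (hB.isSeries (α := 1) homog 1) σ (linear 2) 1⟩

end ThreeKP

end

theorem mainTheorem1 (τ : ThreeKP.Lattice → ThreeKP.TSeries) (hτ : ThreeKP.IsTau τ) :
    -- the inverses of the wave operators exist and are unique
    ((∃! T, ThreeKP.Op.IsInv 0 1 (ThreeKP.S₁ τ) T) ∧
      (∃! T, ThreeKP.Op.IsInv 1 (-1) (ThreeKP.S₂ τ) T) ∧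
      (∃! T, ThreeKP.Op.IsInv 0 (-1) (ThreeKP.S₃ τ) T) ∧
      (∃! T, ThreeKP.Op.IsInv 1 1 (ThreeKP.S₃' τ) T)) ∧
    -- the four projections are well defined, and the operators `B` lie in their domains
    (∀ (α : Fin 2) (ε : ℤˣ) (A : ThreeKP.Op), ThreeKP.Op.IsMixed α ε A →
      ∃! P, ThreeKP.IsProj τ α ε A P) ∧
    (∀ k : ℕ+, ThreeKP.Op.IsLaurentPoly (ThreeKP.B₁ τ k) ∧
      ThreeKP.Op.IsLaurentPoly (ThreeKP.B₂ τ k) ∧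
      ThreeKP.Op.IsLaurentPoly (ThreeKP.B₃ τ k) ∧
      ThreeKP.Op.IsLaurentPoly (ThreeKP.B₃' τ k)) ∧
    -- the flow of the first family of times
    (∀ k : ℕ+,
      (ThreeKP.L₁ τ).deriv (0, k) = (ThreeKP.B₁ τ k).comm (ThreeKP.L₁ τ) ∧
      (ThreeKP.L₂ τ).deriv (0, k) =
        (ThreeKP.proj τ 1 (-1) (ThreeKP.B₁ τ k)).comm (ThreeKP.L₂ τ) ∧
      (ThreeKP.L₃ τ).deriv (0, k) = (ThreeKP.B₁ τ k).comm (ThreeKP.L₃ τ) ∧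
      (ThreeKP.L₃' τ).deriv (0, k) =
        (ThreeKP.proj τ 1 1 (ThreeKP.B₁ τ k)).comm (ThreeKP.L₃' τ)) ∧
    -- the flow of the second family of times
    (∀ k : ℕ+,
      (ThreeKP.L₁ τ).deriv (1, k) =
        (ThreeKP.proj τ 0 1 (ThreeKP.B₂ τ k)).comm (ThreeKP.L₁ τ) ∧
      (ThreeKP.L₂ τ).deriv (1, k) = (ThreeKP.B₂ τ k).comm (ThreeKP.L₂ τ) ∧
      (ThreeKP.L₃ τ).deriv (1, k) =
        (ThreeKP.proj τ 0 (-1) (ThreeKP.B₂ τ k)).comm (ThreeKP.L₃ τ) ∧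
      (ThreeKP.L₃' τ).deriv (1, k) = (ThreeKP.B₂ τ k).comm (ThreeKP.L₃' τ)) ∧
    -- the flow of the third family of times, in terms of `Λ_1`
    (∀ k : ℕ+,
      (ThreeKP.L₁ τ).deriv (2, k) = (ThreeKP.B₃ τ k).comm (ThreeKP.L₁ τ) ∧
      (ThreeKP.L₂ τ).deriv (2, k) =
        (ThreeKP.proj τ 1 (-1) (ThreeKP.B₃ τ k)).comm (ThreeKP.L₂ τ) ∧
      (ThreeKP.L₃ τ).deriv (2, k) = (ThreeKP.B₃ τ k).comm (ThreeKP.L₃ τ) ∧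
      (ThreeKP.L₃' τ).deriv (2, k) =
        (ThreeKP.proj τ 1 1 (ThreeKP.B₃ τ k)).comm (ThreeKP.L₃' τ)) ∧
    -- the flow of the third family of times, in terms of `Λ_2`
    (∀ k : ℕ+,
      (ThreeKP.L₁ τ).deriv (2, k) =
        (ThreeKP.proj τ 0 1 (ThreeKP.B₃' τ k)).comm (ThreeKP.L₁ τ) ∧
      (ThreeKP.L₂ τ).deriv (2, k) = (ThreeKP.B₃' τ k).comm (ThreeKP.L₂ τ) ∧
      (ThreeKP.L₃ τ).deriv (2, k) =
        (ThreeKP.proj τ 0 (-1) (ThreeKP.B₃' τ k)).comm (ThreeKP.L₃ τ) ∧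
      (ThreeKP.L₃' τ).deriv (2, k) = (ThreeKP.B₃' τ k).comm (ThreeKP.L₃' τ)) := by
  have ne_zero := hτ.ne_zero
  have b₁ := ThreeKP.isLaurentPoly_B₁ ne_zero
  have b₂ := ThreeKP.isLaurentPoly_B₂ ne_zero
  have b₃ := ThreeKP.isLaurentPoly_B₃ ne_zero
  have b₃' := ThreeKP.isLaurentPoly_B₃' ne_zero
  exact ⟨⟨(ThreeKP.isWaveOp_S₁ τ).existsUnique_isInv ne_zero,
      (ThreeKP.isWaveOp_S₂ τ).existsUnique_isInv ne_zero,
      (ThreeKP.isWaveOp_S₃ τ).existsUnique_isInv ne_zero,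
      (ThreeKP.isWaveOp_S₃' τ).existsUnique_isInv ne_zero⟩,
    fun α ε A hA => ThreeKP.existsUnique_isProj ne_zero hA,
    fun k => ⟨b₁ k, b₂ k, b₃ k, b₃' k⟩,
    fun k => hτ.lax_of_isHomog_one (b₁ k) (ThreeKP.isSeries_B₁ ne_zero k 1).isHomog (hτ.act_B₁ k),
    fun k => hτ.lax_of_isHomog_zero (b₂ k) (ThreeKP.isSeries_B₂ ne_zero k 1).isHomog (hτ.act_B₂ k),
    fun k => hτ.lax_of_isHomog_one (b₃ k) (ThreeKP.isSeries_B₃ ne_zero k 1).isHomog (hτ.act_B₃ k),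
    fun k => hτ.lax_of_isHomog_zero (b₃' k) (ThreeKP.isSeries_B₃' ne_zero k 1).isHomog
      (hτ.act_B₃' k)⟩
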